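/- Let $d\ge 0$, let $\mathbb{P}^d=\mathbb{P}(\mathbb{R}^{d+1})$ be the real projective space, and let $\Omega\subset\mathbb{P}^d$ be a properly convex open set, i.e. a nonempty open set contained in some affine chart (complement of a projective hyperplane) in which it is convex and bounded. Let $d_\Omega$ be the Hilbert distance on $\Omega$: $d_\Omega(x,x)=0$ and, for $x\ne y$, $d_\Omega(x,y)=\frac12\ln\frac{|py|\,|qx|}{|px|\,|qy|}$, computed in an affine chart containing $\overline\Omega$, where $p,q$ are the points at which the line $(xy)$ meets $\partial\Omega$, with $x$ between $p$ and $y$, and $y$ between $x$ and $q$. The space $(\Omega,d_\Omega)$ is Gromov-hyperbolic if there is a $\delta$ such that for all $x,y,z\in\Omega$ and all geodesics $[x,y],[y,z],[z,x]$, every point of $[x,y]$ is at distance at most $\delta$ from some point of $[y,z]\cup[z,x]$. The set $\Omega$ is strictly convex if $\partial\Omega$ contains no non-trivial segment, and has $C^1$ boundary if $\partial\Omega$ is a hypersurface of class $C^1$ of $\mathbb{P}^d$. Let $X$ be the space of all properly convex open subsets of $\mathbb{P}^d$ with the Hausdorff topology (two sets are close if their closures are close for the Hausdorff distance). (a) The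 following properties are equivalent: 1. the metric space $(\Omega,d_\Omega)$ is Gromov-hyperbolic; 2. every element of the closure in $X$ of the orbit $\mathrm{PGL}_{d+1}(\mathbb{R})\cdot\Omega$ is strictly convex; 3. every element of the closure in $X$ of the orbit $\mathrm{PGL}_{d+1}(\mathbb{R})\cdot\Omega$ has $C^1$ boundary. (b) Let $\Omega^*\subset\mathbb{P}((\mathbb{R}^{d+1})^*)$ be the dual of $\Omega$, that is, the image in $\mathbb{P}((\mathbb{R}^{d+1})^*)$ of $\{f \mid f(v)>0 \text{ for all } v\in\overline{C}\smallsetminus\{0\}\}$, where $C$ is one of the connected components of the preimage of $\Omega$ in $\mathbb{R}^{d+1}\smallsetminus\{0\}$. Then $(\Omega,d_\Omega)$ is Gromov-hyperbolic if and only if $(\Omega^*,d_{\Omega^*})$ is Gromov-hyperbolic. (c) If $\Omega$ is strictly convex and divisible, i.e. there is a discrete subgroup $\Gamma$ of $\mathrm{PGL}_{d+1}(\mathbb{R})$ preserving $\Omega$ such that $\Omega/\Gamma$ is compact, then $(\Omega,d_\Omega)$ is Gromov-hyperbolic. -/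

import Mathlib

open scoped LinearAlgebra.Projectivization MatrixGroups

namespace HilbertGeometry

/-- The topology of the projective space `ℙ(E)`: the quotient topology from `E ∖ {0}`. -/
instance projTopology {E : Type*} [NormedAddCommGroup E] [NormedSpace ℝ E] :
    TopologicalSpace (ℙ ℝ E) :=
  inferInstanceAs (TopologicalSpace (Quotient (projectivizationSetoid ℝ E)))

/-- The topology of `PGL_n(ℝ)`: the quotient topology from `GL_n(ℝ)`. -/
instance pglTopology {n : Type*} [Fintype n] [DecidableEq n] :
    TopologicalSpace (Matrix.ProjGenLinGroup n ℝ) :=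
  TopologicalSpace.coinduced (Matrix.ProjGenLinGroup.mk : GL n ℝ → Matrix.ProjGenLinGroup n ℝ)
    inferInstance

section Convexity

variable {E : Type*} [NormedAddCommGroup E] [NormedSpace ℝ E]

/-- The preimage in `E ∖ {0}` of a subset `S` of `ℙ(E)`. -/
def preimg (S : Set (ℙ ℝ E)) : Set E :=
  {v | ∃ hv : v ≠ 0, Projectivization.mk ℝ v hv ∈ S}

/-- The affine chart of `ℙ(E)` given by a linear form `φ`: the complement of the projective
hyperplane `φ = 0`. -/
def affineChart (φ : StrongDual ℝ E) : Set (ℙ ℝ E) :=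
  {x | φ x.rep ≠ 0}

/-- The part of `S` lying in the chart `affineChart φ`, seen as a subset of the affine
hyperplane `{v | φ v = 1}` of `E`, which is a model of this chart. -/
def inChart (φ : StrongDual ℝ E) (S : Set (ℙ ℝ E)) : Set E :=
  {v | φ v = 1 ∧ v ∈ preimg S}

/-- A nonempty open subset of `ℙ(E)` that is contained in an affine chart in which it is convex
and bounded. -/
structure IsProperlyConvexOpen (Ω : Set (ℙ ℝ E)) : Prop where
  nonempty : Ω.Nonempty
  isOpen : IsOpen Ω
  exists_chart : ∃ φ : StrongDual ℝ E, Ω ⊆ affineChart φ ∧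
    Convex ℝ (inChart φ Ω) ∧ Bornology.IsBounded (inChart φ Ω)

/-- The boundary of `Ω` contains no non-trivial projective segment. Here `u` and `v` are lifts of
the (distinct) endpoints. -/
def IsStrictlyConvex (Ω : Set (ℙ ℝ E)) : Prop :=
  ∀ u v : E, LinearIndependent ℝ ![u, v] → ¬ (segment ℝ u v ⊆ preimg (frontier Ω))

/-- The boundary of `Ω` is a hypersurface (submanifold of codimension one) of class `C¹` of
`ℙ(E)`. As `E ∖ {0} → ℙ(E)` is a submersion, this means that the preimage of the boundary is a
`C¹` hypersurface of `E ∖ {0}`, i.e. is locally the zero set of a `C¹` function whose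
differential does not vanish. -/
def HasC1Boundary (Ω : Set (ℙ ℝ E)) : Prop :=
  ∀ v ∈ preimg (frontier Ω), ∃ (U : Set E) (f : E → ℝ), IsOpen U ∧ v ∈ U ∧ ContDiffOn ℝ 1 f U ∧
    (∀ w ∈ U, fderiv ℝ f w ≠ 0) ∧ ∀ w ∈ U, w ∈ preimg (frontier Ω) ↔ f w = 0

/-- `r` is the Hilbert distance between the points `x` and `y` of `Ω`: either `x = y` and `r = 0`,
or `r` is half the logarithm of the cross-ratio `[p : x : y : q]`, computed in an affine chart
containing the closure of `Ω`, where `p, q` are the intersection points of the line `(xy)` with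
the boundary of `Ω`, such that `x` is between `p` and `y`, and `y` is between `x` and `q`.
The points `x, y, p, q` are represented by the vectors `a, b, p, q` in the hyperplane `φ = 1`. -/
def IsHilbertDist (Ω : Set (ℙ ℝ E)) (x y : ℙ ℝ E) (r : ℝ) : Prop :=
  (x = y ∧ r = 0) ∨
  (x ≠ y ∧ ∃ φ : StrongDual ℝ E, closure Ω ⊆ affineChart φ ∧
    ∃ p a b q : E, a ∈ inChart φ {x} ∧ b ∈ inChart φ {y} ∧
      p ∈ inChart φ (frontier Ω) ∧ q ∈ inChart φ (frontier Ω) ∧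
      a ∈ openSegment ℝ p b ∧ b ∈ openSegment ℝ a q ∧
      r = 1 / 2 * Real.log ((‖b - p‖ * ‖a - q‖) / (‖a - p‖ * ‖b - q‖)))

/-- The Hilbert distance of `Ω` (relevant only for points of `Ω`). -/
noncomputable def hilbertDist (Ω : Set (ℙ ℝ E)) (x y : ℙ ℝ E) : ℝ :=
  Classical.epsilon (IsHilbertDist Ω x y)

/-- `C` is a cone above `Ω`: one of the connected components of the preimage of `Ω`. -/
def IsConeAbove (Ω : Set (ℙ ℝ E)) (C : Set E) : Prop :=
  ∃ v ∈ preimg Ω, C = connectedComponentIn (preimg Ω) v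

/-- The dual `C* = {f | f > 0 on closure C ∖ {0}}` of a convex cone. -/
def dualCone (C : Set E) : Set (StrongDual ℝ E) :=
  {f | ∀ x ∈ closure C \ {0}, 0 < f x}

/-- The dual `Ω* ⊆ ℙ(E*)` of `Ω`: the projection of the dual of a cone above `Ω`. (It does not
depend on the chosen cone, the other choice being the opposite cone.) -/
def dual (Ω : Set (ℙ ℝ E)) : Set (ℙ ℝ (StrongDual ℝ E)) :=
  {x | ∃ C, IsConeAbove Ω C ∧ ∃ (f : StrongDual ℝ E) (hf : f ≠ 0),
    f ∈ dualCone C ∧ x = Projectivization.mk ℝ f hf}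

/-- The space `X` of all properly convex open subsets of `ℙ(E)`. -/
def ConvexOpens (E : Type*) [NormedAddCommGroup E] [NormedSpace ℝ E] : Type _ :=
  {Ω : Set (ℙ ℝ E) // IsProperlyConvexOpen Ω}

/-- The trace on the unit sphere of `E` of the lines belonging to `S`. -/
def sphericalTrace (S : Set (ℙ ℝ E)) : Set E :=
  {v | ‖v‖ = 1 ∧ v ∈ preimg S}

/-- The Hausdorff distance on `X`. The spherical traces being symmetric, this is the Hausdorff
distance between subsets of `ℙ(E)` for the metric `d([u], [v]) = min ‖u - v‖ ‖u + v‖`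
(`u, v` unit vectors) of `ℙ(E)`. It does not change when the sets are replaced by their
closures. -/
noncomputable instance : PseudoEMetricSpace (ConvexOpens E) where
  edist Ω₁ Ω₂ := Metric.hausdorffEDist (sphericalTrace Ω₁.1) (sphericalTrace Ω₂.1)
  edist_self _ := Metric.hausdorffEDist_self
  edist_comm _ _ := Metric.hausdorffEDist_comm
  edist_triangle _ _ _ := Metric.hausdorffEDist_triangle

end Convexity

section Hyperbolicity

variable {X : Type*}

/-- `G` is (the image of) a geodesic from `x` to `y` in the set `S` with the distance `d`. -/
def IsGeodesic (S : Set X) (d : X → X → ℝ) (x y : X) (G : Set X) : Prop :=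
  ∃ (L : ℝ) (γ : ℝ → X), 0 ≤ L ∧ γ 0 = x ∧ γ L = y ∧ (∀ t ∈ Set.Icc 0 L, γ t ∈ S) ∧
    (∀ s ∈ Set.Icc 0 L, ∀ t ∈ Set.Icc 0 L, d (γ s) (γ t) = |s - t|) ∧ G = γ '' Set.Icc 0 L

/-- Gromov-hyperbolicity of the set `S` with the distance `d`: there is `δ` such that all the
geodesic triangles of `S` are `δ`-thin. -/
def GromovHyperbolic (S : Set X) (d : X → X → ℝ) : Prop :=
  ∃ δ : ℝ, ∀ x ∈ S, ∀ y ∈ S, ∀ z ∈ S, ∀ Gxy Gyz Gzx : Set X,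
    IsGeodesic S d x y Gxy → IsGeodesic S d y z Gyz → IsGeodesic S d z x Gzx →
      ∀ u ∈ Gxy, ∃ v ∈ Gyz ∪ Gzx, d u v ≤ δ

/-- The metric space `(Ω, d_Ω)` is Gromov-hyperbolic. -/
def IsGromovHyperbolic {E : Type*} [NormedAddCommGroup E] [NormedSpace ℝ E]
    (Ω : Set (ℙ ℝ E)) : Prop :=
  GromovHyperbolic Ω (hilbertDist Ω)

end Hyperbolicity

section Action

variable {d : ℕ}

/-- The orbit `PGL_{d+1}(ℝ) · Ω`, as a subset of the space `X` of properly convex open sets. -/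
def pglOrbit (Ω : Set (ℙ ℝ (Fin (d + 1) → ℝ))) : Set (ConvexOpens (Fin (d + 1) → ℝ)) :=
  {Ω' | ∃ g : PGL(Fin (d + 1), ℝ), Ω'.1 = (fun x => g • x) '' Ω}

/-- The quotient `Ω / Γ`: two points of `Ω` are identified if they are in the same `Γ`-orbit. -/
abbrev quotientBy (Ω : Set (ℙ ℝ (Fin (d + 1) → ℝ))) (Γ : Subgroup PGL(Fin (d + 1), ℝ)) : Type :=
  Quotient ((MulAction.orbitRel Γ (ℙ ℝ (Fin (d + 1) → ℝ))).comap (Subtype.val : Ω → _))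

/-- There is a discrete group of projective transformations preserving `Ω` with compact
quotient (for the quotient topology). -/
def IsDivisible (Ω : Set (ℙ ℝ (Fin (d + 1) → ℝ))) : Prop :=
  ∃ Γ : Subgroup PGL(Fin (d + 1), ℝ), DiscreteTopology Γ ∧
    (∀ g ∈ Γ, (fun x => g • x) '' Ω = Ω) ∧ CompactSpace (quotientBy Ω Γ)

end Action

end HilbertGeometry

/-! Everything is transported from `Ω` to the closed convex cone `K` above it, ordered by `u ≤ v`
when `v - u ∈ K`. If `M(u,v)` is the least `r` with `u ≤ r v` (`coneRatio`), the Hilbert distance of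
the classes of `u` and `v` is half the logarithm of `M(u,v) M(v,u)`. A point of a side of a triangle
is, after rescaling the vertices, the class of `x + y`; being close to another side means that some
`w = s x + t z` or `w = s y + t z` satisfies `x + y ≤ w ≤ R (x + y)`. Thus hyperbolicity amounts to
`IsThinCone R K` for some `R` (`IsLift.isGromovHyperbolic_iff`). Straight segments are geodesics,
which gives one direction; for the other, a thin cone is strictly convex, and then equality in the
triangle inequality makes every geodesic straight.

For fixed `R`, thinness is invariant under linear isomorphisms and passes to limits of cones, so
every domain in the orbit closure inherits it. A thin cone is strictly convex, since a flat face
produces fat triangles as they approach the face. It is also smooth, since two supporting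
hyperplanes at one boundary ray produce fat triangles near that ray. Hence 1 implies 2 and 3.

Conversely, suppose that `K` is not thin for any `R`. Take triangles `x n, y n, z n` violating
thinness with constant `n`, and move `x n + y n` to the vector `1` by linear maps that keep the
cones in a compact family (`exists_gl_normalization`, by maximizing a determinant). In the limit
cone the class of `x + y` stays interior while the other two sides go to the boundary, which is
incompatible with strict convexity (`ConeTendsto.not_isStrictlyConvexCone`). So 2 implies 1. If `K`
is divisible, the dividing group itself provides the normalization and the limit cone is `K`, which
gives (c).

Duality exchanges flat faces and corners: if the dual of `K` is not thin, a limit of its images is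
not strictly convex, so a limit of images of `K` is not smooth. Since thinness of `K` makes all its
limits smooth, thinness passes to the dual cone. This gives (b), and also 3 implies 1.

Limits are taken along a nonprincipal ultrafilter, along which bounded sequences in finite dimension
converge; no subsequences are needed. -/

namespace HilbertGeometry

open Filter Topology

/-! ### Proper convex cones and their supporting forms -/

section Cones

variable {E : Type*} [NormedAddCommGroup E] [NormedSpace ℝ E]

/-- A closed convex cone with nonempty interior, whose nonzero vectors are uniformly positive for
some linear form. -/
structure IsProperCone (K : Set E) : Prop where
  isClosed : IsClosed K
  add_mem : ∀ x ∈ K, ∀ y ∈ K, x + y ∈ K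
  smul_mem : ∀ c : ℝ, 0 ≤ c → ∀ x ∈ K, c • x ∈ K
  exists_form : ∃ ψ : StrongDual ℝ E, ∃ c : ℝ, 0 < c ∧ ∀ x ∈ K, c * ‖x‖ ≤ ψ x
  nonempty_interior : (interior K).Nonempty

/-- No two independent vectors of the cone have their sum on the boundary. -/
def IsStrictlyConvexCone (K : Set E) : Prop :=
  ∀ x ∈ K, ∀ y ∈ K, x + y ∉ interior K → ¬ LinearIndependent ℝ ![x, y]

/-- The supporting hyperplane at any nonzero boundary vector is unique. -/
def IsSmoothCone (K : Set E) : Prop :=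
  ∀ p ∈ K, p ≠ 0 → ∀ f g : StrongDual ℝ E, (∀ x ∈ K, 0 ≤ f x) → (∀ x ∈ K, 0 ≤ g x) →
    f p = 0 → g p = 0 → ∀ e ∈ interior K, f e = 1 → g e = 1 → f = g

/-- The point `x + y` of the side `[x, y]` of the triangle `x, y, z` is close to another side,
uniformly in `x, y, z`. -/
def IsThinCone (R : ℝ) (K : Set E) : Prop :=
  ∀ x ∈ interior K, ∀ y ∈ interior K, ∀ z ∈ interior K, ∃ s t : ℝ, 0 ≤ s ∧ 0 ≤ t ∧
    ∃ w, (w = s • x + t • z ∨ w = s • y + t • z) ∧ w - (x + y) ∈ K ∧ R • (x + y) - w ∈ K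

namespace IsProperCone

variable {K : Set E}

theorem zero_mem (hK : IsProperCone K) : (0 : E) ∈ K := by
  obtain ⟨e, he⟩ := hK.nonempty_interior
  simpa using hK.smul_mem 0 le_rfl e (interior_subset he)

theorem convex (hK : IsProperCone K) : Convex ℝ K := by
  intro x hx y hy a b ha hb _
  exact hK.add_mem _ (hK.smul_mem a ha x hx) _ (hK.smul_mem b hb y hy)

theorem eq_zero_of_neg_mem (hK : IsProperCone K) {x : E} (hx : x ∈ K) (hx' : -x ∈ K) : x = 0 := by
  obtain ⟨ψ, c, hc, h⟩ := hK.exists_form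
  have h1 := h x hx
  have h2 := h (-x) hx'
  rw [norm_neg, map_neg] at h2
  have : c * ‖x‖ ≤ 0 := by linarith
  have h3 : ‖x‖ ≤ 0 := by
    by_contra hcon
    push Not at hcon
    nlinarith [mul_pos hc hcon]
  exact norm_le_zero_iff.1 h3

theorem add_mem_interior (hK : IsProperCone K) {x y : E} (hx : x ∈ K) (hy : y ∈ interior K) :
    x + y ∈ interior K := by
  have h : (fun v => x + v) '' interior K ⊆ interior K := by
    apply interior_maximal
    · rintro _ ⟨v, hv, rfl⟩
      exact hK.add_mem _ hx _ (interior_subset hv)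
    · exact (Homeomorph.addLeft x).isOpenMap _ isOpen_interior
  exact h ⟨y, hy, rfl⟩

theorem smul_mem_interior (hK : IsProperCone K) {c : ℝ} (hc : 0 < c) {x : E}
    (hx : x ∈ interior K) : c • x ∈ interior K := by
  have h : (fun v => c • v) '' interior K ⊆ interior K := by
    apply interior_maximal
    · rintro _ ⟨v, hv, rfl⟩
      exact hK.smul_mem _ hc.le _ (interior_subset hv)
    · exact (Homeomorph.smulOfNeZero c hc.ne').isOpenMap _ isOpen_interior
  exact h ⟨x, hx, rfl⟩

theorem exists_neg_of_notMem (hK : IsProperCone K) {x : E} (hx : x ∉ K) :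
    ∃ f : StrongDual ℝ E, (∀ v ∈ K, 0 ≤ f v) ∧ f x < 0 := by
  obtain ⟨f, u, hfx, hf⟩ := geometric_hahn_banach_point_closed hK.convex hK.isClosed hx
  have hu : u < 0 := by simpa using hf 0 hK.zero_mem
  refine ⟨f, fun v hv => ?_, hfx.trans hu⟩
  by_contra hcon
  push Not at hcon
  have := hf _ (hK.smul_mem (u / f v) (div_nonneg_of_nonpos hu.le hcon.le) v hv)
  rw [map_smul, smul_eq_mul, div_mul_cancel₀ _ hcon.ne] at this
  exact lt_irrefl _ this

theorem exists_nonpos_of_notMem_interior (hK : IsProperCone K) {x : E} (hx : x ∉ interior K) :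
    ∃ f : StrongDual ℝ E, f ≠ 0 ∧ (∀ v ∈ K, 0 ≤ f v) ∧ f x ≤ 0 := by
  obtain ⟨f, hf0, hf⟩ := geometric_hahn_banach_of_nonempty_interior_point hK.convex hx
    hK.nonempty_interior
  have h0 : 0 ≤ f x := by simpa using hf 0 hK.zero_mem
  refine ⟨-f, neg_ne_zero.2 hf0, fun v hv => ?_, by simpa using h0⟩
  by_contra hcon
  have hcon : 0 < f v := by simpa using hcon
  have := hf _ (hK.smul_mem ((f x + 1) / f v) (by positivity) v hv)
  rw [map_smul, smul_eq_mul, div_mul_cancel₀ _ hcon.ne'] at this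
  linarith

/-- A zero at an interior point would be a local minimum of `f`, so the derivative of `f`, which is
`f` itself, would vanish. -/
theorem pos_of_mem_interior {f : StrongDual ℝ E} (hf0 : f ≠ 0)
    (hf : ∀ v ∈ K, 0 ≤ f v) {x : E} (hx : x ∈ interior K) : 0 < f x := by
  refine (hf x (interior_subset hx)).lt_of_ne' fun h0 => hf0 ?_
  have hmin : IsLocalMin f x := by
    filter_upwards [mem_interior_iff_mem_nhds.1 hx] with v hv
    rw [h0]
    exact hf v hv
  exact hmin.hasFDerivAt_eq_zero f.hasFDerivAt

theorem mem_iff (hK : IsProperCone K) {x : E} :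
    x ∈ K ↔ ∀ f : StrongDual ℝ E, (∀ v ∈ K, 0 ≤ f v) → 0 ≤ f x := by
  refine ⟨fun hx f hf => hf x hx, fun h => ?_⟩
  by_contra hx
  obtain ⟨f, hf, hfx⟩ := hK.exists_neg_of_notMem hx
  exact (h f hf).not_gt hfx

theorem mem_of_forall_add_smul_mem (hK : IsProperCone K) {x e : E}
    (h : ∀ ε : ℝ, 0 < ε → x + ε • e ∈ K) : x ∈ K := by
  have hc : Tendsto (fun ε : ℝ => x + ε • e) (𝓝[>] 0) (𝓝 x) := by
    have : Tendsto (fun ε : ℝ => x + ε • e) (𝓝 0) (𝓝 (x + (0 : ℝ) • e)) :=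
      Continuous.tendsto (by fun_prop) 0
    simpa using this.mono_left nhdsWithin_le_nhds
  refine hK.isClosed.mem_of_tendsto hc ?_
  filter_upwards [self_mem_nhdsWithin] with ε hε using h ε hε

/-- Interior vectors are order units: `e - ε • v` stays interior for small `ε`, and it remains to
rescale. -/
theorem exists_smul_sub_mem_interior (hK : IsProperCone K) {e : E} (he : e ∈ interior K) (v : E) :
    ∃ s : ℝ, 0 < s ∧ s • e - v ∈ interior K := by
  have hc : Tendsto (fun ε : ℝ => e - ε • v) (𝓝[>] 0) (𝓝 e) := by
    have : Tendsto (fun ε : ℝ => e - ε • v) (𝓝 0) (𝓝 (e - (0 : ℝ) • v)) :=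
      Continuous.tendsto (by fun_prop) 0
    simpa using this.mono_left nhdsWithin_le_nhds
  obtain ⟨ε, hε, hε0⟩ := ((hc.eventually (isOpen_interior.mem_nhds he)).and
    self_mem_nhdsWithin).exists
  have hε0 : 0 < ε := hε0
  refine ⟨ε⁻¹, inv_pos.2 hε0, ?_⟩
  have := hK.smul_mem_interior (inv_pos.2 hε0) hε
  rwa [smul_sub, smul_smul, inv_mul_cancel₀ hε0.ne', one_smul] at this

theorem ne_zero_of_mem_interior [Nontrivial E] (hK : IsProperCone K) {x : E}
    (hx : x ∈ interior K) : x ≠ 0 := by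
  rintro rfl
  obtain ⟨v, hv⟩ := exists_ne (0 : E)
  have h : ∀ v, -v ∈ K := fun v => by
    obtain ⟨s, -, hs⟩ := hK.exists_smul_sub_mem_interior hx v
    simpa using interior_subset hs
  exact hv (hK.eq_zero_of_neg_mem (by simpa using h (-v)) (h v))

theorem pos_of_ne_zero {ψ : StrongDual ℝ E} {c : ℝ} (hc : 0 < c)
    (hψ : ∀ x ∈ K, c * ‖x‖ ≤ ψ x) {x : E} (hx : x ∈ K) (hx0 : x ≠ 0) : 0 < ψ x :=
  lt_of_lt_of_le (mul_pos hc (norm_pos_iff.2 hx0)) (hψ x hx)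

theorem nonneg_of_mem {ψ : StrongDual ℝ E} {c : ℝ} (hc : 0 < c)
    (hψ : ∀ x ∈ K, c * ‖x‖ ≤ ψ x) {x : E} (hx : x ∈ K) : 0 ≤ ψ x :=
  (mul_nonneg hc.le (norm_nonneg _)).trans (hψ x hx)

theorem image {F : Type*} [NormedAddCommGroup F] [NormedSpace ℝ F] (hK : IsProperCone K)
    (L : E ≃L[ℝ] F) : IsProperCone (L '' K) where
  isClosed := (L.toHomeomorph.isClosed_image).2 hK.isClosed
  add_mem := by
    rintro _ ⟨x, hx, rfl⟩ _ ⟨y, hy, rfl⟩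
    exact ⟨x + y, hK.add_mem x hx y hy, map_add L x y⟩
  smul_mem := by
    rintro c hc _ ⟨x, hx, rfl⟩
    exact ⟨c • x, hK.smul_mem c hc x hx, map_smul L c x⟩
  exists_form := by
    obtain ⟨ψ, c, hc, h⟩ := hK.exists_form
    obtain ⟨e, he⟩ := hK.nonempty_interior
    set B := ‖(L : E →L[ℝ] F)‖ + 1 with hB
    have hB0 : 0 < B := by positivity
    refine ⟨ψ.comp (L.symm : F →L[ℝ] E), c / B, by positivity, ?_⟩
    rintro _ ⟨x, hx, rfl⟩
    have h1 : ‖L x‖ ≤ B * ‖x‖ := by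
      refine ((L : E →L[ℝ] F).le_opNorm x).trans ?_
      gcongr
      linarith
    have h2 := h x hx
    simp only [ContinuousLinearMap.comp_apply, ContinuousLinearEquiv.coe_coe,
      ContinuousLinearEquiv.symm_apply_apply]
    calc c / B * ‖L x‖ ≤ c / B * (B * ‖x‖) := by gcongr
      _ = c * ‖x‖ := by field_simp
      _ ≤ _ := h2
  nonempty_interior := by
    have : interior (L '' K) = L '' interior K := (L.toHomeomorph.image_interior K).symm
    rw [this]
    exact hK.nonempty_interior.image _

end IsProperCone

theorem interior_image_equiv {F : Type*} [NormedAddCommGroup F] [NormedSpace ℝ F]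
    (L : E ≃L[ℝ] F) (K : Set E) : interior (L '' K) = L '' interior K :=
  (L.toHomeomorph.image_interior K).symm

theorem IsThinCone.image {F : Type*} [NormedAddCommGroup F] [NormedSpace ℝ F] {R : ℝ} {K : Set E}
    (h : IsThinCone R K) (L : E ≃L[ℝ] F) : IsThinCone R (L '' K) := by
  intro x hx y hy z hz
  rw [interior_image_equiv] at hx hy hz
  obtain ⟨x, hx, rfl⟩ := hx
  obtain ⟨y, hy, rfl⟩ := hy
  obtain ⟨z, hz, rfl⟩ := hz
  obtain ⟨s, t, hs, ht, w, hw, h1, h2⟩ := h x hx y hy z hz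
  refine ⟨s, t, hs, ht, L w, ?_, ⟨_, h1, by simp⟩, ⟨_, h2, by simp⟩⟩
  rcases hw with rfl | rfl
  · exact Or.inl (by simp)
  · exact Or.inr (by simp)

theorem isThinCone_image_iff {F : Type*} [NormedAddCommGroup F] [NormedSpace ℝ F] {R : ℝ}
    {K : Set E} (L : E ≃L[ℝ] F) : IsThinCone R (L '' K) ↔ IsThinCone R K := by
  refine ⟨fun h => ?_, fun h => h.image L⟩
  have := h.image L.symm
  rwa [← Set.image_comp, show (L.symm ∘ L : E → E) = id by ext; simp, Set.image_id] at this

end Cones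

end HilbertGeometry

namespace HilbertGeometry

open Filter Topology

/-! ### Thin cones are strictly convex and smooth -/

section ThinCones

variable {E : Type*} [NormedAddCommGroup E] [NormedSpace ℝ E] {K : Set E} {R : ℝ}

/-- The last point of `K` on the half-line from `a` in the direction `-b`. -/
theorem IsProperCone.exists_last (hK : IsProperCone K) {a b : E} (ha : a ∈ K) (hb : b ∈ K)
    (hb0 : b ≠ 0) : ∃ c : ℝ, 0 ≤ c ∧ a - c • b ∈ K ∧ ∀ ε : ℝ, 0 < ε → a - (c + ε) • b ∉ K := by
  obtain ⟨ψ, k, hk, hψ⟩ := hK.exists_form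
  have hb1 : 0 < ψ b := IsProperCone.pos_of_ne_zero hk hψ hb hb0
  have hcl : IsClosed {c : ℝ | 0 ≤ c ∧ a - c • b ∈ K} :=
    isClosed_Ici.inter (hK.isClosed.preimage (f := fun c : ℝ => a - c • b) (by fun_prop))
  have hcomp : IsCompact {c : ℝ | 0 ≤ c ∧ a - c • b ∈ K} := by
    refine (isCompact_Icc (a := 0) (b := ψ a / ψ b)).of_isClosed_subset hcl fun c hc => ⟨hc.1, ?_⟩
    have := IsProperCone.nonneg_of_mem hk hψ hc.2
    rw [map_sub, map_smul, smul_eq_mul] at this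
    rw [le_div_iff₀ hb1]
    linarith
  obtain ⟨c, hc, hmax⟩ := hcomp.exists_isGreatest ⟨0, le_rfl, by simpa using ha⟩
  refine ⟨c, hc.1, hc.2, fun ε hε hcon => ?_⟩
  have := hmax ⟨by linarith [hc.1], hcon⟩
  linarith

/-- One of the two cases in `IsThinCone.isStrictlyConvexCone`. -/
theorem IsProperCone.smul_sub_add_smul_mem (hK : IsProperCone K) {f ψ : StrongDual ℝ E} {k : ℝ}
    (hk : 0 < k) (hψ : ∀ v ∈ K, k * ‖v‖ ≤ ψ v) (hf : ∀ v ∈ K, 0 ≤ f v) {x y e : E}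
    (hx : x ∈ K) (hx0 : x ≠ 0) (hy : y ∈ K) (he : e ∈ K) (hfx : f x = 0) (hfy : f y = 0)
    (hfe : f e = 1) {δ s t S : ℝ} (hδ : 0 < δ) (hδ1 : δ ≤ 1) (hs : 0 ≤ s) (ht : 0 ≤ t)
    (hS : |R| * (ψ x + ψ y + 2 * ψ e) / ψ x ≤ S)
    (h1 : s • (x + δ • e) + t • e - ((x + δ • e) + (y + δ • e)) ∈ K)
    (h2 : R • ((x + δ • e) + (y + δ • e)) - (s • (x + δ • e) + t • e) ∈ K) :
    S • x - y + (2 * |R| * δ) • e ∈ K := by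
  have hψx : 0 < ψ x := IsProperCone.pos_of_ne_zero hk hψ hx hx0
  have hψe : 0 ≤ ψ e := IsProperCone.nonneg_of_mem hk hψ he
  have hψy : 0 ≤ ψ y := IsProperCone.nonneg_of_mem hk hψ hy
  have a1 := IsProperCone.nonneg_of_mem hk hψ h2
  have a2 := hf _ h2
  simp only [map_sub, map_add, map_smul, smul_eq_mul, hfx, hfy, hfe] at a1 a2
  have hR : R ≤ |R| := le_abs_self R
  have b1 : R * (ψ x + δ * ψ e + (ψ y + δ * ψ e)) ≤ |R| * (ψ x + ψ y + 2 * ψ e) := by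
    apply mul_le_mul hR _ (by positivity) (abs_nonneg R)
    nlinarith
  -- The form `ψ` bounds the coefficient `s`, whereas `f`, which vanishes at `x` and `y`, bounds the
  -- total coefficient of `e` by a multiple of `δ`.
  have hsS : s ≤ S := by
    refine le_trans ?_ hS
    rw [le_div_iff₀ hψx]
    nlinarith [mul_nonneg hs (mul_nonneg hδ.le hψe), mul_nonneg ht hψe]
  have c1 : 0 ≤ 2 * |R| * δ - (s * δ + t - 2 * δ) := by
    nlinarith [mul_le_mul_of_nonneg_right hR hδ.le]
  have h3 := hK.add_mem _ (hK.add_mem _ h1 _ (hK.smul_mem (S - s + 1) (by linarith) x hx)) _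
    (hK.smul_mem _ c1 e he)
  convert h3 using 1
  module

/-- If `a + b` lies on the boundary with `a, b` independent, a supporting form `f` vanishes at both.
Pushing `a` and `b` along their plane to extreme vectors `x, y` makes `x - ε y` and `y - ε x` leave
`K` for every `ε > 0`. Thinness of the triangles `x + δ e, y + δ e, e` with `δ → 0` would put `S x -
y` or `S y - x` in `K`. -/
theorem IsThinCone.isStrictlyConvexCone (hK : IsProperCone K) (h : IsThinCone R K) :
    IsStrictlyConvexCone K := by
  intro a ha b hb hab hli
  obtain ⟨f, hf0, hf, hfab⟩ := hK.exists_nonpos_of_notMem_interior hab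
  rw [map_add] at hfab
  have hfa : f a = 0 := le_antisymm (by linarith [hf b hb]) (hf a ha)
  have hfb : f b = 0 := le_antisymm (by linarith [hf a ha]) (hf b hb)
  obtain ⟨ψ, k, hk, hψ⟩ := hK.exists_form
  rw [LinearIndependent.pair_iff] at hli
  have hb0 : b ≠ 0 := by
    rintro rfl
    simpa using hli 0 1 (by simp)
  obtain ⟨c, hc, hx, hxε⟩ := hK.exists_last ha hb hb0
  have hx0 : a - c • b ≠ 0 := by
    intro h0
    have := hli 1 (-c) (by rw [← h0]; module)
    simp at this
  obtain ⟨c', hc', hy, hyε⟩ := hK.exists_last hb hx hx0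
  have hy0 : b - c' • (a - c • b) ≠ 0 := by
    intro h0
    have := hli (-c') (1 + c' * c) (by rw [← h0]; module)
    have h1 : c' = 0 := by linarith [this.1]
    simp [h1] at this
  set x := a - c • b with hxdef
  set y := b - c' • x with hydef
  have hyx : ∀ ε : ℝ, 0 < ε → y - ε • x ∉ K := by
    intro ε hε hmem
    refine hyε ε hε ?_
    convert hmem using 1
    rw [hydef]; module
  -- Up to a positive factor, `x - ε y` is `x - (ε / (1 + ε c')) b`, which is beyond the last point
  -- `x` in the direction `-b`.
  have hxy : ∀ ε : ℝ, 0 < ε → x - ε • y ∉ K := by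
    intro ε hε hmem
    have hpos : 0 < 1 + ε * c' := by positivity
    refine hxε (ε / (1 + ε * c')) (by positivity) ?_
    have := hK.smul_mem (1 + ε * c')⁻¹ (by positivity) _ hmem
    convert this using 1
    have e1 : (1 + ε * c')⁻¹ • (x - ε • y) =
        (1 + ε * c')⁻¹ • ((1 + ε * c') • x - ε • b) := by
      rw [hydef]; module
    rw [e1, smul_sub, smul_smul, inv_mul_cancel₀ hpos.ne', one_smul, smul_smul, hxdef, add_smul,
      div_eq_inv_mul]
    module
  have hfx : f x = 0 := by simp [hxdef, hfa, hfb]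
  have hfy : f y = 0 := by simp [hydef, hfx, hfb]
  obtain ⟨e₀, he₀⟩ := hK.nonempty_interior
  have hfe₀ : 0 < f e₀ := IsProperCone.pos_of_mem_interior hf0 hf he₀
  set e := (f e₀)⁻¹ • e₀ with hedef
  have he : e ∈ interior K := hK.smul_mem_interior (inv_pos.2 hfe₀) he₀
  have hfe : f e = 1 := by simp [hedef, hfe₀.ne']
  have heK := interior_subset he
  have hψx : 0 < ψ x := IsProperCone.pos_of_ne_zero hk hψ hx hx0
  have hψy : 0 < ψ y := IsProperCone.pos_of_ne_zero hk hψ hy hy0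
  have hψe : 0 ≤ ψ e := IsProperCone.nonneg_of_mem hk hψ heK
  set S := |R| * (ψ x + ψ y + 2 * ψ e) / ψ x + |R| * (ψ y + ψ x + 2 * ψ e) / ψ y + 1 with hSdef
  have hq1 : 0 ≤ |R| * (ψ x + ψ y + 2 * ψ e) / ψ x := by positivity
  have hq2 : 0 ≤ |R| * (ψ y + ψ x + 2 * ψ e) / ψ y := by positivity
  have hS0 : 0 < S := by positivity
  have key : ∀ x y : E, (∀ ε : ℝ, 0 < ε → x - ε • y ∉ K) →
      ∃ ε : ℝ, 0 < ε ∧ S • x - y + ε • e ∉ K := by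
    intro x y hxy
    by_contra! hcon
    have hmem := hK.mem_of_forall_add_smul_mem hcon
    have := hK.smul_mem S⁻¹ (by positivity) _ hmem
    rw [smul_sub, smul_smul, inv_mul_cancel₀ hS0.ne', one_smul] at this
    exact hxy _ (by positivity) this
  have mono : ∀ {v : E} {ε ε' : ℝ}, v + ε • e ∉ K → ε' ≤ ε → v + ε' • e ∉ K := by
    intro v ε ε' hv hε hcon
    refine hv ?_
    have := hK.add_mem _ hcon _ (hK.smul_mem (ε - ε') (by linarith) e heK)
    convert this using 1
    module
  obtain ⟨ε₁, hε₁, h₁⟩ := key x y hxy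
  obtain ⟨ε₂, hε₂, h₂⟩ := key y x hyx
  -- Chosen so that the error `2 |R| δ` in the coefficient of `e` is at most `ε₁` and `ε₂`,
  -- whichever side is the close one.
  set δ := min 1 (min (ε₁ / (2 * |R| + 1)) (ε₂ / (2 * |R| + 1))) with hδdef
  have hRpos : 0 < 2 * |R| + 1 := by positivity
  have hδ : 0 < δ := by positivity
  have hδ1 : δ ≤ 1 := min_le_left _ _
  have hδ₁ : 2 * |R| * δ ≤ ε₁ := by
    have : δ ≤ ε₁ / (2 * |R| + 1) := (min_le_right _ _).trans (min_le_left _ _)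
    rw [le_div_iff₀ hRpos] at this
    linarith
  have hδ₂ : 2 * |R| * δ ≤ ε₂ := by
    have : δ ≤ ε₂ / (2 * |R| + 1) := (min_le_right _ _).trans (min_le_right _ _)
    rw [le_div_iff₀ hRpos] at this
    linarith
  obtain ⟨s, t, hs, ht, w, hw, hw1, hw2⟩ := h (x + δ • e)
    (hK.add_mem_interior hx (hK.smul_mem_interior hδ he)) (y + δ • e)
    (hK.add_mem_interior hy (hK.smul_mem_interior hδ he)) e he
  rcases hw with rfl | rfl
  · exact mono h₁ hδ₁ (hK.smul_sub_add_smul_mem hk hψ hf hx hx0 hy heK hfx hfy hfe hδ hδ1 hs ht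
      (by linarith) hw1 hw2)
  · rw [add_comm (x + δ • e)] at hw1 hw2
    exact mono h₂ hδ₂ (hK.smul_sub_add_smul_mem hk hψ hf hy hy0 hx heK hfy hfx hfe hδ hδ1 hs ht
      (by linarith) hw1 hw2)

/-- One of the two cases in `IsThinCone.isSmoothCone`. -/
theorem IsProperCone.false_of_corner (hK : IsProperCone K) {f g ψ : StrongDual ℝ E} {k : ℝ}
    (hk : 0 < k) (hψ : ∀ v ∈ K, k * ‖v‖ ≤ ψ v) (hf : ∀ v ∈ K, 0 ≤ f v) (hg : ∀ v ∈ K, 0 ≤ g v)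
    {p e w : E} (hp : p ∈ K) (hp0 : p ≠ 0) (he : e ∈ interior K) (hfp : f p = 0) (hgp : g p = 0)
    (hfe : f e = 1) (hge : g e = 1) (hfw : f w = 1) (hgw : g w = -1)
    {T τ₁ τ₂ N M s t : ℝ} (hT : ∀ τ N : ℝ, N • p + e + τ • w ∈ interior K → τ ≤ T) (hT0 : 0 < T)
    (hτ₁ : 0 ≤ τ₁) (hτ₁T : T - T / (12 * (|R| + 1)) < τ₁) (hτ₁1 : τ₁ ≤ 1)
    (hτ₂ : τ₂ ≤ 0) (hτ₂1 : -1 ≤ τ₂)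
    (hx : N • p + e + τ₁ • w ∈ K) (hy : N • p + e + τ₂ • w ∈ K) (hM : 0 < M)
    (hM' : 4 * (|R| * ψ (N • p + e + τ₁ • w + (N • p + e + τ₂ • w))) ≤ M * ψ p)
    (hs : 0 ≤ s) (ht : 0 ≤ t)
    (h1 : s • (N • p + e + τ₁ • w) + t • (M • p + e) -
      (N • p + e + τ₁ • w + (N • p + e + τ₂ • w)) ∈ K)
    (h2 : R • (N • p + e + τ₁ • w + (N • p + e + τ₂ • w)) -
      (s • (N • p + e + τ₁ • w) + t • (M • p + e)) ∈ K) : False := by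
  have hψp : 0 < ψ p := IsProperCone.pos_of_ne_zero hk hψ hp hp0
  have hψe : 0 ≤ ψ e := IsProperCone.nonneg_of_mem hk hψ (interior_subset he)
  have hψx := IsProperCone.nonneg_of_mem hk hψ hx
  have hψu := IsProperCone.nonneg_of_mem hk hψ (hK.add_mem _ hx _ hy)
  set x := N • p + e + τ₁ • w with hxdef
  set y := N • p + e + τ₂ • w with hydef
  have hR : R ≤ |R| := le_abs_self R
  -- The third vertex `M p + e` is so far in the direction `p` that `ψ` allows only a small
  -- coefficient for it.
  have ht4 : t ≤ 1 / 4 := by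
    have a1 := IsProperCone.nonneg_of_mem hk hψ h2
    simp only [map_sub, map_smul, smul_eq_mul, map_add ψ (s • x), map_add ψ (M • p)] at a1
    have a2 := mul_le_mul_of_nonneg_right hR hψu
    have a3 : t * (M * ψ p) ≤ 1 / 4 * (M * ψ p) := by
      nlinarith [mul_nonneg hs hψx, mul_nonneg ht hψe]
    exact le_of_mul_le_mul_right a3 (by positivity)
  have hfx : f x = 1 + τ₁ := by simp [hxdef, hfp, hfe, hfw]
  have hfy : f y = 1 + τ₂ := by simp [hydef, hfp, hfe, hfw]
  have hgx : g x = 1 - τ₁ := by simp [hxdef, hgp, hge, hgw]; ring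
  have hgy : g y = 1 - τ₂ := by simp [hydef, hgp, hge, hgw]; ring
  have hsR : s ≤ 3 * |R| := by
    have a1 := hf _ h2
    simp only [map_sub, map_smul, smul_eq_mul, map_add, hfx, hfy, hfp, hfe] at a1
    have a2 : R * (1 + τ₁ + (1 + τ₂)) ≤ |R| * 3 :=
      mul_le_mul hR (by linarith) (by linarith) (abs_nonneg R)
    nlinarith [mul_nonneg hs hτ₁]
  have b1 := hf _ h1
  have b2 := hg _ h1
  simp only [map_sub, map_smul, smul_eq_mul, map_add, hfx, hfy, hfp, hfe, hgx, hgy, hgp,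
    hge] at b1 b2
  -- Sum of `b1` and `b2`: the `w`-components cancel.
  have hS : 0 ≤ s + t - 2 := by nlinarith
  -- Modulo `p`, the vector of `h1` is `(s + t - 2) e + ((s - 1) τ₁ - τ₂) w`, and `T` bounds the
  -- slope of interior vectors. The small multiple of `e` makes the vector interior and the divisor
  -- positive.
  have hQ : (s - 1) * τ₁ - τ₂ ≤ T * (s + t - 2) := by
    refine le_of_forall_pos_le_add fun η hη => ?_
    have hη' : 0 < η / T := by positivity
    have c1 := hK.add_mem_interior h1 (hK.smul_mem_interior hη' he)
    have hpos : 0 < s + t - 2 + η / T := by linarith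
    have c2 := hK.smul_mem_interior (inv_pos.2 hpos) c1
    have c3 := hT (((s - 1) * τ₁ - τ₂) / (s + t - 2 + η / T))
      ((s * N + t * M - 2 * N) / (s + t - 2 + η / T)) (by
        have e1 : s • x + t • (M • p + e) - (x + y) + (η / T) • e =
            (s * N + t * M - 2 * N) • p + (s + t - 2 + η / T) • e +
              ((s - 1) * τ₁ - τ₂) • w := by
          rw [hxdef, hydef]
          module
        rw [e1, smul_add, smul_add, smul_smul, smul_smul, smul_smul, inv_mul_cancel₀ hpos.ne',
          one_smul, ← div_eq_inv_mul, ← div_eq_inv_mul] at c2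
        exact c2)
    rw [div_le_iff₀ hpos, mul_add, mul_div_cancel₀ _ hT0.ne'] at c3
    exact c3
  have hs1 : 1 ≤ s := by linarith
  have hεs : T / (12 * (|R| + 1)) * (s - 1) ≤ T / 4 := by
    have : T / (12 * (|R| + 1)) * (s - 1) ≤ T / (12 * (|R| + 1)) * (3 * (|R| + 1)) := by
      gcongr
      linarith
    refine this.trans (le_of_eq ?_)
    field_simp
    norm_num
  -- As `τ₁` is almost `T` and `τ₂ ≤ 0`, `hQ` gives `T (1 - t) ≤ T / 4`, contrary to `t ≤ 1 / 4`.
  nlinarith [mul_le_mul_of_nonneg_left hτ₁T.le (sub_nonneg.2 hs1)]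

/-- Two normalized supporting forms `f ≠ g` at `p` confine the slopes `τ` of the vectors `N p + e +
τ w` to a bounded interval, also modulo `p`. Take `x` and `y` with slopes near the two ends and `z =
M p + e` with `M` large. Staying close to `x + y` on a side through `z` would require either almost
no slope of the opposite sign or a large coefficient of `z`; both are excluded by `false_of_corner`.
-/
theorem IsThinCone.isSmoothCone (hK : IsProperCone K) (h : IsThinCone R K) : IsSmoothCone K := by
  intro p hp hp0 f g hf hg hfp hgp e he hfe hge
  by_contra hfg
  obtain ⟨w₀, hw₀⟩ : ∃ w₀, f w₀ ≠ g w₀ := by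
    by_contra! hcon
    exact hfg (ContinuousLinearMap.ext hcon)
  have hw₀' : f w₀ - g w₀ ≠ 0 := sub_ne_zero.2 hw₀
  obtain ⟨w, hfw, hgw⟩ : ∃ w, f w = 1 ∧ g w = -1 := by
    refine ⟨(2 / (f w₀ - g w₀)) • w₀ + (1 - 2 / (f w₀ - g w₀) * f w₀) • e, ?_, ?_⟩
    · simp [hfe]
    · simp only [map_add, map_smul, smul_eq_mul, hge]
      field_simp
      ring
  obtain ⟨ψ, k, hk, hψ⟩ := hK.exists_form
  have hψp : 0 < ψ p := IsProperCone.pos_of_ne_zero hk hψ hp hp0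
  -- The slopes of the projection of the cone along `p`. On these vectors `f = 1 + τ` and `g = 1 -
  -- τ`, whence `A ⊆ [-1, 1]`.
  set A := {τ : ℝ | ∃ N : ℝ, N • p + e + τ • w ∈ interior K} with hA
  have hAub : ∀ τ ∈ A, τ ≤ 1 := by
    rintro τ ⟨N, hN⟩
    have := hg _ (interior_subset hN)
    simp only [map_add, map_smul, smul_eq_mul, hgp, hge, hgw] at this
    linarith
  have hAlb : ∀ τ ∈ A, -1 ≤ τ := by
    rintro τ ⟨N, hN⟩
    have := hf _ (interior_subset hN)
    simp only [map_add, map_smul, smul_eq_mul, hfp, hfe, hfw] at this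
    linarith
  have hnear : ∃ r : ℝ, 0 < r ∧ r ∈ A ∧ -r ∈ A := by
    have hc : ∀ σ : ℝ, ∀ᶠ r in 𝓝[>] (0 : ℝ), (0 : ℝ) • p + e + (σ * r) • w ∈ interior K := by
      intro σ
      refine Filter.Eventually.filter_mono nhdsWithin_le_nhds ?_
      have : Continuous fun r : ℝ => (0 : ℝ) • p + e + (σ * r) • w := by fun_prop
      refine this.continuousAt.eventually (isOpen_interior.mem_nhds ?_)
      simpa using he
    obtain ⟨r, ⟨h1, h2⟩, hr⟩ := (((hc 1).and (hc (-1))).and self_mem_nhdsWithin).exists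
    exact ⟨r, hr, ⟨0, by simpa using h1⟩, ⟨0, by simpa using h2⟩⟩
  obtain ⟨r, hr, hrA, hrA'⟩ := hnear
  have hbdd : BddAbove A := ⟨1, hAub⟩
  have hbdd' : BddBelow A := ⟨-1, hAlb⟩
  have hT : 0 < sSup A := hr.trans_le (le_csSup hbdd hrA)
  have hT' : sInf A < 0 := (csInf_le hbdd' hrA').trans_lt (by linarith)
  have hRp : 0 < 12 * (|R| + 1) := by positivity
  have hR1 : ∀ {x : ℝ}, 0 < x → 0 ≤ x - x / (12 * (|R| + 1)) := by
    intro x hx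
    rw [sub_nonneg, div_le_iff₀ hRp]
    nlinarith [mul_nonneg hx.le (abs_nonneg R)]
  obtain ⟨τ₁, ⟨N₁, hN₁⟩, hτ₁⟩ := exists_lt_of_lt_csSup ⟨r, hrA⟩
    (show sSup A - sSup A / (12 * (|R| + 1)) < sSup A by
      have : 0 < sSup A / (12 * (|R| + 1)) := by positivity
      linarith)
  obtain ⟨τ₂, ⟨N₂, hN₂⟩, hτ₂⟩ := exists_lt_of_csInf_lt ⟨r, hrA⟩
    (show sInf A < sInf A + (-sInf A) / (12 * (|R| + 1)) by
      have : 0 < (-sInf A) / (12 * (|R| + 1)) := div_pos (by linarith) hRp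
      linarith)
  have hτ₁0 : 0 ≤ τ₁ := (hR1 hT).trans hτ₁.le
  have hτ₂0 : τ₂ ≤ 0 := by
    have := hR1 (neg_pos.2 hT')
    linarith
  have up : ∀ {N N' τ : ℝ}, N ≤ N' → N • p + e + τ • w ∈ interior K →
      N' • p + e + τ • w ∈ interior K := by
    intro N N' τ hN hmem
    have := hK.add_mem_interior (hK.smul_mem (N' - N) (sub_nonneg.2 hN) p hp) hmem
    convert this using 1
    module
  have hx := up (le_max_left N₁ N₂) hN₁
  have hy := up (le_max_right N₁ N₂) hN₂
  set N := max N₁ N₂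
  set x := N • p + e + τ₁ • w with hxdef
  set y := N • p + e + τ₂ • w with hydef
  have hψu := IsProperCone.nonneg_of_mem hk hψ
    (hK.add_mem _ (interior_subset hx) _ (interior_subset hy))
  set M := 4 * (|R| * ψ (x + y)) / ψ p + 1 with hMdef
  have hM : 0 < M := by positivity
  have hM' : 4 * (|R| * ψ (x + y)) ≤ M * ψ p := by
    rw [hMdef, add_mul, div_mul_cancel₀ _ hψp.ne']
    linarith
  have hz : M • p + e ∈ interior K := hK.add_mem_interior (hK.smul_mem M hM.le p hp) he
  obtain ⟨s, t, hs, ht, v, hv, hv1, hv2⟩ := h x hx y hy _ hz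
  rcases hv with rfl | rfl
  · exact hK.false_of_corner hk hψ hf hg hp hp0 he hfp hgp hfe hge hfw hgw
      (fun τ N' hmem => le_csSup hbdd ⟨N', hmem⟩) hT hτ₁0 hτ₁ (hAub _ ⟨_, hN₁⟩) hτ₂0
      (hAlb _ ⟨_, hN₂⟩) (interior_subset hx) (interior_subset hy) hM hM' hs ht hv1 hv2
  -- The side from `y` to `z` reduces to the first case by exchanging `f` with `g`, `x` with `y`,
  -- and `w` with `-w`.
  · have ex : x = N • p + e + (-τ₁) • (-w) := by rw [hxdef]; module
    have ey : y = N • p + e + (-τ₂) • (-w) := by rw [hydef]; module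
    rw [add_comm x y, ex, ey] at hv1 hv2 hM'
    rw [ex] at hx
    rw [ey] at hy
    refine hK.false_of_corner (R := R) (τ₁ := -τ₂) (τ₂ := -τ₁) (T := -sInf A) hk hψ hg hf hp hp0 he
      hgp hfp hge hfe (w := -w) (by simp [hgw]) (by simp [hfw]) ?_ (by linarith) (by linarith) ?_
      (by linarith [hAlb _ ⟨_, hN₂⟩]) (by linarith) (by linarith [hAub _ ⟨_, hN₁⟩])
      (interior_subset hy) (interior_subset hx) hM hM' hs ht hv1 hv2
    · intro τ N' hmem
      have : -τ ∈ A := ⟨N', by convert hmem using 1; module⟩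
      linarith [csInf_le hbdd' this]
    · linarith

end ThinCones

end HilbertGeometry

namespace HilbertGeometry

open Filter Topology

/-! ### Limits of cones along an ultrafilter -/

section Limits

variable {E : Type*} [NormedAddCommGroup E] [NormedSpace ℝ E]

/-- Convergence of cones along a nonprincipal ultrafilter on `ℕ`. -/
structure ConeTendsto (C : ℕ → Set E) (K : Set E) : Prop where
  mem : ∀ w : ℕ → E, (∀ᶠ n in hyperfilter ℕ, w n ∈ C n) → ∀ v,
    Tendsto w (hyperfilter ℕ) (𝓝 v) → v ∈ K
  exists_seq : ∀ v ∈ K, ∃ w : ℕ → E, (∀ n, w n ∈ C n) ∧ Tendsto w (hyperfilter ℕ) (𝓝 v)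

theorem exists_tendsto_hyperfilter {X : Type*} [NormedAddCommGroup X] [ProperSpace X]
    {w : ℕ → X} {B : ℝ} (h : ∀ᶠ n in hyperfilter ℕ, ‖w n‖ ≤ B) :
    ∃ v, Tendsto w (hyperfilter ℕ) (𝓝 v) := by
  obtain ⟨v, -, hv⟩ := (isCompact_closedBall (0 : X) B).ultrafilter_le_nhds
    ((hyperfilter ℕ).map w) (by
      rw [le_principal_iff]
      show ∀ᶠ n in hyperfilter ℕ, w n ∈ Metric.closedBall 0 B
      simpa using h)
  exact ⟨v, hv⟩

theorem tendsto_one_div_hyperfilter :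
    Tendsto (fun n : ℕ => 1 / ((n : ℝ) + 1)) (hyperfilter ℕ) (𝓝 0) :=
  tendsto_one_div_add_atTop_nhds_zero_nat.mono_left Nat.hyperfilter_le_atTop

theorem eventually_le_hyperfilter (r : ℝ) : ∀ᶠ n : ℕ in hyperfilter ℕ, r ≤ n :=
  (tendsto_natCast_atTop_atTop.eventually_ge_atTop r).filter_mono Nat.hyperfilter_le_atTop

/-- The limit consists of the vectors whose distance to `C n` tends to zero. The common form keeps
it pointed and the common ball keeps it of nonempty interior: these two bounds are the compactness
needed for a proper limit. -/
theorem exists_coneTendsto [ProperSpace E] {C : ℕ → Set E} (hC : ∀ n, IsProperCone (C n))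
    {ψ : StrongDual ℝ E} {c : ℝ} (hc : 0 < c) (hψ : ∀ n, ∀ x ∈ C n, c * ‖x‖ ≤ ψ x)
    {e : E} {r : ℝ} (hr : 0 < r) (he : ∀ n, Metric.ball e r ⊆ C n) :
    ∃ K, IsProperCone K ∧ ConeTendsto C K ∧ (∀ x ∈ K, c * ‖x‖ ≤ ψ x) ∧ Metric.ball e r ⊆ K := by
  set K := {v : E | Tendsto (fun n => Metric.infDist v (C n)) (hyperfilter ℕ) (𝓝 0)} with hKdef
  have hlim : ConeTendsto C K := by
    constructor
    · intro w hw v hv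
      refine squeeze_zero' (.of_forall fun n => Metric.infDist_nonneg) ?_
        (tendsto_iff_dist_tendsto_zero.1 hv)
      filter_upwards [hw] with n hn
      rw [dist_comm]
      exact Metric.infDist_le_dist_of_mem hn
    · intro v hv
      choose w hw hwd using fun n => (hC n).isClosed.exists_infDist_eq_dist ⟨0, (hC n).zero_mem⟩ v
      refine ⟨w, hw, tendsto_iff_dist_tendsto_zero.2 ?_⟩
      refine Tendsto.congr (fun n => ?_) hv
      rw [hwd, dist_comm]
  have hψK : ∀ x ∈ K, c * ‖x‖ ≤ ψ x := by
    intro x hx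
    obtain ⟨w, hw, hwx⟩ := hlim.exists_seq x hx
    exact le_of_tendsto_of_tendsto' (hwx.norm.const_mul c) ((ψ.continuous.tendsto x).comp hwx)
      fun n => hψ n _ (hw n)
  have hball : Metric.ball e r ⊆ K := fun v hv =>
    hlim.mem (fun _ => v) (.of_forall fun n => he n hv) v tendsto_const_nhds
  refine ⟨K, ⟨?_, ?_, ?_, ⟨ψ, c, hc, hψK⟩, ⟨e, ?_⟩⟩, hlim, hψK, hball⟩
  · refine isClosed_of_closure_subset fun v hv => ?_
    rw [hKdef, Set.mem_ofPred_eq, Metric.tendsto_nhds]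
    intro ε hε
    obtain ⟨v', hv', hd⟩ := Metric.mem_closure_iff.1 hv (ε / 2) (by positivity)
    filter_upwards [Metric.tendsto_nhds.1 hv' (ε / 2) (by positivity)] with n hn
    rw [Real.dist_eq, sub_zero, abs_of_nonneg Metric.infDist_nonneg] at hn ⊢
    have := Metric.infDist_le_infDist_add_dist (s := C n) (x := v) (y := v')
    linarith
  · intro x hx y hy
    obtain ⟨w, hw, hwx⟩ := hlim.exists_seq x hx
    obtain ⟨w', hw', hwy⟩ := hlim.exists_seq y hy
    exact hlim.mem _ (.of_forall fun n => (hC n).add_mem _ (hw n) _ (hw' n)) _ (hwx.add hwy)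
  · intro a ha x hx
    obtain ⟨w, hw, hwx⟩ := hlim.exists_seq x hx
    exact hlim.mem _ (.of_forall fun n => (hC n).smul_mem a ha _ (hw n)) _ (hwx.const_smul a)
  · exact mem_interior_iff_mem_nhds.2 (mem_of_superset (Metric.ball_mem_nhds e hr) hball)

namespace ConeTendsto

variable {C : ℕ → Set E} {K : Set E}

theorem tendsto_apply {g : ℕ → StrongDual ℝ E} {h : StrongDual ℝ E} {w : ℕ → E} {v : E}
    (hg : Tendsto g (hyperfilter ℕ) (𝓝 h)) (hw : Tendsto w (hyperfilter ℕ) (𝓝 v)) :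
    Tendsto (fun n => g n (w n)) (hyperfilter ℕ) (𝓝 (h v)) :=
  (isBoundedBilinearMap_apply.continuous.tendsto (h, v)).comp (hg.prodMk_nhds hw)

theorem form_nonneg (h : ConeTendsto C K) {g : ℕ → StrongDual ℝ E} {f : StrongDual ℝ E}
    (hg : Tendsto g (hyperfilter ℕ) (𝓝 f))
    (hgC : ∀ᶠ n in hyperfilter ℕ, ∀ v ∈ C n, 0 ≤ g n v) : ∀ v ∈ K, 0 ≤ f v := by
  intro v hv
  obtain ⟨w, hw, hwv⟩ := h.exists_seq v hv
  refine ge_of_tendsto (tendsto_apply hg hwv) ?_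
  filter_upwards [hgC] with n hn using hn _ (hw n)

variable [FiniteDimensional ℝ E]

/-- Limits of linear forms. -/
theorem exists_form_tendsto {f : ℕ → StrongDual ℝ E} (hf0 : ∀ᶠ n in hyperfilter ℕ, f n ≠ 0) :
    ∃ (g : ℕ → StrongDual ℝ E) (h : StrongDual ℝ E), h ≠ 0 ∧
      Tendsto g (hyperfilter ℕ) (𝓝 h) ∧
      ∀ᶠ n in hyperfilter ℕ, ‖g n‖ = 1 ∧ ∃ a : ℝ, 0 < a ∧ g n = a • f n := by
  have h1 : ∀ᶠ n in hyperfilter ℕ, ‖(‖f n‖⁻¹ • f n)‖ = 1 := by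
    filter_upwards [hf0] with n hn
    rw [norm_smul, norm_inv, norm_norm, inv_mul_cancel₀ (norm_ne_zero_iff.2 hn)]
  obtain ⟨h, hh⟩ := exists_tendsto_hyperfilter (w := fun n => ‖f n‖⁻¹ • f n) (B := 1)
    (h1.mono fun n hn => hn.le)
  refine ⟨fun n => ‖f n‖⁻¹ • f n, h, ?_, hh, ?_⟩
  · rintro rfl
    have h2 := tendsto_nhds_unique (tendsto_const_nhds.congr' (h1.mono fun n hn => hn.symm)) hh.norm
    simp at h2
  · filter_upwards [hf0, h1] with n hn hn1
    exact ⟨hn1, ‖f n‖⁻¹, inv_pos.2 (norm_pos_iff.2 hn), rfl⟩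

/-- Otherwise there are nonzero forms, nonnegative on `C n` and nonpositive at `w n`. Normalized,
they converge to a nonzero form that is nonnegative on `K` and nonpositive at the interior vector
`v`. -/
theorem eventually_mem_interior (h : ConeTendsto C K) (hC : ∀ n, IsProperCone (C n))
    {v : E} (hv : v ∈ interior K) {w : ℕ → E} (hw : Tendsto w (hyperfilter ℕ) (𝓝 v)) :
    ∀ᶠ n in hyperfilter ℕ, w n ∈ interior (C n) := by
  by_contra hcon
  rw [← Ultrafilter.eventually_not] at hcon
  obtain ⟨f, hf⟩ := Filter.Eventually.choice
    (hcon.mono fun n hn => (hC n).exists_nonpos_of_notMem_interior hn)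
  obtain ⟨g, F, hF0, hgF, hg⟩ := exists_form_tendsto (hf.mono fun n hn => hn.1)
  have hF : ∀ v ∈ K, 0 ≤ F v := by
    refine h.form_nonneg hgF ?_
    filter_upwards [hg, hf] with n hn hn' x hx
    obtain ⟨-, a, ha, hga⟩ := hn
    rw [hga]
    exact mul_nonneg ha.le (hn'.2.1 x hx)
  have hFv : F v ≤ 0 := by
    refine le_of_tendsto (tendsto_apply hgF hw) ?_
    filter_upwards [hg, hf] with n hn hn'
    obtain ⟨-, a, ha, hga⟩ := hn
    rw [hga]
    exact mul_nonpos_of_nonneg_of_nonpos ha.le hn'.2.2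
  exact (IsProperCone.pos_of_mem_interior hF0 hF hv).not_ge hFv

/-- A triangle interior to `K` is eventually interior to `C n`. The coefficients `s, t` of the close
point are bounded because `x`, `y`, `z` are order units, and their limits serve for `K`. The
ultrafilter decides which of the two sides is used. -/
theorem isThinCone (h : ConeTendsto C K) (hC : ∀ n, IsProperCone (C n)) (hK : IsProperCone K)
    {R : ℝ} (hR : ∀ n, IsThinCone R (C n)) : IsThinCone R K := by
  intro x hx y hy z hz
  rcases subsingleton_or_nontrivial E with hE | hE
  · refine ⟨0, 0, le_rfl, le_rfl, 0, Or.inl (by simp), ?_, ?_⟩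
    · rw [Subsingleton.elim (0 - (x + y)) 0]
      exact hK.zero_mem
    · rw [Subsingleton.elim (R • (x + y) - 0) 0]
      exact hK.zero_mem
  have ev : ∀ {v : E}, v ∈ interior K → ∀ᶠ n in hyperfilter ℕ, v ∈ interior (C n) :=
    fun hv => h.eventually_mem_interior hC hv tendsto_const_nhds
  have bound : ∀ {v : E}, v ∈ interior K → ∃ S : ℝ, 0 ≤ S ∧ ∀ᶠ n in hyperfilter ℕ, ∀ s : ℝ,
      R • (x + y) - s • v ∈ C n → s ≤ S := by
    intro v hv
    obtain ⟨S, hS0, hS⟩ := hK.exists_smul_sub_mem_interior hv (R • (x + y))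
    refine ⟨S, hS0.le, ?_⟩
    filter_upwards [ev hS, ev hv] with n hn hvn s hs
    by_contra! hcon
    have h1 := (hC n).add_mem _ hs _ (interior_subset hn)
    have h2 : (s - S) • v = 0 := by
      refine (hC n).eq_zero_of_neg_mem
        ((hC n).smul_mem (s - S) (by linarith) v (interior_subset hvn)) ?_
      convert h1 using 1
      module
    rcases smul_eq_zero.1 h2 with h3 | h3
    · linarith
    · exact (hC n).ne_zero_of_mem_interior hvn h3
  obtain ⟨S₁, hS₁0, hS₁⟩ := bound hx
  obtain ⟨S₂, hS₂0, hS₂⟩ := bound hy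
  obtain ⟨S₃, hS₃0, hS₃⟩ := bound hz
  obtain ⟨st, hst⟩ := Filter.Eventually.choice (r := fun (n : ℕ) (st : ℝ × ℝ) =>
      0 ≤ st.1 ∧ 0 ≤ st.2 ∧ ∃ w, (w = st.1 • x + st.2 • z ∨ w = st.1 • y + st.2 • z) ∧
        w - (x + y) ∈ C n ∧ R • (x + y) - w ∈ C n) (by
    filter_upwards [ev hx, ev hy, ev hz] with n h1 h2 h3
    obtain ⟨s, t, h⟩ := hR n x h1 y h2 z h3
    exact ⟨(s, t), h⟩)
  have key : ∀ x' y' : E, x' + y' = x + y → x' ∈ interior K → ∀ S₁ : ℝ, (∀ᶠ n in hyperfilter ℕ,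
      ∀ s : ℝ, R • (x + y) - s • x' ∈ C n → s ≤ S₁) →
      (∀ᶠ n in hyperfilter ℕ, 0 ≤ (st n).1 ∧ 0 ≤ (st n).2 ∧
        (st n).1 • x' + (st n).2 • z - (x + y) ∈ C n ∧
        R • (x + y) - ((st n).1 • x' + (st n).2 • z) ∈ C n) →
      ∃ s t : ℝ, 0 ≤ s ∧ 0 ≤ t ∧ s • x' + t • z - (x + y) ∈ K ∧
        R • (x + y) - (s • x' + t • z) ∈ K := by
    intro x' y' hxy hx' S₁ hS₁ hev
    have hb : ∀ᶠ n in hyperfilter ℕ, (st n).1 ≤ S₁ ∧ (st n).2 ≤ S₃ := by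
      filter_upwards [hev, hS₁, hS₃, ev hx', ev hz] with n hn h1 h3 hxn hzn
      refine ⟨h1 _ ?_, h3 _ ?_⟩
      · have := (hC n).add_mem _ hn.2.2.2 _ ((hC n).smul_mem _ hn.2.1 z (interior_subset hzn))
        convert this using 1
        module
      · have := (hC n).add_mem _ hn.2.2.2 _ ((hC n).smul_mem _ hn.1 x' (interior_subset hxn))
        convert this using 1
        module
    obtain ⟨s, hs⟩ := exists_tendsto_hyperfilter (w := fun n => (st n).1) (B := S₁) (by
      filter_upwards [hev, hb] with n h1 h2
      rw [Real.norm_of_nonneg h1.1]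
      exact h2.1)
    obtain ⟨t, ht⟩ := exists_tendsto_hyperfilter (w := fun n => (st n).2) (B := S₃) (by
      filter_upwards [hev, hb] with n h1 h2
      rw [Real.norm_of_nonneg h1.2.1]
      exact h2.2)
    have hw := (hs.smul_const x').add (ht.smul_const z)
    refine ⟨s, t, ge_of_tendsto hs (hev.mono fun n h => h.1),
      ge_of_tendsto ht (hev.mono fun n h => h.2.1), ?_, ?_⟩
    · exact h.mem _ (hev.mono fun n h => h.2.2.1) _ (hw.sub_const _)
    · exact h.mem _ (hev.mono fun n h => h.2.2.2) _ (hw.const_sub _)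
  have hor : ∀ᶠ n in hyperfilter ℕ,
      (0 ≤ (st n).1 ∧ 0 ≤ (st n).2 ∧ (st n).1 • x + (st n).2 • z - (x + y) ∈ C n ∧
        R • (x + y) - ((st n).1 • x + (st n).2 • z) ∈ C n) ∨
      (0 ≤ (st n).1 ∧ 0 ≤ (st n).2 ∧ (st n).1 • y + (st n).2 • z - (x + y) ∈ C n ∧
        R • (x + y) - ((st n).1 • y + (st n).2 • z) ∈ C n) := by
    filter_upwards [hst] with n hn
    obtain ⟨h1, h2, w, rfl | rfl, h3, h4⟩ := hn
    · exact Or.inl ⟨h1, h2, h3, h4⟩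
    · exact Or.inr ⟨h1, h2, h3, h4⟩
  rcases Ultrafilter.eventually_or.1 hor with hev | hev
  · obtain ⟨s, t, hs, ht, h1, h2⟩ := key x y rfl hx S₁ hS₁ hev
    exact ⟨s, t, hs, ht, _, Or.inl rfl, h1, h2⟩
  · obtain ⟨s, t, hs, ht, h1, h2⟩ := key y x (add_comm y x) hy S₂ hS₂ hev
    exact ⟨s, t, hs, ht, _, Or.inr rfl, h1, h2⟩

/-- A limit of increasingly non-thin triangles produces a cone that is not strictly convex. -/
theorem not_isStrictlyConvexCone (h : ConeTendsto C K) (hC : ∀ n, IsProperCone (C n))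
    (hK : IsProperCone K) {ψ : StrongDual ℝ E} {c : ℝ} (hc : 0 < c)
    (hψ : ∀ n, ∀ x ∈ C n, c * ‖x‖ ≤ ψ x) {x y z : ℕ → E} (hx : ∀ n, x n ∈ C n)
    (hy : ∀ n, y n ∈ C n) (hz : ∀ n, z n ∈ C n) (hz0 : ∀ n, z n ≠ 0) {u : E}
    (hu : u ∈ interior K) (hxy : Tendsto (fun n => x n + y n) (hyperfilter ℕ) (𝓝 u))
    (hthin : ∀ n, ∀ s t : ℝ, 0 ≤ s → 0 ≤ t → ∀ w, (w = s • x n + t • z n ∨ w = s • y n + t • z n) →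
      w - (x n + y n) ∈ C n → (n : ℝ) • (x n + y n) - w ∉ C n) :
    ¬ IsStrictlyConvexCone K := by
  intro hSC
  have hz1 : ∀ n, 0 < ‖z n‖ := fun n => norm_pos_iff.2 (hz0 n)
  set z' : ℕ → E := fun n => ‖z n‖⁻¹ • z n with hz'
  have hz'C : ∀ n, z' n ∈ C n := fun n => (hC n).smul_mem _ (inv_nonneg.2 (norm_nonneg _)) _ (hz n)
  have hz'1 : ∀ n, ‖z' n‖ = 1 := fun n => by
    rw [hz', norm_smul, norm_inv, norm_norm, inv_mul_cancel₀ (hz1 n).ne']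
  have hψu : ∀ᶠ n in hyperfilter ℕ, ψ (x n + y n) ≤ ψ u + 1 :=
    ((ψ.continuous.tendsto u).comp hxy).eventually_le_const (by linarith)
  have bd : ∀ {v : ℕ → E}, (∀ n, v n ∈ C n) → (∀ᶠ n in hyperfilter ℕ, ψ (v n) ≤ ψ u + 1) →
      ∃ l, Tendsto v (hyperfilter ℕ) (𝓝 l) := by
    intro v hv hvu
    refine exists_tendsto_hyperfilter (B := (ψ u + 1) / c) ?_
    filter_upwards [hvu] with n hn
    rw [le_div_iff₀ hc, mul_comm]
    exact (hψ n _ (hv n)).trans hn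
  obtain ⟨X, hX⟩ := bd hx (by
    filter_upwards [hψu] with n hn
    rw [map_add] at hn
    linarith [IsProperCone.nonneg_of_mem hc (hψ n) (hy n)])
  obtain ⟨Y, hY⟩ := bd hy (by
    filter_upwards [hψu] with n hn
    rw [map_add] at hn
    linarith [IsProperCone.nonneg_of_mem hc (hψ n) (hx n)])
  obtain ⟨Z, hZ⟩ := exists_tendsto_hyperfilter (w := z') (B := 1) (.of_forall fun n => (hz'1 n).le)
  have hXY : X + Y = u := tendsto_nhds_unique (hX.add hY) hxy
  have hXK := h.mem x (.of_forall hx) X hX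
  have hYK := h.mem y (.of_forall hy) Y hY
  have hZK := h.mem z' (.of_forall hz'C) Z hZ
  have hZ0 : Z ≠ 0 := by
    rintro rfl
    have := tendsto_nhds_unique (tendsto_const_nhds.congr fun n => (hz'1 n).symm) hZ.norm
    simp at this
  -- If `A + Z` were interior, fixed multiples would give `u < s (A + Z) < R u`; these persist near
  -- the limit, so for `n ≥ R` the point `s (a n + z' n)` contradicts the failure of thinness.
  have key : ∀ (a : ℕ → E) (A : E), Tendsto a (hyperfilter ℕ) (𝓝 A) →
      (∀ n, ∀ s t : ℝ, 0 ≤ s → 0 ≤ t → s • a n + t • z n - (x n + y n) ∈ C n →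
        (n : ℝ) • (x n + y n) - (s • a n + t • z n) ∉ C n) → A + Z ∉ interior K := by
    intro a A hA ha hcon
    obtain ⟨s, hs, hsu⟩ := hK.exists_smul_sub_mem_interior hcon u
    obtain ⟨R, hR, hRu⟩ := hK.exists_smul_sub_mem_interior hu (s • (A + Z))
    have h1 := h.eventually_mem_interior hC hsu (((hA.add hZ).const_smul s).sub hxy)
    have h2 := h.eventually_mem_interior hC hRu
      ((hxy.const_smul R).sub ((hA.add hZ).const_smul s))
    obtain ⟨n, h1, h2, hn, hun⟩ := (h1.and (h2.and ((eventually_le_hyperfilter R).and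
      (h.eventually_mem_interior hC hu hxy)))).exists
    have e1 : s • (a n + z' n) = s • a n + (s * ‖z n‖⁻¹) • z n := by
      rw [hz']; module
    rw [e1] at h1 h2
    refine ha n s (s * ‖z n‖⁻¹) hs.le (mul_nonneg hs.le (inv_nonneg.2 (norm_nonneg _)))
      (interior_subset h1) ?_
    have := (hC n).add_mem _ (interior_subset h2) _ ((hC n).smul_mem (n - R) (by linarith) _
      (interior_subset hun))
    convert this using 1
    module
  have hXZ := key x X hX fun n s t hs ht h1 => hthin n s t hs ht _ (Or.inl rfl) h1
  have hYZ := key y Y hY fun n s t hs ht h1 => hthin n s t hs ht _ (Or.inr rfl) h1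
  -- Strict convexity now puts `X` and `Y` on the line of `Z`. Then `u = X + Y` is a multiple of
  -- `Z`, so `Z` is interior, and so is `X + Z`.
  have dep : ∀ A ∈ K, A + Z ∉ interior K → ∃ a : ℝ, A = a • Z := by
    intro A hA hAZ
    have := hSC Z hZK A hA (by rwa [add_comm])
    rw [LinearIndependent.pair_iff' hZ0] at this
    push Not at this
    obtain ⟨a, ha⟩ := this
    exact ⟨a, ha.symm⟩
  obtain ⟨a, ha⟩ := dep X hXK hXZ
  obtain ⟨b, hb⟩ := dep Y hYK hYZ
  have ha0 : 0 ≤ a := by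
    by_contra! hcon
    refine hZ0 (hK.eq_zero_of_neg_mem hZK ?_)
    have := hK.smul_mem (-a)⁻¹ (inv_nonneg.2 (by linarith)) _ hXK
    rw [ha, smul_smul, inv_neg, neg_mul, inv_mul_cancel₀ hcon.ne, neg_one_smul] at this
    exact this
  rw [ha, hb, ← add_smul] at hXY
  rcases le_or_gt (a + b) 0 with hab | hab
  · have hu0 : -u ∈ K := by
      rw [← hXY, ← neg_smul]
      exact hK.smul_mem _ (by linarith) _ hZK
    have := hK.add_mem_interior hu0 hu
    rw [neg_add_cancel] at this
    have hn : Nontrivial E := ⟨Z, 0, hZ0⟩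
    exact hK.ne_zero_of_mem_interior this rfl
  · have : Z ∈ interior K := by
      have := hK.smul_mem_interior (inv_pos.2 hab) hu
      rwa [← hXY, smul_smul, inv_mul_cancel₀ hab.ne', one_smul] at this
    exact hXZ (hK.add_mem_interior hXK this)

end ConeTendsto

end Limits

end HilbertGeometry

namespace HilbertGeometry

open Filter Topology

/-! ### Dual cones in coordinates, and normalization by a linear map -/

section Coordinates

variable {n : ℕ}

/-- The action of an invertible matrix on vectors. -/
noncomputable def glEquiv (g : GL (Fin n) ℝ) : (Fin n → ℝ) ≃L[ℝ] (Fin n → ℝ) :=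
  (DistribMulAction.toLinearEquiv ℝ (Fin n → ℝ) g).toContinuousLinearEquiv

@[simp]
theorem glEquiv_apply (g : GL (Fin n) ℝ) (v : Fin n → ℝ) : glEquiv g v = g • v := rfl

/-- The identification of `ℝⁿ` with its dual given by the dot product. -/
noncomputable def dotEquiv (n : ℕ) : (Fin n → ℝ) ≃L[ℝ] StrongDual ℝ (Fin n → ℝ) :=
  ((dotProductEquiv ℝ (Fin n)).trans LinearMap.toContinuousLinearMap).toContinuousLinearEquiv

@[simp]
theorem dotEquiv_apply (w v : Fin n → ℝ) : dotEquiv n w v = w ⬝ᵥ v := rfl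

/-- The dual cone, for the dot product. -/
def dotDual (K : Set (Fin n → ℝ)) : Set (Fin n → ℝ) :=
  {w | ∀ v ∈ K, 0 ≤ w ⬝ᵥ v}

theorem mul_norm_le_dotProduct {K : Set (Fin n → ℝ)} {e : Fin n → ℝ} {r : ℝ} (hr : 0 < r)
    (he : Metric.ball e r ⊆ K) {w : Fin n → ℝ} (hw : w ∈ dotDual K) :
    r / 2 * ‖w‖ ≤ e ⬝ᵥ w := by
  have h : ∀ i, r / 2 * |w i| ≤ e ⬝ᵥ w := by
    intro i
    -- Moving from `e` against the sign of the `i`-th coordinate makes the pairing with `w` drop by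
    -- `r / 2 * |w i|`.
    have hmem : e - (r / 2 * SignType.sign (w i)) • Pi.single i (1 : ℝ) ∈ K := by
      refine he ?_
      rw [Metric.mem_ball, dist_eq_norm, sub_sub_cancel_left, norm_neg, norm_smul, norm_mul,
        Pi.norm_single, norm_one, mul_one, Real.norm_of_nonneg (by positivity)]
      have : ‖((SignType.sign (w i) : SignType) : ℝ)‖ ≤ 1 := by
        rcases lt_trichotomy (w i) 0 with h | h | h <;> simp [h]
      nlinarith
    have := hw _ hmem
    rw [dotProduct_sub, dotProduct_smul, dotProduct_single, mul_one, smul_eq_mul, mul_assoc,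
      sign_mul_self, dotProduct_comm] at this
    linarith
  rcases isEmpty_or_nonempty (Fin n) with hn | hn
  · have : w = 0 := Subsingleton.elim _ _
    simp [this]
  · obtain ⟨i, hi⟩ := Finite.exists_max fun i => ‖w i‖
    have h1 : ‖w‖ ≤ ‖w i‖ := (pi_norm_le_iff_of_nonneg (norm_nonneg _)).2 hi
    refine le_trans ?_ (h i)
    gcongr
    exact h1

theorem abs_dotProduct_le (v w : Fin n → ℝ) : |v ⬝ᵥ w| ≤ n * ‖v‖ * ‖w‖ := by
  calc |v ⬝ᵥ w| ≤ ∑ i, |v i * w i| := Finset.abs_sum_le_sum_abs _ _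
    _ ≤ ∑ _i : Fin n, ‖v‖ * ‖w‖ := Finset.sum_le_sum fun i _ => by
        rw [abs_mul]
        exact mul_le_mul (norm_le_pi_norm v i) (norm_le_pi_norm w i) (abs_nonneg _) (norm_nonneg _)
    _ = n * ‖v‖ * ‖w‖ := by simp; ring

theorem IsProperCone.dotDual {K : Set (Fin n → ℝ)} (hK : IsProperCone K) :
    IsProperCone (dotDual K) where
  isClosed := by
    have : HilbertGeometry.dotDual K = ⋂ v ∈ K, {w | 0 ≤ w ⬝ᵥ v} := by
      ext w
      simp [HilbertGeometry.dotDual]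
    rw [this]
    exact isClosed_biInter fun v _ => isClosed_le continuous_const (by fun_prop)
  add_mem x hx y hy v hv := by
    rw [add_dotProduct]
    exact add_nonneg (hx v hv) (hy v hv)
  smul_mem c hc x hx v hv := by
    rw [smul_dotProduct]
    exact mul_nonneg hc (hx v hv)
  exists_form := by
    obtain ⟨e, he⟩ := hK.nonempty_interior
    obtain ⟨r, hr, hball⟩ := Metric.mem_nhds_iff.1 (mem_interior_iff_mem_nhds.1 he)
    exact ⟨dotEquiv n e, r / 2, by positivity, fun w hw => mul_norm_le_dotProduct hr hball hw⟩
  nonempty_interior := by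
    obtain ⟨ψ, c, hc, hψ⟩ := hK.exists_form
    obtain ⟨a, rfl⟩ := (dotEquiv n).surjective ψ
    refine ⟨a, mem_interior_iff_mem_nhds.2 (mem_of_superset
      (Metric.ball_mem_nhds a (ε := c / (n + 1)) (by positivity)) fun w hw v hv => ?_)⟩
    rw [Metric.mem_ball, dist_eq_norm, lt_div_iff₀ (by positivity)] at hw
    have h1 := hψ v hv
    rw [dotEquiv_apply] at h1
    have h2 := neg_le_of_abs_le (abs_dotProduct_le (w - a) v)
    rw [sub_dotProduct] at h2
    nlinarith [norm_nonneg v, mul_le_mul_of_nonneg_right hw.le (norm_nonneg v),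
      mul_nonneg (norm_nonneg (w - a)) (norm_nonneg v)]

theorem IsProperCone.dotDual_dotDual {K : Set (Fin n → ℝ)} (hK : IsProperCone K) :
    HilbertGeometry.dotDual (HilbertGeometry.dotDual K) = K := by
  ext v
  rw [hK.mem_iff]
  constructor
  · intro hv f hf
    obtain ⟨a, rfl⟩ := (dotEquiv n).surjective f
    have := hv a hf
    rwa [dotProduct_comm] at this
  · intro h w hw
    rw [dotProduct_comm]
    exact h (dotEquiv n w) hw

/-- The inverse transpose of an invertible matrix. -/
noncomputable def glContragredient (g : GL (Fin n) ℝ) : GL (Fin n) ℝ where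
  val := (g⁻¹ : GL (Fin n) ℝ).1.transpose
  inv := g.1.transpose
  val_inv := by rw [← Matrix.transpose_mul, Units.mul_inv, Matrix.transpose_one]
  inv_val := by rw [← Matrix.transpose_mul, Units.inv_mul, Matrix.transpose_one]

theorem gl_smul_eq (g : GL (Fin n) ℝ) (v : Fin n → ℝ) : g • v = g.1.mulVec v := rfl

theorem dotProduct_glContragredient (g : GL (Fin n) ℝ) (w v : Fin n → ℝ) :
    (g • w) ⬝ᵥ (glContragredient g • v) = w ⬝ᵥ v := by
  rw [gl_smul_eq, gl_smul_eq, glContragredient, Matrix.mulVec_transpose, dotProduct_comm,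
    ← Matrix.dotProduct_mulVec, Matrix.mulVec_mulVec, Units.inv_mul, Matrix.one_mulVec,
    dotProduct_comm]

theorem dotDual_image (g : GL (Fin n) ℝ) (K : Set (Fin n → ℝ)) :
    dotDual (glEquiv g '' K) = glEquiv (glContragredient g) '' dotDual K := by
  ext v
  constructor
  · intro hv
    refine ⟨(glContragredient g)⁻¹ • v, fun w hw => ?_, by simp⟩
    have := hv _ ⟨w, hw, rfl⟩
    rw [dotProduct_comm, ← dotProduct_glContragredient g]
    simpa [dotProduct_comm] using this
  · rintro ⟨v, hv, rfl⟩ _ ⟨w, hw, rfl⟩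
    rw [dotProduct_comm, glEquiv_apply, glEquiv_apply, dotProduct_glContragredient, dotProduct_comm]
    exact hv w hw

/-- A pointed properly convex cone can be normalized by a projective transformation. -/
theorem exists_gl_normalization {K : Set (Fin (n + 1) → ℝ)} (hK : IsProperCone K)
    {u : Fin (n + 1) → ℝ} (hu : u ∈ interior K) :
    ∃ g : GL (Fin (n + 1)) ℝ, (∀ v ∈ K, ∀ i, 0 ≤ (g • v) i) ∧ g • u = 1 ∧
      Metric.ball 1 (1 / ((n : ℝ) + 1)) ⊆ glEquiv g '' K := by
  have hD := hK.dotDual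
  obtain ⟨r, hr, hball⟩ := Metric.mem_nhds_iff.1 (mem_interior_iff_mem_nhds.1 hu)
  set D := dotDual K with hDdef
  have hpos : ∀ w ∈ D, w ≠ 0 → 0 < w ⬝ᵥ u := by
    intro w hw hw0
    rw [dotProduct_comm]
    exact lt_of_lt_of_le (mul_pos (half_pos hr) (norm_pos_iff.2 hw0))
      (mul_norm_le_dotProduct hr hball hw)
  -- Matrices whose rows lie in the compact slice of the dual cone on which `u` takes the value `1`.
  -- The matrix sought is one of maximal `|det|`, as for an Auerbach basis; the maximum is nonzero
  -- because the dual cone spans the space.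
  set S : Set (Matrix (Fin (n + 1)) (Fin (n + 1)) ℝ) :=
    {W | ∀ i, W i ∈ D ∧ W i ⬝ᵥ u = 1} with hSdef
  have hScomp : IsCompact S := by
    have h1 : IsCompact {w : Fin (n + 1) → ℝ | w ∈ D ∧ w ⬝ᵥ u = 1} := by
      refine Metric.isCompact_of_isClosed_isBounded
        (hD.isClosed.inter (isClosed_eq (by fun_prop) continuous_const)) ?_
      refine isBounded_iff_forall_norm_le.2 ⟨2 / r, fun w hw => ?_⟩
      have := mul_norm_le_dotProduct hr hball hw.1
      rw [dotProduct_comm, hw.2] at this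
      rw [le_div_iff₀ hr]
      linarith
    have h2 : S = Set.pi Set.univ fun _ => {w : Fin (n + 1) → ℝ | w ∈ D ∧ w ⬝ᵥ u = 1} := by
      ext W
      exact (Set.mem_univ_pi (f := W) (t := fun _ => {w | w ∈ D ∧ w ⬝ᵥ u = 1})).symm
    rw [h2]
    exact isCompact_univ_pi fun _ => h1
  have hdet : Continuous fun W : Matrix (Fin (n + 1)) (Fin (n + 1)) ℝ => |W.det| :=
    (Continuous.matrix_det continuous_id).abs
  obtain ⟨W₀, hW₀, hW₀det⟩ : ∃ W ∈ S, W.det ≠ 0 := by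
    have hspan : ⊤ ≤ Submodule.span ℝ D := by
      rw [Submodule.eq_top_of_nonempty_interior' (Submodule.span ℝ D)
        (hD.nonempty_interior.mono (interior_mono Submodule.subset_span))]
    set b := Module.Basis.ofSpan hspan
    have e : _ ≃ Fin (n + 1) := b.indexEquiv (Pi.basisFun ℝ (Fin (n + 1)))
    set b' := b.reindex e with hb'
    have hb'D : ∀ i, b' i ∈ D := fun i => by
      rw [hb', Module.Basis.reindex_apply]
      exact Module.Basis.ofSpan_subset hspan ⟨_, rfl⟩
    have hb'u : ∀ i, 0 < b' i ⬝ᵥ u := fun i => hpos _ (hb'D i) (b'.ne_zero i)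
    refine ⟨Matrix.of fun i => (b' i ⬝ᵥ u)⁻¹ • b' i, fun i => ⟨?_, ?_⟩, ?_⟩
    · exact hD.smul_mem _ (inv_nonneg.2 (hb'u i).le) _ (hb'D i)
    · show ((b' i ⬝ᵥ u)⁻¹ • b' i) ⬝ᵥ u = 1
      rw [smul_dotProduct, smul_eq_mul, inv_mul_cancel₀ (hb'u i).ne']
    · have hli : LinearIndependent ℝ fun i => (b' i ⬝ᵥ u)⁻¹ • b' i := by
        have := b'.linearIndependent.units_smul fun i => Units.mk0 _ (inv_pos.2 (hb'u i)).ne'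
        exact this
      have := Matrix.linearIndependent_rows_iff_isUnit.1
        (show LinearIndependent ℝ (Matrix.of fun i => (b' i ⬝ᵥ u)⁻¹ • b' i).row from hli)
      exact ((Matrix.isUnit_iff_isUnit_det _).1 this).ne_zero
  obtain ⟨W, hW, hmax⟩ := hScomp.exists_isMaxOn ⟨W₀, hW₀⟩ hdet.continuousOn
  have hWdet : W.det ≠ 0 := by
    have := hmax hW₀
    rw [← abs_pos]
    exact lt_of_lt_of_le (abs_pos.2 hW₀det) this
  set g : GL (Fin (n + 1)) ℝ := Matrix.GeneralLinearGroup.mkOfDetNeZero W hWdet with hg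
  have hgv : ∀ v i, (g • v) i = W i ⬝ᵥ v := fun v i => rfl
  refine ⟨g, fun v hv i => ?_, ?_, fun h hh => ?_⟩
  · rw [hgv]
    exact (hW i).1 v hv
  · ext i
    rw [hgv, (hW i).2, Pi.one_apply]
  · refine ⟨g⁻¹ • h, ?_, by simp⟩
    rw [← hK.dotDual_dotDual]
    intro w hw
    rcases eq_or_ne w 0 with rfl | hw0
    · simp
    have hwu := hpos w hw hw0
    set w' := (w ⬝ᵥ u)⁻¹ • w with hw'
    have hw'D : w' ∈ D := hD.smul_mem _ (inv_nonneg.2 hwu.le) _ hw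
    have hw'u : w' ⬝ᵥ u = 1 := by
      rw [hw', smul_dotProduct, smul_eq_mul, inv_mul_cancel₀ hwu.ne']
    set c := Matrix.vecMul w' W⁻¹ with hc
    have hWinv : IsUnit W.det := isUnit_iff_ne_zero.2 hWdet
    have hw'c : w' = Matrix.vecMul c W := by
      rw [hc, Matrix.vecMul_vecMul, Matrix.nonsing_inv_mul _ hWinv, Matrix.vecMul_one]
    have hsum : w' = ∑ i, c i • W i := by
      rw [hw'c, Matrix.vecMul_eq_sum]
    -- Replacing row `i` by `w'` stays in `S` and multiplies the determinant by `c i`, so maximality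
    -- bounds `c i`.
    have hc1 : ∀ i, |c i| ≤ 1 := by
      intro i
      have hmem : W.updateRow i w' ∈ S := by
        intro j
        rcases eq_or_ne j i with rfl | hji
        · rw [Matrix.updateRow_self]
          exact ⟨hw'D, hw'u⟩
        · rw [Matrix.updateRow_ne hji]
          exact hW j
      have h1 : |(W.updateRow i w').det| ≤ |W.det| := hmax hmem
      rw [hsum, Matrix.det_updateRow_sum, smul_eq_mul, abs_mul] at h1
      exact le_of_mul_le_mul_right (by linarith) (abs_pos.2 hWdet)
    have hcdot : ∀ v, w' ⬝ᵥ v = c ⬝ᵥ (g • v) := by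
      intro v
      rw [hw'c, ← Matrix.dotProduct_mulVec]
      rfl
    have hgu : g • u = 1 := by
      ext i
      rw [hgv, (hW i).2, Pi.one_apply]
    have h2 : 0 ≤ w' ⬝ᵥ (g⁻¹ • h) := by
      rw [hcdot, smul_inv_smul]
      -- The coordinates `c i` add up to `w' ⬝ᵥ u = 1`. With `|c i| ≤ 1`, the error term is at most
      -- `(n + 1) * ‖h - 1‖ ≤ 1`, hence the radius `1 / (n + 1)`.
      have h3 : c ⬝ᵥ h = 1 + c ⬝ᵥ (h - 1) := by
        rw [dotProduct_sub, ← hgu, ← hcdot u, hw'u]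
        ring
      have h4 := neg_le_of_abs_le (abs_dotProduct_le c (h - 1))
      rw [Metric.mem_ball, dist_eq_norm, lt_div_iff₀ (by positivity)] at hh
      have h5 : ‖c‖ ≤ 1 := (pi_norm_le_iff_of_nonneg zero_le_one).2 hc1
      push_cast at h4
      have h6 : ((n : ℝ) + 1) * ‖c‖ * ‖h - 1‖ ≤ 1 := by
        calc ((n : ℝ) + 1) * ‖c‖ * ‖h - 1‖ ≤ ((n : ℝ) + 1) * 1 * ‖h - 1‖ := by gcongr
          _ ≤ 1 := by linarith
      linarith
    rw [hw', smul_dotProduct, smul_eq_mul] at h2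
    rw [dotProduct_comm]
    exact nonneg_of_mul_nonneg_right h2 (inv_pos.2 hwu)

end Coordinates

end HilbertGeometry

namespace HilbertGeometry

open Filter Topology

/-! ### Non-thin cones have degenerate limits; thinness passes to the dual -/

section NotThin

/-- The failure of thinness, in a form that is convenient for rescaling. -/
theorem exists_triangle_of_not_isThinCone {E : Type*} [NormedAddCommGroup E] [NormedSpace ℝ E]
    {K : Set E} {R : ℝ} (h : ¬ IsThinCone R K) : ∃ x ∈ interior K, ∃ y ∈ interior K,
      ∃ z ∈ interior K, ∀ s t : ℝ, 0 ≤ s → 0 ≤ t → ∀ w, (w = s • x + t • z ∨ w = s • y + t • z) →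
        w - (x + y) ∈ K → R • (x + y) - w ∉ K := by
  unfold IsThinCone at h
  push Not at h
  obtain ⟨x, hx, y, hy, z, hz, h⟩ := h
  exact ⟨x, hx, y, hy, z, hz, fun s t hs ht w hw h1 h2 => h s t hs ht w hw h1 h2⟩

theorem triangle_image {E : Type*} [NormedAddCommGroup E] [NormedSpace ℝ E]
    {K : Set E} {R : ℝ} {x y z : E} (L : E ≃L[ℝ] E)
    (h : ∀ s t : ℝ, 0 ≤ s → 0 ≤ t → ∀ w, (w = s • x + t • z ∨ w = s • y + t • z) →
      w - (x + y) ∈ K → R • (x + y) - w ∉ K) :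
    ∀ s t : ℝ, 0 ≤ s → 0 ≤ t → ∀ w, (w = s • L x + t • L z ∨ w = s • L y + t • L z) →
      w - (L x + L y) ∈ L '' K → R • (L x + L y) - w ∉ L '' K := by
  intro s t hs ht w hw h1 h2
  have hm : ∀ v, L v ∈ L '' K → v ∈ K := by
    rintro v ⟨v', hv', e⟩
    rwa [← L.injective e]
  have hw' : ∃ w', w = L w' ∧ (w' = s • x + t • z ∨ w' = s • y + t • z) := by
    rcases hw with rfl | rfl
    · exact ⟨_, by simp, Or.inl rfl⟩
    · exact ⟨_, by simp, Or.inr rfl⟩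
  obtain ⟨w', rfl, hw'⟩ := hw'
  exact h s t hs ht w' hw' (hm _ (by simpa using h1)) (hm _ (by simpa using h2))

variable {d : ℕ} {K : Set (Fin (d + 1) → ℝ)}

theorem norm_le_sum_of_nonneg {v : Fin (d + 1) → ℝ} (hv : ∀ i, 0 ≤ v i) :
    1 * ‖v‖ ≤ dotEquiv (d + 1) 1 v := by
  rw [one_mul, dotEquiv_apply, one_dotProduct]
  refine (pi_norm_le_iff_of_nonneg (Finset.sum_nonneg fun i _ => hv i)).2 fun i => ?_
  rw [Real.norm_of_nonneg (hv i)]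
  exact Finset.single_le_sum (fun j _ => hv j) (Finset.mem_univ i)

/-- Triangles that violate thinness with constant `n` are normalized so that `x n + y n` becomes the
vector `1`. The bounds on the normalized cones (orthant and ball) are part of the conclusion because
they also control the dual cones in `exists_limit_not_isSmoothCone`. -/
theorem exists_limit_not_isStrictlyConvexCone (hK : IsProperCone K)
    (h : ∀ R, ¬ IsThinCone R K) :
    ∃ (g : ℕ → GL (Fin (d + 1)) ℝ) (K' : Set (Fin (d + 1) → ℝ)), IsProperCone K' ∧
      ConeTendsto (fun n => glEquiv (g n) '' K) K' ∧ (∀ n, ∀ v ∈ K, ∀ i, 0 ≤ (g n • v) i) ∧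
      (∀ n, Metric.ball 1 (1 / ((d : ℝ) + 1)) ⊆ glEquiv (g n) '' K) ∧
      ¬ IsStrictlyConvexCone K' := by
  choose x hx y hy z hz hxyz using fun n : ℕ => exists_triangle_of_not_isThinCone (h n)
  choose g hg hgu hball using fun n : ℕ => exists_gl_normalization hK
    (hK.add_mem_interior (interior_subset (hx n)) (hy n))
  have hC : ∀ n, IsProperCone (glEquiv (g n) '' K) := fun n => hK.image _
  have hψ : ∀ n, ∀ v ∈ glEquiv (g n) '' K, 1 * ‖v‖ ≤ dotEquiv (d + 1) 1 v := by
    rintro n _ ⟨v, hv, rfl⟩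
    exact norm_le_sum_of_nonneg (hg n v hv)
  have hr : 0 < 1 / ((d : ℝ) + 1) := by positivity
  obtain ⟨K', hK', hlim, -, hball'⟩ := exists_coneTendsto hC one_pos hψ hr hball
  refine ⟨g, K', hK', hlim, hg, hball, ?_⟩
  refine hlim.not_isStrictlyConvexCone hC hK' one_pos hψ
    (x := fun n => glEquiv (g n) (x n)) (y := fun n => glEquiv (g n) (y n))
    (z := fun n => glEquiv (g n) (z n)) (u := 1)
    (fun n => ⟨_, interior_subset (hx n), rfl⟩) (fun n => ⟨_, interior_subset (hy n), rfl⟩)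
    (fun n => ⟨_, interior_subset (hz n), rfl⟩) (fun n => ?_)
    (mem_interior_iff_mem_nhds.2 (mem_of_superset (Metric.ball_mem_nhds 1 hr) hball')) ?_
    fun n => triangle_image _ (hxyz n)
  · rw [Ne, map_eq_zero_iff _ (glEquiv (g n)).injective]
    exact hK.ne_zero_of_mem_interior (hz n)
  · refine tendsto_const_nhds.congr fun n => ?_
    rw [glEquiv_apply, glEquiv_apply, ← smul_add, hgu n]

/-- Passing to the limit commutes with duality (one inclusion). -/
theorem ConeTendsto.dotDual_subset {n : ℕ} {C : ℕ → Set (Fin n → ℝ)} {D K : Set (Fin n → ℝ)}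
    (hCD : ConeTendsto C D) (hC : ∀ n, IsProperCone (C n)) (hD : IsProperCone D)
    (hCK : ConeTendsto (fun n => dotDual (C n)) K) (hK : IsProperCone K) : dotDual D ⊆ K := by
  have hint : interior (dotDual D) ⊆ K := by
    intro v hv
    refine hCK.mem (fun _ => v) ?_ v tendsto_const_nhds
    by_contra hcon
    rw [← Ultrafilter.eventually_not] at hcon
    have hcon' : ∀ᶠ k in hyperfilter ℕ, ∃ w, ‖w‖ = 1 ∧ w ∈ C k ∧ w ⬝ᵥ v ≤ 0 := by
      filter_upwards [hcon] with k hk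
      simp only [dotDual, Set.mem_ofPred_eq, not_forall, not_le] at hk
      obtain ⟨w, hw, hwv⟩ := hk
      have hw0 : w ≠ 0 := by
        rintro rfl
        simp at hwv
      have hw1 : 0 < ‖w‖ := norm_pos_iff.2 hw0
      refine ⟨‖w‖⁻¹ • w, ?_, (hC k).smul_mem _ (inv_nonneg.2 hw1.le) _ hw, ?_⟩
      · rw [norm_smul, norm_inv, norm_norm, inv_mul_cancel₀ hw1.ne']
      · rw [smul_dotProduct, dotProduct_comm]
        exact mul_nonpos_of_nonneg_of_nonpos (inv_nonneg.2 hw1.le) hwv.le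
    obtain ⟨w, hw⟩ := hcon'.choice
    obtain ⟨w', hw'⟩ := exists_tendsto_hyperfilter (w := w) (B := 1) (hw.mono fun k h => h.1.le)
    have h1 : w' ∈ D := hCD.mem w (hw.mono fun k h => h.2.1) w' hw'
    have h2 : w' ≠ 0 := by
      rintro rfl
      have := tendsto_nhds_unique
        (tendsto_const_nhds.congr' (hw.mono fun k h => h.1.symm)) hw'.norm
      simp at this
    have h3 : w' ⬝ᵥ v ≤ 0 := by
      have hc : Continuous fun a : Fin n → ℝ => a ⬝ᵥ v := by fun_prop
      exact le_of_tendsto ((hc.tendsto w').comp hw') (hw.mono fun k h => h.2.2)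
    refine (IsProperCone.pos_of_mem_interior (f := dotEquiv n w') ?_ (fun a ha => ?_) hv).not_ge h3
    · rwa [Ne, map_eq_zero_iff _ (dotEquiv n).injective]
    · rw [dotEquiv_apply, dotProduct_comm]
      exact ha w' h1
  intro v hv
  obtain ⟨e, he⟩ := hD.dotDual.nonempty_interior
  exact hK.mem_of_forall_add_smul_mem fun ε hε => hint
    (hD.dotDual.add_mem_interior hv (hD.dotDual.smul_mem_interior hε he))

/-- Let `D` be a limit of images of the dual cone that is not strictly convex, and `K'` the limit of
their duals, which are images of `K`. If `x + y` is on the boundary of `D` with `x, y` independent,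
a form supporting `D` there is a vector `p ∈ K'`, and `x, y` become, after normalization, two
distinct forms supporting `K'` at `p`. -/
theorem exists_limit_not_isSmoothCone (hK : IsProperCone K)
    (h : ∀ R, ¬ IsThinCone R (dotDual K)) :
    ∃ (g : ℕ → GL (Fin (d + 1)) ℝ) (K' : Set (Fin (d + 1) → ℝ)), IsProperCone K' ∧
      ConeTendsto (fun n => glEquiv (g n) '' K) K' ∧ ¬ IsSmoothCone K' := by
  obtain ⟨g, D, hD, hlim, hg, hball, hSC⟩ := exists_limit_not_isStrictlyConvexCone hK.dotDual h
  have hC : ∀ n, IsProperCone (glEquiv (g n) '' dotDual K) := fun n => hK.dotDual.image _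
  have hr : 0 < 1 / ((d : ℝ) + 1) := by positivity
  have hdual : ∀ n, dotDual (glEquiv (g n) '' dotDual K) =
      glEquiv (glContragredient (g n)) '' K := fun n => by
    rw [dotDual_image, hK.dotDual_dotDual]
  -- The two bounds are exchanged by duality: the ball in the images gives a common form on their
  -- duals, and the inclusion in the orthant gives the unit ball about `1`, whose vectors have
  -- positive coordinates.
  obtain ⟨K', hK', hlim', -⟩ := exists_coneTendsto
    (C := fun n => dotDual (glEquiv (g n) '' dotDual K)) (fun n => (hC n).dotDual)
    (ψ := dotEquiv (d + 1) 1) (c := 1 / ((d : ℝ) + 1) / 2) (by positivity)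
    (fun n v hv => mul_norm_le_dotProduct hr (hball n) hv) (e := 1) (r := 1) one_pos (by
      rintro n v hv _ ⟨w, hw, rfl⟩
      refine Finset.sum_nonneg fun i _ => mul_nonneg ?_ (hg n w hw i)
      rw [Metric.mem_ball, dist_pi_lt_iff one_pos] at hv
      have := hv i
      rw [Real.dist_eq, abs_lt, Pi.one_apply] at this
      linarith)
  have hsub := hlim.dotDual_subset hC hD hlim' hK'
  have hpair : ∀ w ∈ D, ∀ v ∈ K', 0 ≤ w ⬝ᵥ v := by
    intro w hw v hv
    obtain ⟨a, ha, haw⟩ := hlim.exists_seq w hw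
    obtain ⟨b, hb, hbv⟩ := hlim'.exists_seq v hv
    have hc : Continuous fun p : (Fin (d + 1) → ℝ) × (Fin (d + 1) → ℝ) => p.1 ⬝ᵥ p.2 := by fun_prop
    refine ge_of_tendsto ((hc.tendsto (w, v)).comp (haw.prodMk_nhds hbv)) (.of_forall fun n => ?_)
    have := hb n _ (ha n)
    rwa [dotProduct_comm] at this
  refine ⟨fun n => glContragredient (g n), K', hK', ?_, ?_⟩
  · simp only [hdual] at hlim'
    exact hlim'
  · intro hsm
    apply hSC
    intro x hx y hy hxy hli
    obtain ⟨f, hf0, hf, hfxy⟩ := hD.exists_nonpos_of_notMem_interior hxy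
    obtain ⟨p, rfl⟩ := (dotEquiv (d + 1)).surjective f
    rw [map_add] at hfxy
    have hpx : p ⬝ᵥ x = 0 := le_antisymm (by linarith [hf y hy, dotEquiv_apply p x]) (hf x hx)
    have hpy : p ⬝ᵥ y = 0 := le_antisymm (by linarith [hf x hx, dotEquiv_apply p y]) (hf y hy)
    have hp0 : p ≠ 0 := by
      rintro rfl
      simp at hf0
    have hpK : p ∈ K' := hsub hf
    obtain ⟨e, he⟩ := hK'.nonempty_interior
    have hx0 : x ≠ 0 := hli.ne_zero 0
    have hy0 : y ≠ 0 := hli.ne_zero 1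
    have pos : ∀ w ∈ D, w ≠ 0 → 0 < w ⬝ᵥ e := fun w hw hw0 =>
      IsProperCone.pos_of_mem_interior (f := dotEquiv (d + 1) w)
        (by rwa [Ne, map_eq_zero_iff _ (dotEquiv (d + 1)).injective]) (hpair w hw) he
    have hxe := pos x hx hx0
    have hye := pos y hy hy0
    have := hsm p hpK hp0 (dotEquiv (d + 1) ((x ⬝ᵥ e)⁻¹ • x)) (dotEquiv (d + 1) ((y ⬝ᵥ e)⁻¹ • y))
      (hpair _ (hD.smul_mem _ (inv_nonneg.2 hxe.le) _ hx))
      (hpair _ (hD.smul_mem _ (inv_nonneg.2 hye.le) _ hy))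
      (by rw [dotEquiv_apply, smul_dotProduct, dotProduct_comm x p, hpx, smul_zero])
      (by rw [dotEquiv_apply, smul_dotProduct, dotProduct_comm y p, hpy, smul_zero]) e he
      (by rw [dotEquiv_apply, smul_dotProduct, smul_eq_mul, inv_mul_cancel₀ hxe.ne'])
      (by rw [dotEquiv_apply, smul_dotProduct, smul_eq_mul, inv_mul_cancel₀ hye.ne'])
    have h1 := (dotEquiv (d + 1)).injective this
    rw [LinearIndependent.pair_iff] at hli
    have h2 := hli (x ⬝ᵥ e)⁻¹ (-(y ⬝ᵥ e)⁻¹) (by rw [h1]; module)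
    exact (inv_pos.2 hxe).ne' h2.1

/-- All limits of images of `K` are `R`-thin, hence smooth; a dual cone that is not thin would yield
a limit that is not. The argument is by compactness and gives no explicit `R'`. -/
theorem IsThinCone.dotDual (hK : IsProperCone K) {R : ℝ} (h : IsThinCone R K) :
    ∃ R', IsThinCone R' (dotDual K) := by
  by_contra! hcon
  obtain ⟨g, K', hK', hlim, hsm⟩ := exists_limit_not_isSmoothCone hK hcon
  exact hsm ((hlim.isThinCone (fun n => hK.image _) hK' fun n => h.image _).isSmoothCone hK')

end NotThin

end HilbertGeometry

namespace HilbertGeometry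

open Filter Topology

/-! ### Properly convex open sets and the cones above them -/

section Lifts

variable {E : Type*} [NormedAddCommGroup E] [NormedSpace ℝ E] {S T : Set (ℙ ℝ E)}

theorem mk_mem_iff {v : E} (hv : v ≠ 0) : Projectivization.mk ℝ v hv ∈ S ↔ v ∈ preimg S :=
  ⟨fun h => ⟨hv, h⟩, fun ⟨_, h⟩ => h⟩

theorem ne_zero_of_mem_preimg {v : E} (hv : v ∈ preimg S) : v ≠ 0 := hv.1

theorem mk_smul_eq {v : E} (hv : v ≠ 0) {c : ℝ} (hc : c ≠ 0) :
    Projectivization.mk ℝ (c • v) (smul_ne_zero hc hv) = Projectivization.mk ℝ v hv :=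
  (Projectivization.mk_eq_mk_iff' ℝ _ _ _ _).2 ⟨c, rfl⟩

theorem smul_mem_preimg {v : E} (hv : v ∈ preimg S) {c : ℝ} (hc : c ≠ 0) : c • v ∈ preimg S := by
  obtain ⟨hv0, hv⟩ := hv
  exact ⟨smul_ne_zero hc hv0, by rwa [mk_smul_eq hv0 hc]⟩

theorem neg_mem_preimg {v : E} : -v ∈ preimg S ↔ v ∈ preimg S := by
  have h : ∀ {v : E}, v ∈ preimg S → -v ∈ preimg S := fun hv => by
    simpa using smul_mem_preimg hv (c := -1) (by norm_num)
  exact ⟨fun hv => by simpa using h hv, h⟩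

theorem isOpen_iff_preimg : IsOpen S ↔ IsOpen (preimg S) := by
  have h : preimg S = Subtype.val ''
      ((fun v : {v : E // v ≠ 0} => Projectivization.mk ℝ v.1 v.2) ⁻¹' S) := by
    ext v
    constructor
    · rintro ⟨hv, h⟩
      exact ⟨⟨v, hv⟩, h, rfl⟩
    · rintro ⟨w, hw, rfl⟩
      exact ⟨w.2, hw⟩
  have ho : IsOpen {v : E | v ≠ 0} := isOpen_ne
  rw [h]
  exact ho.isOpenEmbedding_subtypeVal.isOpen_iff_image_isOpen
    (s := (fun v : {v : E // v ≠ 0} => Projectivization.mk ℝ v.1 v.2) ⁻¹' S)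

theorem preimg_compl : preimg Sᶜ = (preimg S)ᶜ \ {0} := by
  ext v
  constructor
  · rintro ⟨hv, h⟩
    exact ⟨fun h' => h h'.2, hv⟩
  · rintro ⟨h, hv⟩
    exact ⟨hv, fun h' => h ⟨hv, h'⟩⟩

theorem preimg_affineChart {φ : StrongDual ℝ E} {v : E} :
    v ∈ preimg (affineChart φ) ↔ φ v ≠ 0 := by
  by_cases hv : v = 0
  · subst hv
    simp only [map_zero, ne_eq, not_true_eq_false, iff_false]
    exact fun h => h.1 rfl
  · rw [← mk_mem_iff hv]
    obtain ⟨a, ha⟩ := Projectivization.exists_smul_eq_mk_rep ℝ v hv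
    rw [affineChart, Set.mem_ofPred_eq, ← ha, Units.smul_def, map_smul, smul_eq_mul]
    simp

theorem preimg_subset (h : S ⊆ T) : preimg S ⊆ preimg T := fun _ hv => ⟨hv.1, h hv.2⟩

/-- `K` is (the closure of) one of the two cones above `Ω`. -/
structure IsLift (Ω : Set (ℙ ℝ E)) (K : Set E) : Prop where
  isProperCone : IsProperCone K
  mem_preimg_iff : ∀ v, v ∈ preimg Ω ↔ v ∈ interior K ∨ -v ∈ interior K

variable {Ω : Set (ℙ ℝ E)} {K : Set E}

namespace IsLift

theorem zero_notMem_interior (h : IsLift Ω K) : (0 : E) ∉ interior K := fun h0 =>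
  ne_zero_of_mem_preimg ((h.mem_preimg_iff 0).2 (Or.inl h0)) rfl

theorem mem_preimg (h : IsLift Ω K) {v : E} (hv : v ∈ interior K) : v ∈ preimg Ω :=
  (h.mem_preimg_iff v).2 (Or.inl hv)

theorem ne_zero (h : IsLift Ω K) {v : E} (hv : v ∈ interior K) : v ≠ 0 :=
  ne_zero_of_mem_preimg (h.mem_preimg hv)

theorem mk_mem (h : IsLift Ω K) {v : E} (hv : v ∈ interior K) :
    Projectivization.mk ℝ v (h.ne_zero hv) ∈ Ω := (h.mem_preimg hv).2

theorem exists_rep (h : IsLift Ω K) {x : ℙ ℝ E} (hx : x ∈ Ω) :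
    ∃ (v : E) (hv : v ∈ interior K), x = Projectivization.mk ℝ v (h.ne_zero hv) := by
  induction x using Projectivization.ind with
  | h v hv =>
    rcases (h.mem_preimg_iff v).1 ((mk_mem_iff hv).1 hx) with hv' | hv'
    · exact ⟨v, hv', rfl⟩
    · exact ⟨-v, hv', (Projectivization.mk_eq_mk_iff' ℝ _ _ _ _).2 ⟨-1, by simp⟩⟩

theorem isOpen (h : IsLift Ω K) : IsOpen Ω := by
  rw [isOpen_iff_preimg]
  have : preimg Ω = interior K ∪ Neg.neg ⁻¹' interior K := by
    ext v
    exact h.mem_preimg_iff v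
  rw [this]
  exact isOpen_interior.union (isOpen_interior.preimage continuous_neg)

theorem isProperlyConvexOpen (h : IsLift Ω K) : IsProperlyConvexOpen Ω where
  nonempty := by
    obtain ⟨e, he⟩ := h.isProperCone.nonempty_interior
    exact ⟨_, h.mk_mem he⟩
  isOpen := h.isOpen
  exists_chart := by
    obtain ⟨ψ, c, hc, hψ⟩ := h.isProperCone.exists_form
    have hpos : ∀ v ∈ interior K, 0 < ψ v := fun v hv =>
      IsProperCone.pos_of_ne_zero hc hψ (interior_subset hv) (h.ne_zero hv)
    have hmem : ∀ v ∈ inChart ψ Ω, v ∈ interior K := by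
      rintro v ⟨hv1, hv⟩
      rcases (h.mem_preimg_iff v).1 hv with h1 | h1
      · exact h1
      · have := hpos _ h1
        rw [map_neg, hv1] at this
        linarith
    refine ⟨ψ, fun x hx => ?_, ?_, ?_⟩
    · obtain ⟨v, hv, rfl⟩ := h.exists_rep hx
      rw [mk_mem_iff, preimg_affineChart]
      exact (hpos v hv).ne'
    · intro x hx y hy a b ha hb hab
      refine ⟨by simp [hx.1, hy.1, hab], h.mem_preimg ?_⟩
      exact (h.isProperCone.convex.interior) (hmem x hx) (hmem y hy) ha hb hab
    · refine isBounded_iff_forall_norm_le.2 ⟨1 / c, fun v hv => ?_⟩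
      have := hψ v (interior_subset (hmem v hv))
      rw [hv.1] at this
      rw [le_div_iff₀ hc]
      linarith

theorem mem_closure_interior (h : IsLift Ω K) {v : E} (hv : v ∈ K) : v ∈ closure (interior K) := by
  rw [h.isProperCone.convex.closure_interior_eq_closure_of_nonempty_interior
    h.isProperCone.nonempty_interior]
  exact subset_closure hv

theorem mem_preimg_closure_iff (h : IsLift Ω K) (v : E) :
    v ∈ preimg (closure Ω) ↔ v ≠ 0 ∧ (v ∈ K ∨ -v ∈ K) := by
  constructor
  · intro hv
    refine ⟨hv.1, ?_⟩
    -- `T` is the image of `K ∪ -K` in projective space; it is closed and contains `Ω`.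
    set T : Set (ℙ ℝ E) := {x | ∀ (v : E) (hv : v ≠ 0), x = Projectivization.mk ℝ v hv →
      v ∈ K ∨ -v ∈ K} with hT
    have hTpre : preimg Tᶜ = (K ∪ Neg.neg ⁻¹' K)ᶜ := by
      ext w
      constructor
      · rintro ⟨hw, hwT⟩
        simp only [hT, Set.mem_compl_iff, Set.mem_ofPred_eq] at hwT
        push Not at hwT
        obtain ⟨w', hw', hww', h1, h2⟩ := hwT
        rw [Projectivization.mk_eq_mk_iff'] at hww'
        obtain ⟨a, rfl⟩ := hww'
        have hsm : ∀ {b : ℝ} {z : E}, 0 ≤ b → z ∈ K → b • z ∈ K := fun hb hz =>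
          h.isProperCone.smul_mem _ hb _ hz
        have ha : a ≠ 0 := by
          rintro rfl
          simp at hw
        have e : w' = a⁻¹ • a • w' := by rw [smul_smul, inv_mul_cancel₀ ha, one_smul]
        rintro (h3 | h3)
        · rcases le_or_gt 0 a with h4 | h4
          · exact h1 (by rw [e]; exact hsm (inv_nonneg.2 h4) h3)
          · refine h2 ?_
            rw [e, ← neg_smul]
            exact hsm (neg_nonneg.2 (inv_nonpos.2 h4.le)) h3
        · rcases le_or_gt 0 a with h4 | h4
          · refine h2 ?_
            rw [e, ← smul_neg]
            exact hsm (inv_nonneg.2 h4) h3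
          · refine h1 ?_
            rw [e, ← neg_neg (a⁻¹ • a • w'), ← smul_neg, ← neg_smul]
            exact hsm (neg_nonneg.2 (inv_nonpos.2 h4.le)) h3
      · intro hw
        have hw0 : w ≠ 0 := by
          rintro rfl
          exact hw (Or.inl h.isProperCone.zero_mem)
        exact ⟨hw0, fun hT' => hw (hT' w hw0 rfl)⟩
    have hTcl : IsClosed T := by
      rw [← isOpen_compl_iff, isOpen_iff_preimg, hTpre]
      exact (h.isProperCone.isClosed.union
        (h.isProperCone.isClosed.preimage continuous_neg)).isOpen_compl
    have hsub : Ω ⊆ T := by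
      rintro x hx v hv rfl
      rcases (h.mem_preimg_iff v).1 ((mk_mem_iff hv).1 hx) with h1 | h1
      · exact Or.inl (interior_subset h1)
      · exact Or.inr (interior_subset h1)
    exact closure_minimal hsub hTcl hv.2 v hv.1 rfl
  · have key : ∀ v, v ≠ 0 → v ∈ K → v ∈ preimg (closure Ω) := by
      intro v hv0 hv
      by_contra hcon
      have hopen : IsOpen (preimg (closure Ω)ᶜ) := isOpen_iff_preimg.1 isClosed_closure.isOpen_compl
      have hmem : v ∈ preimg (closure Ω)ᶜ := by
        rw [preimg_compl]
        exact ⟨hcon, hv0⟩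
      obtain ⟨w, hw, hwK⟩ := mem_closure_iff.1 (h.mem_closure_interior hv) _ hopen hmem
      exact hw.2 (subset_closure (h.mk_mem hwK))
    rintro ⟨hv0, hv | hv⟩
    · exact key v hv0 hv
    · exact neg_mem_preimg.1 (key (-v) (neg_ne_zero.2 hv0) hv)

theorem neg_notMem_interior (h : IsLift Ω K) {v : E} (hv : v ∈ K) : -v ∉ interior K := fun h' =>
  h.zero_notMem_interior (by simpa using h.isProperCone.add_mem_interior hv h')

theorem mem_preimg_frontier_iff (h : IsLift Ω K) (v : E) : v ∈ preimg (frontier Ω) ↔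
    v ≠ 0 ∧ ((v ∈ K ∧ v ∉ interior K) ∨ (-v ∈ K ∧ -v ∉ interior K)) := by
  have h1 : v ∈ preimg (frontier Ω) ↔ v ∈ preimg (closure Ω) ∧ v ∉ preimg Ω := by
    rw [h.isOpen.frontier_eq]
    constructor
    · rintro ⟨hv, h1, h2⟩
      exact ⟨⟨hv, h1⟩, fun h3 => h2 h3.2⟩
    · rintro ⟨⟨hv, h1⟩, h2⟩
      exact ⟨hv, h1, fun h3 => h2 ⟨hv, h3⟩⟩
  rw [h1, h.mem_preimg_closure_iff, h.mem_preimg_iff]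
  have h2 : v ∈ K → -v ∉ interior K := h.neg_notMem_interior
  have h3 : -v ∈ K → v ∉ interior K := fun h' => by simpa using h.neg_notMem_interior h'
  tauto

theorem closure_subset_affineChart (h : IsLift Ω K) {ψ : StrongDual ℝ E} {c : ℝ} (hc : 0 < c)
    (hψ : ∀ x ∈ K, c * ‖x‖ ≤ ψ x) : closure Ω ⊆ affineChart ψ := by
  intro x hx
  induction x using Projectivization.ind with
  | h w hw =>
    rw [mk_mem_iff, preimg_affineChart]
    rcases ((h.mem_preimg_closure_iff w).1 ⟨hw, hx⟩).2 with h1 | h1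
    · exact (IsProperCone.pos_of_ne_zero hc hψ h1 hw).ne'
    · have := IsProperCone.pos_of_ne_zero hc hψ h1 (neg_ne_zero.2 hw)
      rw [map_neg] at this
      linarith

/-- A linear form that does not vanish on the closure of `Ω` has a constant sign on the cone. -/
theorem pos_of_closure_subset (h : IsLift Ω K) {φ : StrongDual ℝ E}
    (hφ : closure Ω ⊆ affineChart φ) {u : E} (hu : u ∈ interior K) (hu1 : 0 < φ u) {w : E}
    (hw : w ∈ K) (hw0 : w ≠ 0) : 0 < φ w := by
  have hne : ∀ w ∈ K, w ≠ 0 → φ w ≠ 0 := fun w hw hw0 => preimg_affineChart.1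
    (preimg_subset hφ ((h.mem_preimg_closure_iff w).2 ⟨hw0, Or.inl hw⟩))
  by_contra! hcon
  have hlt := lt_of_le_of_ne hcon (hne w hw hw0)
  -- The positive combination `(φ u) w - (φ w) u` is interior and killed by `φ`.
  have h1 := h.isProperCone.add_mem_interior
    (h.isProperCone.smul_mem _ hu1.le w hw) (h.isProperCone.smul_mem_interior (neg_pos.2 hlt) hu)
  refine hne _ (interior_subset h1) (h.ne_zero h1) ?_
  simp only [map_add, map_smul, smul_eq_mul]
  ring

end IsLift

theorem IsProperCone.exists_isLift [Nontrivial E] (hK : IsProperCone K) :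
    ∃ Ω : Set (ℙ ℝ E), IsLift Ω K := by
  refine ⟨{x | ∃ (v : E) (hv : v ≠ 0), v ∈ interior K ∧ x = Projectivization.mk ℝ v hv}, hK,
    fun v => ⟨?_, ?_⟩⟩
  · rintro ⟨hv, w, hw, hwK, e⟩
    obtain ⟨a, rfl⟩ := (Projectivization.mk_eq_mk_iff' ℝ _ _ _ _).1 e
    rcases lt_trichotomy a 0 with ha | rfl | ha
    · right
      rw [← neg_smul]
      exact hK.smul_mem_interior (neg_pos.2 ha) hwK
    · simp at hv
    · exact Or.inl (hK.smul_mem_interior ha hwK)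
  · rintro (hv | hv)
    · exact ⟨hK.ne_zero_of_mem_interior hv, v, hK.ne_zero_of_mem_interior hv, hv, rfl⟩
    · have := hK.ne_zero_of_mem_interior hv
      exact ⟨neg_ne_zero.1 this, -v, this, hv,
        (Projectivization.mk_eq_mk_iff' ℝ _ _ _ _).2 ⟨-1, by simp⟩⟩

/-- The cone is the closure of the half `C` of the preimage on which the form `φ` of the chart is
positive. Convexity in the chart makes `C` stable under addition, boundedness in the chart gives the
bound `B⁻¹ * ‖v‖ ≤ φ v`, and the open convex set `C` is the interior of its closure. -/
theorem IsProperlyConvexOpen.exists_isLift (hΩ : IsProperlyConvexOpen Ω) :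
    ∃ K, IsLift Ω K := by
  obtain ⟨φ, hφ, hconv, hbdd⟩ := hΩ.exists_chart
  obtain ⟨B, hB0, hB⟩ := hbdd.exists_pos_norm_le
  set C := {v : E | 0 < φ v ∧ v ∈ preimg Ω} with hC
  have hne : ∀ v ∈ preimg Ω, φ v ≠ 0 := fun v hv => preimg_affineChart.1 (preimg_subset hφ hv)
  have hCopen : IsOpen C :=
    (isOpen_lt continuous_const φ.continuous).inter (isOpen_iff_preimg.1 hΩ.isOpen)
  have hchart : ∀ v ∈ C, (φ v)⁻¹ • v ∈ inChart φ Ω := fun v hv =>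
    ⟨by simp [hv.1.ne'], smul_mem_preimg hv.2 (inv_ne_zero hv.1.ne')⟩
  have hsmul : ∀ c : ℝ, 0 < c → ∀ v ∈ C, c • v ∈ C := fun c hc v hv =>
    ⟨by simpa using mul_pos hc hv.1, smul_mem_preimg hv.2 hc.ne'⟩
  have hadd : ∀ v ∈ C, ∀ w ∈ C, v + w ∈ C := by
    intro v hv w hw
    have hs : 0 < φ v + φ w := add_pos hv.1 hw.1
    have := hconv (hchart v hv) (hchart w hw) (a := φ v / (φ v + φ w)) (b := φ w / (φ v + φ w))
      (div_nonneg hv.1.le hs.le) (div_nonneg hw.1.le hs.le) (by field_simp)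
    have h2 := hsmul (φ v + φ w) hs _ ⟨by rw [this.1]; exact one_pos, this.2⟩
    convert h2 using 1
    rw [smul_add, smul_smul, smul_smul, smul_smul, smul_smul]
    have e1 : (φ v + φ w) * (φ v / (φ v + φ w)) * (φ v)⁻¹ = 1 := by
      have := hv.1.ne'
      field_simp
    have e2 : (φ v + φ w) * (φ w / (φ v + φ w)) * (φ w)⁻¹ = 1 := by
      have := hw.1.ne'
      field_simp
    rw [e1, e2, one_smul, one_smul]
  have hnorm : ∀ v ∈ C, B⁻¹ * ‖v‖ ≤ φ v := by
    intro v hv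
    have := hB _ (hchart v hv)
    rw [norm_smul, norm_inv, Real.norm_of_nonneg hv.1.le, inv_mul_le_iff₀ hv.1] at this
    rw [inv_mul_le_iff₀ hB0]
    linarith
  have hCconv : Convex ℝ C := by
    rw [convex_iff_forall_pos]
    intro x hx y hy a b ha hb _
    exact hadd _ (hsmul a ha x hx) _ (hsmul b hb y hy)
  have hCne : C.Nonempty := by
    obtain ⟨x, hx⟩ := hΩ.nonempty
    induction x using Projectivization.ind with
    | h v hv =>
      have hv' := (mk_mem_iff hv).1 hx
      rcases lt_or_gt_of_ne (hne v hv') with h | h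
      · exact ⟨-v, by simpa using h, neg_mem_preimg.2 hv'⟩
      · exact ⟨v, h, hv'⟩
  have hint : interior (closure C) = C := by
    rw [hCconv.interior_closure_eq_interior_of_nonempty_interior
      (by rwa [hCopen.interior_eq]), hCopen.interior_eq]
  refine ⟨closure C, ⟨isClosed_closure, ?_, ?_, ⟨φ, B⁻¹, by positivity, ?_⟩, by rwa [hint]⟩, ?_⟩
  · intro x hx y hy
    exact map_mem_closure₂ continuous_add hx hy hadd
  · intro c hc x hx
    rcases hc.eq_or_lt with rfl | hc
    · rw [zero_smul]
      obtain ⟨v, hv⟩ := hCne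
      have ht : Tendsto (fun a : ℝ => a • v) (𝓝[>] 0) (𝓝 0) := by
        have : Tendsto (fun a : ℝ => a • v) (𝓝 0) (𝓝 ((0 : ℝ) • v)) :=
          Continuous.tendsto (by fun_prop) 0
        simpa using this.mono_left nhdsWithin_le_nhds
      refine mem_closure_of_tendsto ht ?_
      filter_upwards [self_mem_nhdsWithin] with a ha using hsmul a ha v hv
    · exact map_mem_closure (continuous_const_smul c) hx fun v hv => hsmul c hc v hv
  · intro x hx
    exact closure_minimal (t := {x | B⁻¹ * ‖x‖ ≤ φ x}) hnorm
      (isClosed_le (by fun_prop) φ.continuous) hx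
  · intro v
    rw [hint]
    constructor
    · intro hv
      rcases lt_or_gt_of_ne (hne v hv) with h | h
      · exact Or.inr ⟨by simpa using h, neg_mem_preimg.2 hv⟩
      · exact Or.inl ⟨h, hv⟩
    · rintro (h | h)
      · exact h.2
      · exact neg_mem_preimg.1 h.2

end Lifts

end HilbertGeometry

namespace HilbertGeometry

open Filter Topology

/-! ### The order ratio of a cone -/

section Ratio

variable {E : Type*} [NormedAddCommGroup E] [NormedSpace ℝ E] {K : Set E}

/-- The least `r` such that `r • v - u` belongs to the cone. -/
noncomputable def coneRatio (K : Set E) (u v : E) : ℝ := sInf {r : ℝ | r • v - u ∈ K}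

namespace IsProperCone

theorem coneRatio_isLeast (hK : IsProperCone K) {u v : E} (hv : v ∈ interior K) (hv0 : v ≠ 0) :
    IsLeast {r : ℝ | r • v - u ∈ K} (coneRatio K u v) := by
  obtain ⟨ψ, c, hc, hψ⟩ := hK.exists_form
  have hψv := IsProperCone.pos_of_ne_zero hc hψ (interior_subset hv) hv0
  refine IsClosed.isLeast_csInf (hK.isClosed.preimage (f := fun r : ℝ => r • v - u) (by fun_prop))
    ?_ ⟨ψ u / ψ v, fun r hr => ?_⟩
  · obtain ⟨s, -, hs⟩ := hK.exists_smul_sub_mem_interior hv u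
    exact ⟨s, (interior_subset hs : s • v - u ∈ K)⟩
  · have := IsProperCone.nonneg_of_mem hc hψ hr
    rw [map_sub, map_smul, smul_eq_mul] at this
    rw [div_le_iff₀ hψv]
    linarith

theorem coneRatio_mem (hK : IsProperCone K) {u v : E} (hv : v ∈ interior K) (hv0 : v ≠ 0) :
    coneRatio K u v • v - u ∈ K := (hK.coneRatio_isLeast hv hv0).1

theorem coneRatio_le (hK : IsProperCone K) {u v : E} (hv : v ∈ interior K) (hv0 : v ≠ 0)
    {r : ℝ} (hr : r • v - u ∈ K) : coneRatio K u v ≤ r := (hK.coneRatio_isLeast hv hv0).2 hr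

theorem coneRatio_notMem_interior (hK : IsProperCone K) {u v : E} (hv : v ∈ interior K)
    (hv0 : v ≠ 0) : coneRatio K u v • v - u ∉ interior K := by
  intro h
  have hc : Tendsto (fun ε : ℝ => (coneRatio K u v - ε) • v - u) (𝓝[>] 0)
      (𝓝 (coneRatio K u v • v - u)) := by
    have : Tendsto (fun ε : ℝ => (coneRatio K u v - ε) • v - u) (𝓝 0)
        (𝓝 ((coneRatio K u v - 0) • v - u)) := Continuous.tendsto (by fun_prop) 0
    rw [sub_zero] at this
    exact this.mono_left nhdsWithin_le_nhds
  obtain ⟨ε, hε, hε0⟩ := ((hc.eventually (isOpen_interior.mem_nhds h)).and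
    self_mem_nhdsWithin).exists
  have := hK.coneRatio_le hv hv0 (interior_subset hε)
  have hε0 : 0 < ε := hε0
  linarith

/-- Beyond the least value, `r • v - u` enters the interior, so the ratio is the only `r` for which
this vector is on the boundary. Ratios are computed this way below. -/
theorem coneRatio_eq (hK : IsProperCone K) {u v : E} (hv : v ∈ interior K) (hv0 : v ≠ 0)
    {r : ℝ} (hr : r • v - u ∈ K) (hr' : r • v - u ∉ interior K) : coneRatio K u v = r := by
  refine le_antisymm (hK.coneRatio_le hv hv0 hr) ?_
  by_contra! hcon
  refine hr' ?_
  have := hK.add_mem_interior (hK.coneRatio_mem (u := u) hv hv0)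
    (hK.smul_mem_interior (sub_pos.2 hcon) hv)
  convert this using 1
  module

theorem coneRatio_pos (hK : IsProperCone K) {u v : E} (hu : u ∈ interior K) (hu0 : u ≠ 0)
    (hv : v ∈ interior K) (hv0 : v ≠ 0) : 0 < coneRatio K u v := by
  obtain ⟨ψ, c, hc, hψ⟩ := hK.exists_form
  have hψv := IsProperCone.pos_of_ne_zero hc hψ (interior_subset hv) hv0
  have hψu := IsProperCone.pos_of_ne_zero hc hψ (interior_subset hu) hu0
  have := IsProperCone.nonneg_of_mem hc hψ (hK.coneRatio_mem (u := u) hv hv0)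
  rw [map_sub, map_smul, smul_eq_mul] at this
  exact pos_of_mul_pos_left (by linarith) hψv.le

theorem coneRatio_le_mul (hK : IsProperCone K) {u v w : E} (hu : u ∈ interior K) (hu0 : u ≠ 0)
    (hv : v ∈ interior K) (hv0 : v ≠ 0) (hw : w ∈ interior K) (hw0 : w ≠ 0) :
    coneRatio K u w ≤ coneRatio K u v * coneRatio K v w := by
  refine hK.coneRatio_le hw hw0 ?_
  have := hK.add_mem _ (hK.smul_mem _ (hK.coneRatio_pos hu hu0 hv hv0).le _
    (hK.coneRatio_mem (u := v) hw hw0)) _ (hK.coneRatio_mem (u := u) hv hv0)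
  convert this using 1
  module

theorem coneRatio_smul (hK : IsProperCone K) {u v : E} (hv : v ∈ interior K) (hv0 : v ≠ 0)
    {a b : ℝ} (ha : 0 < a) (hb : 0 < b) :
    coneRatio K (a • u) (b • v) = a / b * coneRatio K u v := by
  have e : (a / b * coneRatio K u v) • b • v - a • u = a • (coneRatio K u v • v - u) := by
    rw [smul_sub, smul_smul, smul_smul]
    congr 2
    field_simp
  refine hK.coneRatio_eq (hK.smul_mem_interior hb hv) (smul_ne_zero hb.ne' hv0) ?_ ?_
  · rw [e]
    exact hK.smul_mem a ha.le _ (hK.coneRatio_mem hv hv0)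
  · rw [e]
    intro h
    refine hK.coneRatio_notMem_interior (u := u) hv hv0 ?_
    have := hK.smul_mem_interior (inv_pos.2 ha) h
    rwa [smul_smul, inv_mul_cancel₀ ha.ne', one_smul] at this

end IsProperCone

end Ratio

/-! ### The Hilbert distance in terms of order ratios -/

section Distance

variable {E : Type*} [NormedAddCommGroup E] [NormedSpace ℝ E] {K : Set E} {Ω : Set (ℙ ℝ E)}

theorem mem_inChart_singleton {φ : StrongDual ℝ E} {u a : E} (hu : u ≠ 0) :
    a ∈ inChart φ {Projectivization.mk ℝ u hu} ↔ φ a = 1 ∧ ∃ c : ℝ, c ≠ 0 ∧ a = c • u := by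
  constructor
  · rintro ⟨h1, ha, h2⟩
    obtain ⟨c, rfl⟩ := (Projectivization.mk_eq_mk_iff' ℝ _ _ _ _).1 h2
    refine ⟨h1, c, ?_, rfl⟩
    rintro rfl
    simp at ha
  · rintro ⟨h1, c, hc, rfl⟩
    exact ⟨h1, smul_ne_zero hc hu, mk_smul_eq hu hc⟩

theorem neg_mem_inChart {φ : StrongDual ℝ E} {S : Set (ℙ ℝ E)} {a : E} (ha : a ∈ inChart φ S) :
    -a ∈ inChart (-φ) S := ⟨by simp [ha.1], neg_mem_preimg.2 ha.2⟩

/-- If `a = s p + t b`, then `t⁻¹ a - b` is a positive multiple of the boundary vector `p`, so `1 /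
t` is the ratio of `b` to `a`; and `1 / t` is also `‖b - p‖ / ‖a - p‖`. The other endpoint gives the
other factor. -/
theorem IsLift.eq_of_crossRatio (h : IsLift Ω K) {u v : E} (hu : u ∈ interior K)
    (hv : v ∈ interior K) {φ : StrongDual ℝ E} (hφ : closure Ω ⊆ affineChart φ) (hφu : 0 < φ u)
    {p a b q : E} (ha : a ∈ inChart φ {Projectivization.mk ℝ u (h.ne_zero hu)})
    (hb : b ∈ inChart φ {Projectivization.mk ℝ v (h.ne_zero hv)})
    (hp : p ∈ inChart φ (frontier Ω)) (hq : q ∈ inChart φ (frontier Ω))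
    (hapb : a ∈ openSegment ℝ p b) (hbaq : b ∈ openSegment ℝ a q) :
    (‖b - p‖ * ‖a - q‖) / (‖a - p‖ * ‖b - q‖) = coneRatio K u v * coneRatio K v u := by
  have hK := h.isProperCone
  have hpos : ∀ {w : E}, w ∈ K → w ≠ 0 → 0 < φ w := fun hw hw0 =>
    h.pos_of_closure_subset hφ hu hφu hw hw0
  have hvφ : 0 < φ v := hpos (interior_subset hv) (h.ne_zero hv)
  obtain ⟨ha1, α, hα, rfl⟩ := (mem_inChart_singleton _).1 ha
  obtain ⟨hb1, β, hβ, rfl⟩ := (mem_inChart_singleton _).1 hb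
  have hα0 : 0 < α := by
    rw [map_smul, smul_eq_mul] at ha1
    exact pos_of_mul_pos_left (by rw [ha1]; exact one_pos) hφu.le
  have hβ0 : 0 < β := by
    rw [map_smul, smul_eq_mul] at hb1
    exact pos_of_mul_pos_left (by rw [hb1]; exact one_pos) hvφ.le
  have bd : ∀ {p : E}, p ∈ inChart φ (frontier Ω) → p ∈ K ∧ p ∉ interior K := by
    rintro p ⟨hp1, hp⟩
    obtain ⟨hp0, hp | hp⟩ := (h.mem_preimg_frontier_iff p).1 hp
    · exact hp
    · have := hpos hp.1 (neg_ne_zero.2 hp0)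
      rw [map_neg, hp1] at this
      linarith
  have haK := hK.smul_mem_interior hα0 hu
  have hbK := hK.smul_mem_interior hβ0 hv
  have hprod : coneRatio K (α • u) (β • v) * coneRatio K (β • v) (α • u) =
      coneRatio K u v * coneRatio K v u := by
    rw [hK.coneRatio_smul hv (h.ne_zero hv) hα0 hβ0, hK.coneRatio_smul hu (h.ne_zero hu) hβ0 hα0]
    field_simp
  rw [← hprod]
  set a := α • u
  set b := β • v
  clear_value a b
  obtain ⟨hpK, hpK'⟩ := bd hp
  obtain ⟨hqK, hqK'⟩ := bd hq
  obtain ⟨s, t, hs, ht, hst, hab⟩ := hapb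
  obtain ⟨s', t', hs', ht', hst', hba⟩ := hbaq
  have hnot : ∀ {c : ℝ} {w : E}, 0 < c → w ∉ interior K → c • w ∉ interior K := by
    intro c w hc hw hcw
    apply hw
    have := hK.smul_mem_interior (inv_pos.2 hc) hcw
    rwa [smul_smul, inv_mul_cancel₀ hc.ne', one_smul] at this
  have e1 : t⁻¹ • a - b = (s / t) • p := by
    rw [← hab, smul_add, smul_smul, smul_smul, inv_mul_cancel₀ ht.ne', one_smul, div_eq_inv_mul]
    module
  have e2 : s'⁻¹ • b - a = (t' / s') • q := by
    rw [← hba, smul_add, smul_smul, smul_smul, inv_mul_cancel₀ hs'.ne', one_smul, div_eq_inv_mul]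
    module
  have r1 : coneRatio K b a = t⁻¹ := by
    refine hK.coneRatio_eq haK (h.ne_zero haK) ?_ ?_
    · rw [e1]
      exact hK.smul_mem _ (by positivity) _ hpK
    · rw [e1]
      exact hnot (by positivity) hpK'
  have r2 : coneRatio K a b = s'⁻¹ := by
    refine hK.coneRatio_eq hbK (h.ne_zero hbK) ?_ ?_
    · rw [e2]
      exact hK.smul_mem _ (by positivity) _ hqK
    · rw [e2]
      exact hnot (by positivity) hqK'
  have n1 : ‖a - p‖ = t * ‖b - p‖ := by
    have : a - p = t • (b - p) := by
      have hs1 : s = 1 - t := by linarith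
      rw [← hab, hs1]
      module
    rw [this, norm_smul, Real.norm_of_nonneg ht.le]
  have n2 : ‖b - q‖ = s' * ‖a - q‖ := by
    have : b - q = s' • (a - q) := by
      have ht1 : t' = 1 - s' := by linarith
      rw [← hba, ht1]
      module
    rw [this, norm_smul, Real.norm_of_nonneg hs'.le]
  have hbp : ‖b - p‖ ≠ 0 := by
    rw [norm_ne_zero_iff, sub_ne_zero]
    intro e
    exact hpK' (e ▸ hbK)
  have haq : ‖a - q‖ ≠ 0 := by
    rw [norm_ne_zero_iff, sub_ne_zero]
    intro e
    exact hqK' (e ▸ haK)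
  rw [r1, r2, n1, n2]
  field_simp

/-- Shows that the value is independent of the chart and that a suitable configuration exists, so
that the choice in `hilbertDist` is determined. -/
theorem IsLift.isHilbertDist_iff (h : IsLift Ω K) {u v : E} (hu : u ∈ interior K)
    (hv : v ∈ interior K) {r : ℝ} :
    IsHilbertDist Ω (Projectivization.mk ℝ u (h.ne_zero hu)) (Projectivization.mk ℝ v (h.ne_zero hv))
      r ↔ r = 1 / 2 * Real.log (coneRatio K u v * coneRatio K v u) := by
  have hK := h.isProperCone
  have hu0 := h.ne_zero hu
  have hv0 := h.ne_zero hv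
  by_cases hxy : Projectivization.mk ℝ u hu0 = Projectivization.mk ℝ v hv0
  · have : coneRatio K u v * coneRatio K v u = 1 := by
      obtain ⟨a, rfl⟩ := (Projectivization.mk_eq_mk_iff' ℝ _ _ _ _).1 hxy
      obtain ⟨ψ, c, hc, hψ⟩ := hK.exists_form
      have h1 := IsProperCone.pos_of_ne_zero hc hψ (interior_subset hu) hu0
      have h2 := IsProperCone.pos_of_ne_zero hc hψ (interior_subset hv) hv0
      rw [map_smul, smul_eq_mul] at h1
      have ha : 0 < a := pos_of_mul_pos_left h1 h2.le
      have r1 : coneRatio K v v = 1 := hK.coneRatio_eq hv hv0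
        (by simpa using hK.zero_mem) (by simpa using h.zero_notMem_interior)
      have r2 := hK.coneRatio_smul (u := v) hv hv0 ha one_pos
      have r3 := hK.coneRatio_smul (u := v) hv hv0 one_pos ha
      rw [one_smul, r1] at r2 r3
      rw [r2, r3]
      field_simp
    rw [this, Real.log_one, mul_zero, IsHilbertDist]
    simp [hxy]
  · have huniq : ∀ r, IsHilbertDist Ω (Projectivization.mk ℝ u hu0) (Projectivization.mk ℝ v hv0) r →
        r = 1 / 2 * Real.log (coneRatio K u v * coneRatio K v u) := by
      rintro r (⟨h1, -⟩ | ⟨-, φ, hφ, p, a, b, q, ha, hb, hp, hq, hapb, hbaq, rfl⟩)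
      · exact absurd h1 hxy
      · have hne : φ u ≠ 0 := preimg_affineChart.1 (preimg_subset hφ
          (preimg_subset subset_closure (h.mem_preimg hu)))
        -- A chart whose form is negative on `K` is replaced by the opposite form, all
        -- representatives changing sign.
        rcases lt_or_gt_of_ne hne with hφu | hφu
        · have hmem : ∀ {x y z : E}, x ∈ openSegment ℝ y z → -x ∈ openSegment ℝ (-y) (-z) := by
            rintro x y z ⟨s, t, hs, ht, hst, rfl⟩
            exact ⟨s, t, hs, ht, hst, by module⟩
          have hφ' : closure Ω ⊆ affineChart (-φ) := by
            intro x hx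
            have := hφ hx
            simpa [affineChart] using this
          have key := h.eq_of_crossRatio hu hv hφ' (by simpa using hφu) (neg_mem_inChart ha)
            (neg_mem_inChart hb) (neg_mem_inChart hp) (neg_mem_inChart hq) (hmem hapb) (hmem hbaq)
          have hn : ∀ x y : E, ‖-x - -y‖ = ‖x - y‖ := fun x y => by
            rw [← neg_sub', norm_neg]
          rw [hn, hn, hn, hn] at key
          rw [key]
        · rw [h.eq_of_crossRatio hu hv hφ hφu ha hb hp hq hapb hbaq]
    refine ⟨huniq r, ?_⟩
    rintro rfl
    suffices hex : ∃ r, IsHilbertDist Ω (Projectivization.mk ℝ u hu0)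
        (Projectivization.mk ℝ v hv0) r by
      obtain ⟨r, hr⟩ := hex
      rwa [← huniq r hr]
    obtain ⟨ψ, c, hc, hψ⟩ := hK.exists_form
    have hpos : ∀ {w : E}, w ∈ K → w ≠ 0 → 0 < ψ w := fun hw hw0 =>
      IsProperCone.pos_of_ne_zero hc hψ hw hw0
    have hψu := hpos (interior_subset hu) hu0
    have hψv := hpos (interior_subset hv) hv0
    have hchart := h.closure_subset_affineChart hc hψ
    set a := (ψ u)⁻¹ • u with hadef
    set b := (ψ v)⁻¹ • v with hbdef
    have ha1 : ψ a = 1 := by simp [hadef, hψu.ne']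
    have hb1 : ψ b = 1 := by simp [hbdef, hψv.ne']
    have haK : a ∈ interior K := hK.smul_mem_interior (inv_pos.2 hψu) hu
    have hbK : b ∈ interior K := hK.smul_mem_interior (inv_pos.2 hψv) hv
    have hab : a ≠ b := by
      intro e
      apply hxy
      rw [← mk_smul_eq hu0 (inv_pos.2 hψu).ne', ← mk_smul_eq hv0 (inv_pos.2 hψv).ne']
      congr 1
    have main : ∀ {a b : E}, ψ a = 1 → ψ b = 1 → b ∈ interior K → a ≠ b →
        ∃ q, q ∈ inChart ψ (frontier Ω) ∧ b ∈ openSegment ℝ a q := by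
      intro a b ha1 hb1 hbK hab
      have hmem := hK.coneRatio_mem (u := a) hbK (h.ne_zero hbK)
      have hnot := hK.coneRatio_notMem_interior (u := a) hbK (h.ne_zero hbK)
      set l := coneRatio K a b
      have hψl : ψ (l • b - a) = l - 1 := by simp [ha1, hb1]
      have hne : l • b - a ≠ 0 := by
        intro e
        have hl : l = 1 := by
          rw [e, map_zero] at hψl
          linarith
        rw [hl, one_smul, sub_eq_zero] at e
        exact hab e.symm
      have hl : 0 < l - 1 := hψl ▸ hpos hmem hne
      have hl0 : 0 < l := by linarith
      -- The line from `a` through `b` leaves the cone in the direction `l • b - a`, rescaled to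
      -- satisfy `ψ = 1`.
      refine ⟨(l - 1)⁻¹ • (l • b - a), ⟨?_, ?_⟩, l⁻¹, (l - 1) / l, by positivity, by positivity, ?_,
        ?_⟩
      · rw [map_smul, hψl, smul_eq_mul, inv_mul_cancel₀ hl.ne']
      · exact smul_mem_preimg ((h.mem_preimg_frontier_iff _).2 ⟨hne, Or.inl ⟨hmem, hnot⟩⟩)
          (inv_pos.2 hl).ne'
      · field_simp
        ring
      · rw [smul_smul, smul_sub, smul_smul]
        have e1 : (l - 1) / l * (l - 1)⁻¹ = l⁻¹ := by field_simp
        rw [e1, inv_mul_cancel₀ hl0.ne', one_smul]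
        module
    obtain ⟨q, hq, hbaq⟩ := main ha1 hb1 hbK hab
    obtain ⟨p, hp, hapb⟩ := main hb1 ha1 haK hab.symm
    rw [openSegment_symm] at hapb
    exact ⟨_, Or.inr ⟨hxy, ψ, hchart, p, a, b, q,
      (mem_inChart_singleton _).2 ⟨ha1, _, (inv_pos.2 hψu).ne', rfl⟩,
      (mem_inChart_singleton _).2 ⟨hb1, _, (inv_pos.2 hψv).ne', rfl⟩, hp, hq, hapb, hbaq, rfl⟩⟩

theorem IsLift.hilbertDist_mk (h : IsLift Ω K) {u v : E} (hu : u ∈ interior K)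
    (hv : v ∈ interior K) :
    hilbertDist Ω (Projectivization.mk ℝ u (h.ne_zero hu)) (Projectivization.mk ℝ v (h.ne_zero hv)) =
      1 / 2 * Real.log (coneRatio K u v * coneRatio K v u) :=
  (h.isHilbertDist_iff hu hv).1 (Classical.epsilon_spec ⟨_, (h.isHilbertDist_iff hu hv).2 rfl⟩)

end Distance

end HilbertGeometry

namespace HilbertGeometry

open Filter Topology

/-! ### Geodesics, and hyperbolicity as thinness of the cone -/

section Geodesics

variable {E : Type*} [NormedAddCommGroup E] [NormedSpace ℝ E] {K : Set E} {Ω : Set (ℙ ℝ E)}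

theorem mk_eq_mk_of_smul {u v : E} (hu : u ≠ 0) (hv : v ≠ 0) {c : ℝ} (h : u = c • v) :
    Projectivization.mk ℝ u hu = Projectivization.mk ℝ v hv :=
  (Projectivization.mk_eq_mk_iff' ℝ _ _ _ _).2 ⟨c, h.symm⟩

namespace IsLift

theorem hilbertDist_le (h : IsLift Ω K) {u w : E} (hu : u ∈ interior K) (hw : w ∈ interior K)
    {R : ℝ} (h1 : w - u ∈ K) (h2 : R • u - w ∈ K) :
    hilbertDist Ω (Projectivization.mk ℝ u (h.ne_zero hu))
      (Projectivization.mk ℝ w (h.ne_zero hw)) ≤ 1 / 2 * Real.log R := by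
  have hK := h.isProperCone
  rw [h.hilbertDist_mk hu hw]
  have p1 := hK.coneRatio_pos hu (h.ne_zero hu) hw (h.ne_zero hw)
  have p2 := hK.coneRatio_pos hw (h.ne_zero hw) hu (h.ne_zero hu)
  have l1 := hK.coneRatio_le (u := u) (r := 1) hw (h.ne_zero hw) (by simpa using h1)
  have l2 := hK.coneRatio_le hu (h.ne_zero hu) h2
  have : coneRatio K u w * coneRatio K w u ≤ R :=
    calc _ ≤ 1 * R := mul_le_mul l1 l2 p2.le zero_le_one
      _ = R := one_mul R
  have := Real.log_le_log (mul_pos p1 p2) this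
  linarith

theorem exists_smul_of_hilbertDist_le (h : IsLift Ω K) {u v : E} (hu : u ∈ interior K)
    (hv : v ∈ interior K) {δ : ℝ} (hd : hilbertDist Ω (Projectivization.mk ℝ u (h.ne_zero hu))
      (Projectivization.mk ℝ v (h.ne_zero hv)) ≤ δ) :
    ∃ l : ℝ, 0 < l ∧ l • v - u ∈ K ∧ Real.exp (2 * δ) • u - l • v ∈ K := by
  have hK := h.isProperCone
  rw [h.hilbertDist_mk hu hv] at hd
  have p1 := hK.coneRatio_pos hu (h.ne_zero hu) hv (h.ne_zero hv)
  have p2 := hK.coneRatio_pos hv (h.ne_zero hv) hu (h.ne_zero hu)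
  have hle : coneRatio K u v * coneRatio K v u ≤ Real.exp (2 * δ) :=
    (Real.log_le_iff_le_exp (mul_pos p1 p2)).1 (by linarith)
  refine ⟨coneRatio K u v, p1, hK.coneRatio_mem hv (h.ne_zero hv), ?_⟩
  have := hK.add_mem _ (hK.smul_mem _ p1.le _ (hK.coneRatio_mem (u := v) hu (h.ne_zero hu))) _
    (hK.smul_mem _ (sub_nonneg.2 hle) u (interior_subset hu))
  convert this using 1
  module

/-- The line through `x` and `y` meets the boundary at `p` and `q`, and `t ↦ exp (-t) p + exp t q`
is parametrized by arc length, since the ratio of its values at `s` and `t` is `exp |s - t|`. -/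
theorem exists_geodesic (h : IsLift Ω K) {x y : E} (hx : x ∈ interior K) (hy : y ∈ interior K) :
    ∃ G, IsGeodesic Ω (hilbertDist Ω) (Projectivization.mk ℝ x (h.ne_zero hx))
        (Projectivization.mk ℝ y (h.ne_zero hy)) G ∧
      (∀ s t : ℝ, 0 ≤ s → 0 ≤ t → ∀ w, w = s • x + t • y → ∀ hw : w ∈ interior K,
        Projectivization.mk ℝ w (h.ne_zero hw) ∈ G) ∧
      ∀ g ∈ G, ∃ s t : ℝ, 0 ≤ s ∧ 0 ≤ t ∧ ∃ (w : E) (hw : w ∈ interior K), w = s • x + t • y ∧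
        g = Projectivization.mk ℝ w (h.ne_zero hw) := by
  have hK := h.isProperCone
  have hx0 := h.ne_zero hx
  have hy0 := h.ne_zero hy
  have dxx : ∀ {v : E} (hv : v ∈ interior K), hilbertDist Ω (Projectivization.mk ℝ v (h.ne_zero hv))
      (Projectivization.mk ℝ v (h.ne_zero hv)) = 0 := fun {v} hv => by
    have r1 : coneRatio K v v = 1 := hK.coneRatio_eq hv (h.ne_zero hv)
      (by simpa using hK.zero_mem) (by simpa using h.zero_notMem_interior)
    rw [h.hilbertDist_mk hv hv, r1]
    simp
  by_cases hxy : Projectivization.mk ℝ x hx0 = Projectivization.mk ℝ y hy0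
  · refine ⟨{Projectivization.mk ℝ x hx0}, ⟨0, fun _ => Projectivization.mk ℝ x hx0, le_rfl, rfl,
      hxy, fun _ _ => h.mk_mem hx, ?_, ?_⟩, ?_, ?_⟩
    · intro s hs t ht
      rw [Set.Icc_self, Set.mem_singleton_iff] at hs ht
      rw [dxx hx, hs, ht, sub_zero, abs_zero]
    · simp
    · intro s t hs ht w hw hwK
      obtain ⟨a, ha⟩ := (Projectivization.mk_eq_mk_iff' ℝ _ _ _ _).1 hxy.symm
      rw [Set.mem_singleton_iff]
      refine mk_eq_mk_of_smul _ _ (c := s + t * a) ?_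
      rw [hw, ← ha]
      module
    · rintro g rfl
      exact ⟨1, 0, zero_le_one, le_rfl, x, hx, by simp, rfl⟩
  · set l := coneRatio K x y with hl
    set m := coneRatio K y x with hm
    have hl0 : 0 < l := hK.coneRatio_pos hx hx0 hy hy0
    have hm0 : 0 < m := hK.coneRatio_pos hy hy0 hx hx0
    -- The factor `l` makes `p + q` proportional to `x`, so that the curve starts at parameter `0`.
    set p := l • (m • x - y) with hp
    set q := l • y - x with hq
    have hnot : ∀ {c : ℝ} {w : E}, 0 ≤ c → w ∉ interior K → c • w ∉ interior K := by
      intro c w hc hw hcw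
      rcases hc.eq_or_lt with rfl | hc
      · rw [zero_smul] at hcw
        exact h.zero_notMem_interior hcw
      apply hw
      have := hK.smul_mem_interior (inv_pos.2 hc) hcw
      rwa [smul_smul, inv_mul_cancel₀ hc.ne', one_smul] at this
    have hpK : p ∈ K := hK.smul_mem _ hl0.le _ (hK.coneRatio_mem hx hx0)
    have hpK' : p ∉ interior K := hnot hl0.le (hK.coneRatio_notMem_interior hx hx0)
    have hqK : q ∈ K := hK.coneRatio_mem hy hy0
    have hqK' : q ∉ interior K := hK.coneRatio_notMem_interior hy hy0
    clear_value p q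
    have hlm1 : 1 ≤ l * m := by
      have r1 : coneRatio K x x = 1 := hK.coneRatio_eq hx hx0
        (by simpa using hK.zero_mem) (by simpa using h.zero_notMem_interior)
      rw [← r1]
      exact hK.coneRatio_le_mul hx hx0 hy hy0 hx hx0
    have hxpq : p + q = (l * m - 1) • x := by rw [hp, hq]; module
    have hypq : l⁻¹ • p + m • q = (l * m - 1) • y := by
      rw [hp, hq, smul_smul, inv_mul_cancel₀ hl0.ne', one_smul]
      module
    have hlm : 0 < l * m - 1 := by
      refine (sub_nonneg.2 hlm1).lt_of_ne' fun e => ?_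
      rw [e, zero_smul] at hxpq
      have hq0 : q = 0 := by
        refine hK.eq_zero_of_neg_mem hqK ?_
        rwa [← eq_neg_iff_add_eq_zero.2 hxpq]
      refine hxy (mk_eq_mk_of_smul hx0 hy0 (c := l) ?_)
      rw [hq, sub_eq_zero] at hq0
      exact hq0.symm
    have hpq : p + q ∈ interior K := by
      rw [hxpq]
      exact hK.smul_mem_interior hlm hx
    have hmem : ∀ {a b : ℝ}, 0 < a → 0 < b → a • p + b • q ∈ interior K := by
      intro a b ha hb
      have hmin : 0 < min a b := lt_min ha hb
      have := hK.add_mem_interior (hK.add_mem _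
        (hK.smul_mem (a - min a b) (sub_nonneg.2 (min_le_left _ _)) p hpK) _
        (hK.smul_mem (b - min a b) (sub_nonneg.2 (min_le_right _ _)) q hqK))
        (hK.smul_mem_interior hmin hpq)
      convert this using 1
      module
    have hmem' : ∀ t : ℝ, Real.exp (-t) • p + Real.exp t • q ∈ interior K := fun t =>
      hmem (Real.exp_pos _) (Real.exp_pos _)
    have hratio : ∀ s t : ℝ, coneRatio K (Real.exp (-s) • p + Real.exp s • q)
        (Real.exp (-t) • p + Real.exp t • q) = Real.exp |s - t| := by
      intro s t
      have e1 : Real.exp |s - t| • (Real.exp (-t) • p + Real.exp t • q) -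
          (Real.exp (-s) • p + Real.exp s • q) =
          (Real.exp (|s - t| - t) - Real.exp (-s)) • p + (Real.exp (|s - t| + t) - Real.exp s) • q := by
        rw [sub_eq_add_neg |s - t|, Real.exp_add, Real.exp_add]
        module
      have e2 : (Real.exp |s - t| • (Real.exp (-t) • p + Real.exp t • q) -
          (Real.exp (-s) • p + Real.exp s • q)) ∈ K ∧
          (Real.exp |s - t| • (Real.exp (-t) • p + Real.exp t • q) -
          (Real.exp (-s) • p + Real.exp s • q)) ∉ interior K := by
        rw [e1]
        rcases le_total t s with hts | hts
        · have e3 : Real.exp (|s - t| + t) - Real.exp s = 0 := by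
            rw [abs_of_nonneg (sub_nonneg.2 hts), sub_add_cancel, sub_self]
          have e4 : 0 ≤ Real.exp (|s - t| - t) - Real.exp (-s) := by
            rw [abs_of_nonneg (sub_nonneg.2 hts), sub_nonneg]
            exact Real.exp_le_exp.2 (by linarith)
          rw [e3, zero_smul, add_zero]
          exact ⟨hK.smul_mem _ e4 _ hpK, hnot e4 hpK'⟩
        · have e3 : Real.exp (|s - t| - t) - Real.exp (-s) = 0 := by
            rw [abs_of_nonpos (sub_nonpos.2 hts), sub_eq_zero]
            congr 1
            ring
          have e4 : 0 ≤ Real.exp (|s - t| + t) - Real.exp s := by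
            rw [abs_of_nonpos (sub_nonpos.2 hts), sub_nonneg]
            exact Real.exp_le_exp.2 (by linarith)
          rw [e3, zero_smul, zero_add]
          exact ⟨hK.smul_mem _ e4 _ hqK, hnot e4 hqK'⟩
      exact hK.coneRatio_eq (hmem' t) (h.ne_zero (hmem' t)) e2.1 e2.2
    set L := 1 / 2 * Real.log (l * m) with hL
    have hexpL : Real.exp (2 * L) = l * m := by
      rw [hL, ← mul_assoc, mul_one_div_cancel two_ne_zero, one_mul, Real.exp_log (by positivity)]
    have hL0 : 0 ≤ L := mul_nonneg (by norm_num) (Real.log_nonneg hlm1)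
    set γ : ℝ → ℙ ℝ E := fun t => Projectivization.mk ℝ _ (h.ne_zero (hmem' t)) with hγ
    refine ⟨γ '' Set.Icc 0 L, ⟨L, γ, hL0, ?_, ?_, fun t _ => h.mk_mem (hmem' t), ?_, rfl⟩, ?_, ?_⟩
    · refine mk_eq_mk_of_smul _ _ (c := l * m - 1) ?_
      simp [hxpq]
    · refine mk_eq_mk_of_smul _ _ (c := l * Real.exp (-L) * (l * m - 1)) ?_
      have e1 : l * Real.exp (-L) * l⁻¹ = Real.exp (-L) := by field_simp
      have e2 : l * Real.exp (-L) * m = Real.exp L := by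
        rw [mul_right_comm, ← hexpL, ← Real.exp_add]
        congr 1
        ring
      rw [mul_smul, ← hypq, smul_add, smul_smul, smul_smul, e1, e2]
    · intro s _ t _
      rw [hγ, h.hilbertDist_mk (hmem' s) (hmem' t), hratio, hratio, ← Real.exp_add, Real.log_exp,
        abs_sub_comm t s]
      ring
    · intro s t hs ht w hw hwK
      set α := s + t * l⁻¹ with hα
      set β := s + t * m with hβ
      have hst : 0 < s ∨ 0 < t := by
        by_contra! hcon
        have hs0 : s = 0 := le_antisymm hcon.1 hs
        have ht0 : t = 0 := le_antisymm hcon.2 ht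
        rw [hs0, ht0] at hw
        exact h.ne_zero hwK (by simpa using hw)
      have hα0 : 0 < α := by
        rcases hst with h1 | h1 <;> positivity
      have hβ0 : 0 < β := by
        rcases hst with h1 | h1 <;> positivity
      have hw' : (l * m - 1) • w = α • p + β • q := by
        rw [hw, smul_add, smul_comm _ s, smul_comm _ t, ← hxpq, ← hypq]
        module
      have hlm' : l⁻¹ ≤ m := by
        rw [inv_le_iff_one_le_mul₀ hl0]
        linarith
      have hαβ : α ≤ β := by
        rw [hα, hβ]
        gcongr
      have hβα : β ≤ l * m * α := by
        have : l * m * α = l * m * s + t * m := by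
          rw [hα]
          field_simp
        rw [this, hβ]
        nlinarith
      -- The class of `α p + β q` is reached when `exp (2 τ) = β / α`.
      set τ := 1 / 2 * Real.log (β / α) with hτ
      have hexpτ : Real.exp (2 * τ) = β / α := by
        rw [hτ, ← mul_assoc, mul_one_div_cancel two_ne_zero, one_mul, Real.exp_log (by positivity)]
      refine ⟨τ, ⟨mul_nonneg (by norm_num) (Real.log_nonneg ((one_le_div hα0).2 hαβ)), ?_⟩, ?_⟩
      · rw [hτ, hL]
        have := Real.log_le_log (by positivity) ((div_le_iff₀ hα0).2 hβα)
        linarith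
      · refine (mk_eq_mk_of_smul (c := (l * m - 1)⁻¹ * (α * Real.exp τ)) _ _ ?_).symm
        have e1 : α * Real.exp τ * Real.exp (-τ) = α := by
          rw [mul_assoc, ← Real.exp_add, add_neg_cancel, Real.exp_zero, mul_one]
        have e2 : α * Real.exp τ * Real.exp τ = β := by
          rw [mul_assoc, ← Real.exp_add, ← two_mul, hexpτ, mul_div_cancel₀ _ hα0.ne']
        rw [mul_smul, smul_add, smul_smul, smul_smul, e1, e2, ← hw', smul_smul,
          inv_mul_cancel₀ hlm.ne', one_smul]
    · rintro _ ⟨τ, ⟨hτ0, hτL⟩, rfl⟩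
      refine ⟨l * m * Real.exp (-τ) - Real.exp τ, l * Real.exp τ - l * Real.exp (-τ), ?_, ?_, _,
        hmem' τ, ?_, rfl⟩
      · rw [sub_nonneg, ← hexpL, ← Real.exp_add]
        exact Real.exp_le_exp.2 (by linarith)
      · rw [← mul_sub]
        exact mul_nonneg hl0.le (sub_nonneg.2 (Real.exp_le_exp.2 (by linarith)))
      · rw [hp, hq]
        module

/-- In a strictly convex domain, the geodesics are straight. -/
theorem geodesic_straight (h : IsLift Ω K) (hSC : IsStrictlyConvexCone K) {x y : E}
    (hx : x ∈ interior K) (hy : y ∈ interior K) {G : Set (ℙ ℝ E)}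
    (hG : IsGeodesic Ω (hilbertDist Ω) (Projectivization.mk ℝ x (h.ne_zero hx))
        (Projectivization.mk ℝ y (h.ne_zero hy)) G) {g : ℙ ℝ E} (hg : g ∈ G) :
    ∃ s t : ℝ, 0 ≤ s ∧ 0 ≤ t ∧ ∃ (w : E) (hw : w ∈ interior K), w = s • x + t • y ∧
        g = Projectivization.mk ℝ w (h.ne_zero hw) := by
  have hK := h.isProperCone
  have hx0 := h.ne_zero hx
  have hy0 := h.ne_zero hy
  obtain ⟨L, γ, hL, h0, h1, hγ, hd, rfl⟩ := hG
  obtain ⟨t, ht, rfl⟩ := hg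
  obtain ⟨w, hw, hwγ⟩ := h.exists_rep (hγ t ht)
  have hw0 := h.ne_zero hw
  have d1 := hd 0 ⟨le_rfl, hL⟩ t ht
  have d2 := hd t ht L ⟨hL, le_rfl⟩
  have d3 := hd 0 ⟨le_rfl, hL⟩ L ⟨hL, le_rfl⟩
  rw [h0, hwγ, h.hilbertDist_mk hx hw, zero_sub, abs_neg, abs_of_nonneg ht.1] at d1
  rw [h1, hwγ, h.hilbertDist_mk hw hy, abs_of_nonpos (sub_nonpos.2 ht.2)] at d2
  rw [h0, h1, h.hilbertDist_mk hx hy, zero_sub, abs_neg, abs_of_nonneg hL] at d3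
  have pxw := hK.coneRatio_pos hx hx0 hw hw0
  have pwx := hK.coneRatio_pos hw hw0 hx hx0
  have pwy := hK.coneRatio_pos hw hw0 hy hy0
  have pyw := hK.coneRatio_pos hy hy0 hw hw0
  have pxy := hK.coneRatio_pos hx hx0 hy hy0
  have pyx := hK.coneRatio_pos hy hy0 hx hx0
  have le1 := hK.coneRatio_le_mul hx hx0 hw hw0 hy hy0
  have le2 := hK.coneRatio_le_mul hy hy0 hw hw0 hx hx0
  have hlog : Real.log (coneRatio K x y * coneRatio K y x) =
      Real.log ((coneRatio K x w * coneRatio K w x) * (coneRatio K w y * coneRatio K y w)) := by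
    rw [Real.log_mul (mul_pos pxw pwx).ne' (mul_pos pwy pyw).ne']
    linarith
  have heq := Real.log_injOn_pos (mul_pos pxy pyx)
    (mul_pos (mul_pos pxw pwx) (mul_pos pwy pyw)) hlog
  -- Additivity of the distance is equality in the product of two submultiplicativity inequalities,
  -- so each of them is an equality.
  have hxy : coneRatio K x y = coneRatio K x w * coneRatio K w y := by
    refine le_antisymm le1 ?_
    by_contra! hcon
    have : coneRatio K x y * coneRatio K y x <
        (coneRatio K x w * coneRatio K w y) * (coneRatio K y w * coneRatio K w x) :=
      mul_lt_mul hcon le2 pyx (mul_pos pxw pwy).le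
    nlinarith
  set l₁ := coneRatio K x w with hl₁
  set l₂ := coneRatio K w y with hl₂
  have hA : l₁ • (l₂ • y - w) ∈ K := hK.smul_mem _ pxw.le _ (hK.coneRatio_mem hy hy0)
  have hB : l₁ • w - x ∈ K := hK.coneRatio_mem hw hw0
  -- The sum is the boundary vector `(l₁ * l₂) • y - x`; by strict convexity its two terms are
  -- dependent, which places `w` in the plane of `x` and `y`.
  have hAB : (l₁ • w - x) + l₁ • (l₂ • y - w) ∉ interior K := by
    have := hK.coneRatio_notMem_interior (u := x) hy hy0
    rw [hxy] at this
    have e : (l₁ • w - x) + l₁ • (l₂ • y - w) = (l₁ * l₂) • y - x := by module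
    rwa [e]
  have hdep := hSC _ hB _ hA hAB
  by_cases hB0 : l₁ • w - x = 0
  · refine ⟨l₁⁻¹, 0, (inv_pos.2 pxw).le, le_rfl, w, hw, ?_, hwγ⟩
    rw [sub_eq_zero] at hB0
    rw [← hB0, smul_smul, inv_mul_cancel₀ pxw.ne', one_smul, zero_smul, add_zero]
  rw [LinearIndependent.pair_iff' hB0] at hdep
  push Not at hdep
  obtain ⟨a, ha⟩ := hdep
  have ha0 : 0 ≤ a := by
    by_contra! hcon
    refine hB0 (hK.eq_zero_of_neg_mem hB ?_)
    have := hK.smul_mem (-a)⁻¹ (inv_nonneg.2 (by linarith)) _ hA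
    rwa [← ha, smul_smul, inv_neg, neg_mul, inv_mul_cancel₀ hcon.ne, neg_one_smul] at this
  have hc : 0 < l₁ * (1 + a) := by positivity
  refine ⟨(l₁ * (1 + a))⁻¹ * a, (l₁ * (1 + a))⁻¹ * (l₁ * l₂), by positivity, by positivity, w, hw,
    ?_, hwγ⟩
  have e1 : (l₁ * (1 + a)) • w = a • x + (l₁ * l₂) • y := by
    have e2 : (l₁ * (1 + a)) • w = l₁ • w + a • (l₁ • w - x) + a • x := by module
    rw [e2, ha]
    module
  rw [mul_smul, mul_smul, ← smul_add, ← e1, smul_smul, inv_mul_cancel₀ hc.ne', one_smul]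

/-- A point `s x + t y` of a side is the sum of the rescaled vertices `s x` and `t y`, so it
suffices to consider sums `x + y`; and a bound on the distance to `w` is a pair of inequalities `u ≤
w ≤ R u` after rescaling `w`. -/
theorem isGromovHyperbolic_iff (h : IsLift Ω K) :
    IsGromovHyperbolic Ω ↔ ∃ R, IsThinCone R K := by
  have hK := h.isProperCone
  constructor
  · rintro ⟨δ, hδ⟩
    refine ⟨Real.exp (2 * δ), fun x hx y hy z hz => ?_⟩
    obtain ⟨Gxy, hGxy, hxy, -⟩ := h.exists_geodesic hx hy
    obtain ⟨Gyz, hGyz, -, hyz⟩ := h.exists_geodesic hy hz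
    obtain ⟨Gzx, hGzx, -, hzx⟩ := h.exists_geodesic hz hx
    have hu := hK.add_mem_interior (interior_subset hx) hy
    obtain ⟨v, hv, hd⟩ := hδ _ (h.mk_mem hx) _ (h.mk_mem hy) _ (h.mk_mem hz) _ _ _ hGxy hGyz hGzx _
      (hxy 1 1 zero_le_one zero_le_one _ (by simp) hu)
    rcases hv with hv | hv
    · obtain ⟨s, t, hs, ht, w, hw, hwe, rfl⟩ := hyz v hv
      obtain ⟨l, hl, h1, h2⟩ := h.exists_smul_of_hilbertDist_le hu hw hd
      refine ⟨l * s, l * t, by positivity, by positivity, l • w, Or.inr ?_, h1, h2⟩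
      rw [hwe]
      module
    · obtain ⟨s, t, hs, ht, w, hw, hwe, rfl⟩ := hzx v hv
      obtain ⟨l, hl, h1, h2⟩ := h.exists_smul_of_hilbertDist_le hu hw hd
      refine ⟨l * t, l * s, by positivity, by positivity, l • w, Or.inl ?_, h1, h2⟩
      rw [hwe]
      module
  · rintro ⟨R, hR⟩
    have hSC := hR.isStrictlyConvexCone hK
    -- A geodesic contains the whole segment: its point at parameter `τ` lies on the segment at
    -- distance `τ` from `x`, hence equals the point of the straight geodesic at parameter `τ`.
    have cover : ∀ {x y : E} (hx : x ∈ interior K) (hy : y ∈ interior K) {G : Set (ℙ ℝ E)},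
        IsGeodesic Ω (hilbertDist Ω) (Projectivization.mk ℝ x (h.ne_zero hx))
          (Projectivization.mk ℝ y (h.ne_zero hy)) G → ∀ s t : ℝ, 0 ≤ s → 0 ≤ t →
          ∀ (w : E) (hw : w ∈ interior K), w = s • x + t • y →
          Projectivization.mk ℝ w (h.ne_zero hw) ∈ G := by
      intro x y hx hy G hG s t hs ht w hw hwe
      obtain ⟨G₀, hG₀, hin, -⟩ := h.exists_geodesic hx hy
      obtain ⟨L₀, γ₀, hL₀, a0, a1, aΩ, ad, rfl⟩ := hG₀
      obtain ⟨τ, hτ, hτw⟩ := hin s t hs ht w hwe hw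
      have hG' := hG
      obtain ⟨L, γ, hL, b0, b1, bΩ, bd, rfl⟩ := hG
      have eL : L = L₀ := by
        have c1 := ad 0 ⟨le_rfl, hL₀⟩ L₀ ⟨hL₀, le_rfl⟩
        have c2 := bd 0 ⟨le_rfl, hL⟩ L ⟨hL, le_rfl⟩
        rw [a0, a1, zero_sub, abs_neg, abs_of_nonneg hL₀] at c1
        rw [b0, b1, zero_sub, abs_neg, abs_of_nonneg hL] at c2
        rw [← c1, ← c2]
      subst eL
      obtain ⟨s', t', hs', ht', w', hw', hwe', hγτ⟩ :=
        h.geodesic_straight hSC hx hy hG' ⟨τ, hτ, rfl⟩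
      obtain ⟨τ', hτ', hτw'⟩ := hin s' t' hs' ht' w' hwe' hw'
      have c1 := ad 0 ⟨le_rfl, hL⟩ τ' hτ'
      have c2 := bd 0 ⟨le_rfl, hL⟩ τ hτ
      rw [a0, hτw', ← hγτ, zero_sub, abs_neg, abs_of_nonneg hτ'.1] at c1
      rw [b0, zero_sub, abs_neg, abs_of_nonneg hτ.1, c1] at c2
      refine ⟨τ, hτ, ?_⟩
      rw [hγτ, ← hτw', c2, hτw]
    -- The value `0` serves when `u` is a vertex, where thinness does not apply because one
    -- coefficient vanishes.
    refine ⟨max (1 / 2 * Real.log R) 0, ?_⟩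
    intro x hxΩ y hyΩ z hzΩ Gxy Gyz Gzx hGxy hGyz hGzx u huG
    obtain ⟨x, hx, rfl⟩ := h.exists_rep hxΩ
    obtain ⟨y, hy, rfl⟩ := h.exists_rep hyΩ
    obtain ⟨z, hz, rfl⟩ := h.exists_rep hzΩ
    obtain ⟨s, t, hs, ht, u, hu, hue, rfl⟩ := h.geodesic_straight hSC hx hy hGxy huG
    have self : hilbertDist Ω (Projectivization.mk ℝ u (h.ne_zero hu))
        (Projectivization.mk ℝ u (h.ne_zero hu)) ≤ max (1 / 2 * Real.log R) 0 := by
      refine le_max_of_le_right ?_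
      have := h.hilbertDist_le (R := 1) hu hu (by simpa using hK.zero_mem)
        (by simpa using hK.zero_mem)
      simpa using this
    rcases hs.eq_or_lt with rfl | hs
    · exact ⟨_, Or.inl (cover hy hz hGyz t 0 ht le_rfl u hu (by rw [hue]; module)), self⟩
    rcases ht.eq_or_lt with rfl | ht
    · exact ⟨_, Or.inr (cover hz hx hGzx 0 s le_rfl hs.le u hu (by rw [hue]; module)), self⟩
    obtain ⟨s', t', hs', ht', w, hw, h1, h2⟩ := hR _ (hK.smul_mem_interior hs hx) _
      (hK.smul_mem_interior ht hy) z hz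
    rw [← hue] at h1 h2
    have hwK : w ∈ interior K := by
      simpa using hK.add_mem_interior h1 hu
    refine ⟨Projectivization.mk ℝ w (h.ne_zero hwK), ?_,
      (h.hilbertDist_le hu hwK h1 h2).trans (le_max_left _ _)⟩
    rcases hw with hw | hw
    · exact Or.inr (cover hz hx hGzx t' (s' * s) ht' (by positivity) w hwK (by rw [hw]; module))
    · exact Or.inl (cover hy hz hGyz (s' * t) t' (by positivity) ht' w hwK (by rw [hw]; module))

end IsLift

end Geodesics

end HilbertGeometry

namespace HilbertGeometry

open Filter Topology

/-! ### Strict convexity and regularity of the boundary, read on the cone -/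

section Boundary

variable {E : Type*} [NormedAddCommGroup E] [NormedSpace ℝ E] {K : Set E} {Ω : Set (ℙ ℝ E)}

theorem IsLift.isStrictlyConvex_iff (h : IsLift Ω K) :
    IsStrictlyConvex Ω ↔ IsStrictlyConvexCone K := by
  have hK := h.isProperCone
  constructor
  · intro hΩ x hx y hy hxy hli
    refine hΩ x y hli ?_
    obtain ⟨f, hf0, hf, hfxy⟩ := hK.exists_nonpos_of_notMem_interior hxy
    rw [map_add] at hfxy
    have hfx : f x = 0 := le_antisymm (by linarith [hf y hy]) (hf x hx)
    have hfy : f y = 0 := le_antisymm (by linarith [hf x hx]) (hf y hy)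
    rintro w ⟨a, b, ha, hb, hab, rfl⟩
    rw [h.mem_preimg_frontier_iff]
    refine ⟨fun h0 => ?_, Or.inl ⟨hK.convex hx hy ha hb hab, fun hint => ?_⟩⟩
    · have := LinearIndependent.pair_iff.1 hli a b h0
      linarith [this.1, this.2]
    · have := IsProperCone.pos_of_mem_interior hf0 hf hint
      simp [hfx, hfy] at this
  · intro hSC
    have key : ∀ u v : E, u ∈ K → LinearIndependent ℝ ![u, v] →
        ¬ (segment ℝ u v ⊆ preimg (frontier Ω)) := by
      intro u v hu hli hseg
      obtain ⟨ψ, c, hc, hψ⟩ := hK.exists_form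
      have hpos : ∀ {w : E}, w ∈ K → w ≠ 0 → 0 < ψ w := fun hw hw0 =>
        IsProperCone.pos_of_ne_zero hc hψ hw hw0
      have hu0 : u ≠ 0 := hli.ne_zero 0
      have hne : ∀ w ∈ segment ℝ u v, ψ w ≠ 0 := by
        intro w hw
        obtain ⟨hw0, h1 | h1⟩ := (h.mem_preimg_frontier_iff w).1 (hseg hw)
        · exact (hpos h1.1 hw0).ne'
        · have := hpos h1.1 (neg_ne_zero.2 hw0)
          rw [map_neg] at this
          linarith
      have hψu := hpos hu hu0
      -- A boundary segment cannot pass from `K` to `-K`, since `ψ` would vanish somewhere on it.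
      have hψv : 0 < ψ v := by
        by_contra! hcon
        have hs : 0 < ψ u - ψ v := by linarith
        refine hne ((-ψ v / (ψ u - ψ v)) • u + (ψ u / (ψ u - ψ v)) • v)
          ⟨_, _, div_nonneg (by linarith) hs.le, div_nonneg hψu.le hs.le, ?_, rfl⟩ ?_
        · rw [← add_div, neg_add_eq_sub, div_self hs.ne']
        · simp only [map_add, map_smul, smul_eq_mul]
          ring
      have hpK : ∀ w ∈ segment ℝ u v, 0 < ψ w → w ∈ K ∧ w ∉ interior K := by
        intro w hw hψw
        obtain ⟨hw0, h1 | h1⟩ := (h.mem_preimg_frontier_iff w).1 (hseg hw)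
        · exact h1
        · have := hpos h1.1 (neg_ne_zero.2 hw0)
          rw [map_neg] at this
          linarith
      have hv := (hpK v (right_mem_segment ℝ u v) hψv).1
      have hmid := (hpK ((1 / 2 : ℝ) • u + (1 / 2 : ℝ) • v)
        ⟨_, _, by norm_num, by norm_num, by norm_num, rfl⟩ (by
          simp only [map_add, map_smul, smul_eq_mul]
          linarith)).2
      refine hSC u hu v hv (fun hint => hmid ?_) hli
      rw [← smul_add]
      exact hK.smul_mem_interior (by norm_num) hint
    intro u v hli hseg
    obtain ⟨-, h1 | h1⟩ := (h.mem_preimg_frontier_iff u).1 (hseg (left_mem_segment ℝ u v))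
    · exact key u v h1.1 hli hseg
    · refine key (-u) (-v) h1.1 ?_ ?_
      · rw [LinearIndependent.pair_iff] at hli ⊢
        intro s t hst
        have := hli (-s) (-t) (by rw [← hst]; module)
        simpa using this
      · rintro w ⟨a, b, ha, hb, hab, rfl⟩
        rw [← neg_mem_preimg]
        exact hseg ⟨a, b, ha, hb, hab, by module⟩

/-- Lagrange multipliers: a form supporting `K` at `p` is locally minimal at `p` on the hypersurface
`F = 0`, hence proportional to the differential of `F`. The value at `e` fixes the factor. -/
theorem IsLift.isSmoothCone_of_hasC1Boundary [CompleteSpace E] (h : IsLift Ω K)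
    (hΩ : HasC1Boundary Ω) : IsSmoothCone K := by
  have hK := h.isProperCone
  intro p hp hp0 f g hf hg hfp hgp e he hfe hge
  have hpint : p ∉ interior K := fun hint => by
    have hf0 : f ≠ 0 := by
      rintro rfl
      simp at hfe
    exact (IsProperCone.pos_of_mem_interior hf0 hf hint).ne' hfp
  have hpfr := (h.mem_preimg_frontier_iff p).2 ⟨hp0, Or.inl ⟨hp, hpint⟩⟩
  obtain ⟨U, F, hU, hpU, hF, hF0, hUF⟩ := hΩ p hpfr
  have hstrict : HasStrictFDerivAt F (fderiv ℝ F p) p :=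
    (hF.contDiffAt (hU.mem_nhds hpU)).hasStrictFDerivAt one_ne_zero
  have hnp : -p ∉ K := fun hcon => hp0 (hK.eq_zero_of_neg_mem hp hcon)
  have hV : ∀ᶠ x in 𝓝 p, x ∈ U ∧ -x ∉ K :=
    (hU.eventually_mem hpU).and
      ((hK.isClosed.preimage continuous_neg).isOpen_compl.eventually_mem hnp)
  have main : ∀ f : StrongDual ℝ E, (∀ x ∈ K, 0 ≤ f x) → f p = 0 →
      ∃ c : ℝ, f = c • fderiv ℝ F p := by
    intro f hf hfp
    have hmin : IsLocalExtrOn f {x | F x = F p} p := by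
      left
      filter_upwards [nhdsWithin_le_nhds hV, self_mem_nhdsWithin] with x hx hFx
      have hFx : F x = F p := hFx
      rw [hfp]
      rw [(hUF p hpU).1 hpfr] at hFx
      obtain ⟨-, h1 | h1⟩ := (h.mem_preimg_frontier_iff x).1 ((hUF x hx.1).2 hFx)
      · exact hf x h1.1
      · exact absurd h1.1 hx.2
    obtain ⟨a, b, hab, hlin⟩ := hmin.exists_multipliers_of_hasStrictFDerivAt_1d hstrict
      f.hasStrictFDerivAt
    have hb : b ≠ 0 := by
      rintro rfl
      rw [zero_smul, add_zero, smul_eq_zero] at hlin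
      rcases hlin with rfl | hlin
      · exact hab rfl
      · exact hF0 p hpU hlin
    refine ⟨-(b⁻¹ * a), ?_⟩
    have : f = b⁻¹ • (b • f) := by rw [smul_smul, inv_mul_cancel₀ hb, one_smul]
    rw [this, eq_neg_of_add_eq_zero_right hlin]
    module
  obtain ⟨c, hc⟩ := main f hf hfp
  obtain ⟨c', hc'⟩ := main g hg hgp
  have h1 : c * fderiv ℝ F p e = 1 := by rw [← hfe, hc]; rfl
  have h2 : c' * fderiv ℝ F p e = 1 := by rw [← hge, hc']; rfl
  have h3 : fderiv ℝ F p e ≠ 0 := right_ne_zero_of_mul_eq_one h1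
  have h4 : c = c' := mul_right_cancel₀ h3 (h1.trans h2.symm)
  rw [hc, hc', h4]

/-- The defining function `F x` is the least `r` with `r e + x ∈ K`, that is, the maximum of `-f x`
over the compact set `B` of forms nonnegative on `K` with `f e = 1`. Smoothness makes the maximizer
unique, compactness makes it depend continuously on `x`, and the derivative of `F` is minus the
maximizer, with value `-1` at `e`. -/
theorem IsLift.hasC1Boundary_of_isSmoothCone [FiniteDimensional ℝ E] (h : IsLift Ω K)
    (hsm : IsSmoothCone K) : HasC1Boundary Ω := by
  have hK := h.isProperCone
  obtain ⟨e, he⟩ := hK.nonempty_interior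
  have he0 := h.ne_zero he
  set F : E → ℝ := fun x => coneRatio K (-x) e with hFdef
  have hFmem : ∀ x, F x • e + x ∈ K := fun x => by
    simpa using hK.coneRatio_mem (u := -x) he he0
  have hFnot : ∀ x, F x • e + x ∉ interior K := fun x => by
    simpa using hK.coneRatio_notMem_interior (u := -x) he he0
  have hF0 : ∀ x, F x = 0 ↔ x ∈ K ∧ x ∉ interior K := fun x => by
    constructor
    · intro h0
      have h1 := hFmem x
      have h2 := hFnot x
      rw [h0, zero_smul, zero_add] at h1 h2
      exact ⟨h1, h2⟩
    · rintro ⟨h1, h2⟩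
      exact hK.coneRatio_eq he he0 (by simpa using h1) (by simpa using h2)
  set B : Set (StrongDual ℝ E) := {f | (∀ v ∈ K, 0 ≤ f v) ∧ f e = 1} with hB
  have hex : ∀ x, ∃ f ∈ B, f x = -F x := by
    intro x
    obtain ⟨f, hf0, hf, hfx⟩ := hK.exists_nonpos_of_notMem_interior (hFnot x)
    have hfe := IsProperCone.pos_of_mem_interior hf0 hf he
    have hfx' := le_antisymm hfx (hf _ (hFmem x))
    rw [map_add, map_smul, smul_eq_mul] at hfx'
    refine ⟨(f e)⁻¹ • f, ⟨fun v hv => mul_nonneg (inv_nonneg.2 hfe.le) (hf v hv), ?_⟩, ?_⟩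
    · exact inv_mul_cancel₀ hfe.ne'
    · show (f e)⁻¹ * f x = -F x
      have : f x = f e * (-F x) := by linarith
      rw [this, inv_mul_cancel_left₀ hfe.ne']
  choose f hfB hfx using hex
  have hge : ∀ g ∈ B, ∀ y, -F y ≤ g y := by
    intro g hg y
    have := hg.1 _ (hFmem y)
    rw [map_add, map_smul, smul_eq_mul, hg.2] at this
    linarith
  obtain ⟨r, hr, hball⟩ := Metric.mem_nhds_iff.1 (mem_interior_iff_mem_nhds.1 he)
  have hBnorm : ∀ g ∈ B, ‖g‖ ≤ 2 / r := by
    intro g hg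
    refine g.opNorm_le_bound (by positivity) fun v => ?_
    have hle : ∀ v : E, g v ≤ 2 / r * ‖v‖ := by
      intro v
      rcases eq_or_ne v 0 with rfl | hv
      · simp
      have hv' : 0 < ‖v‖ := norm_pos_iff.2 hv
      have hmem : e - (r / 2 * ‖v‖⁻¹) • v ∈ K := by
        refine hball ?_
        rw [Metric.mem_ball, dist_eq_norm, sub_sub_cancel_left, norm_neg, norm_smul,
          Real.norm_of_nonneg (by positivity), mul_assoc, inv_mul_cancel₀ hv'.ne']
        linarith
      have := hg.1 _ hmem
      rw [map_sub, map_smul, smul_eq_mul, hg.2] at this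
      have h2 : r / 2 * ‖v‖⁻¹ * g v ≤ 1 := by linarith
      have h3 : g v = (2 / r * ‖v‖) * (r / 2 * ‖v‖⁻¹ * g v) := by field_simp
      rw [h3]
      exact mul_le_of_le_one_right (by positivity) h2
    rw [Real.norm_eq_abs, abs_le]
    have := hle (-v)
    rw [map_neg, norm_neg] at this
    exact ⟨by linarith, hle v⟩
  have happ : ∀ v : E, Continuous fun g : StrongDual ℝ E => g v := fun v => by fun_prop
  have hBcomp : IsCompact B := by
    refine Metric.isCompact_of_isClosed_isBounded ?_
      (isBounded_iff_forall_norm_le.2 ⟨2 / r, hBnorm⟩)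
    have : B = (⋂ v ∈ K, {g : StrongDual ℝ E | 0 ≤ g v}) ∩ {g | g e = 1} := by
      ext g
      simp [hB]
    rw [this]
    exact (isClosed_biInter fun v _ => isClosed_le continuous_const (happ v)).inter
      (isClosed_eq (happ e) continuous_const)
  have hFle : ∀ x y, F y - F x ≤ 2 / r * dist y x := by
    intro x y
    have h1 := hge _ (hfB y) x
    have h2 := hfx y
    have h3 := (le_abs_self _).trans ((f y).le_opNorm (x - y))
    rw [map_sub] at h3
    have h4 : ‖f y‖ * ‖x - y‖ ≤ 2 / r * dist y x := by
      rw [dist_comm, dist_eq_norm]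
      exact mul_le_mul_of_nonneg_right (hBnorm _ (hfB y)) (norm_nonneg _)
    linarith
  have hFcont : Continuous F := by
    refine (LipschitzWith.of_dist_le_mul (K := ⟨2 / r, by positivity⟩) fun x y => ?_).continuous
    rw [Real.dist_eq, abs_le]
    have h1 := hFle x y
    have h2 := hFle y x
    rw [dist_comm] at h1
    constructor
    · show -(2 / r * dist x y) ≤ _
      linarith
    · exact h2
  -- The apex of the cone is excluded, as the supporting form is unique only at nonzero boundary
  -- vectors.
  set U₀ : Set E := {x | F x • e + x ≠ 0} with hU₀
  have hU₀open : IsOpen U₀ := isOpen_ne_fun (by fun_prop) continuous_const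
  have hfcont : ∀ x ∈ U₀, ContinuousAt f x := by
    intro x hx
    rw [ContinuousAt, tendsto_iff_ultrafilter]
    intro 𝒱 h𝒱
    obtain ⟨g, hgB, hg⟩ := hBcomp.ultrafilter_le_nhds (𝒱.map f) (by
      rw [le_principal_iff]
      exact Filter.Eventually.of_forall (f := (𝒱 : Filter E)) hfB)
    have hg' : Tendsto f 𝒱 (𝓝 g) := hg
    have hid : Tendsto (fun y : E => y) 𝒱 (𝓝 x) := h𝒱
    have hgx : g x = -F x := by
      have h1 : Tendsto (fun y => f y y) 𝒱 (𝓝 (g x)) :=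
        (isBoundedBilinearMap_apply.continuous.tendsto (g, x)).comp (hg'.prodMk_nhds hid)
      have h2 : Tendsto (fun y => -F y) 𝒱 (𝓝 (-F x)) := ((hFcont.tendsto x).comp hid).neg
      exact tendsto_nhds_unique h1 (h2.congr fun y => (hfx y).symm)
    have : g = f x := by
      refine hsm _ (hFmem x) hx g (f x) hgB.1 (hfB x).1 ?_ ?_ e he hgB.2 (hfB x).2
      · rw [map_add, map_smul, hgB.2, hgx, smul_eq_mul, mul_one, add_neg_cancel]
      · rw [map_add, map_smul, (hfB x).2, hfx, smul_eq_mul, mul_one, add_neg_cancel]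
    rwa [← this]
  have hderiv : ∀ x ∈ U₀, HasFDerivAt F (-f x) x := by
    intro x hx
    refine HasFDerivAt.of_isLittleO (Asymptotics.isLittleO_iff.2 fun c hc => ?_)
    filter_upwards [Metric.tendsto_nhds.1 (hfcont x hx) c hc] with y hy
    have h1 := hge _ (hfB x) y
    have h2 := hge _ (hfB y) x
    have h3 := hfx x
    have h4 := hfx y
    -- The remainder lies between `0` and `(f x - f y) (y - x)`, because `f y` is optimal at `y` and
    -- `f x` at `x`; continuity of `f` makes it negligible.
    have h5 : F y - F x - (-f x) (y - x) = f x y - f y y := by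
      simp only [neg_apply, map_sub]
      linarith
    rw [h5, Real.norm_of_nonneg (by linarith)]
    have h6 := (le_abs_self _).trans ((f x - f y).le_opNorm (y - x))
    have h7 : (f x - f y) (y - x) = f x y - f y y - (f x x - f y x) := by
      simp only [sub_apply, map_sub]
    rw [h7] at h6
    have h8 : ‖f x - f y‖ * ‖y - x‖ ≤ c * ‖y - x‖ := by
      rw [dist_comm, dist_eq_norm] at hy
      exact mul_le_mul_of_nonneg_right hy.le (norm_nonneg _)
    linarith
  set U : Set E := U₀ ∩ {x | -x ∉ K} with hU
  have hUopen : IsOpen U := hU₀open.inter (hK.isClosed.preimage continuous_neg).isOpen_compl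
  have hUiff : ∀ w ∈ U, w ∈ preimg (frontier Ω) ↔ F w = 0 := by
    intro w hw
    rw [h.mem_preimg_frontier_iff, hF0]
    constructor
    · rintro ⟨-, h1 | h1⟩
      · exact h1
      · exact absurd h1.1 hw.2
    · intro h1
      refine ⟨?_, Or.inl h1⟩
      rintro rfl
      exact hw.2 (by simpa using hK.zero_mem)
  have hmemU : ∀ v, v ≠ 0 → v ∈ K → v ∉ interior K → v ∈ U := by
    intro v hv0 hv hv'
    refine ⟨?_, fun h' => hv0 (hK.eq_zero_of_neg_mem hv h')⟩
    rw [hU₀, Set.mem_ofPred_eq, (hF0 v).2 ⟨hv, hv'⟩, zero_smul, zero_add]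
    exact hv0
  have hFC1 : ∀ x ∈ U, ContDiffAt ℝ 1 F x := fun x hx =>
    contDiffAt_one_iff.2 ⟨fun y => -f y, U₀, hU₀open.mem_nhds hx.1,
      fun y hy => (hfcont y hy).neg.continuousWithinAt, hderiv⟩
  have hFd0 : ∀ x ∈ U, fderiv ℝ F x e = -1 := fun x hx => by
    rw [(hderiv x hx.1).fderiv, neg_apply, (hfB x).2]
  intro v hv
  obtain ⟨hv0, h1 | h1⟩ := (h.mem_preimg_frontier_iff v).1 hv
  · refine ⟨U, F, hUopen, hmemU v hv0 h1.1 h1.2, fun x hx => (hFC1 x hx).contDiffWithinAt,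
      fun x hx h0 => ?_, hUiff⟩
    have := hFd0 x hx
    rw [h0] at this
    simp at this
  · refine ⟨Neg.neg ⁻¹' U, fun x => F (-x), hUopen.preimage continuous_neg,
      hmemU (-v) (neg_ne_zero.2 hv0) h1.1 h1.2, fun x hx => ?_, fun x hx h0 => ?_, fun x hx => ?_⟩
    · exact ((hFC1 (-x) hx).comp x contDiff_neg.contDiffAt).contDiffWithinAt
    · have hd : HasFDerivAt (fun x => F (-x)) ((-f (-x)).comp (-ContinuousLinearMap.id ℝ E)) x :=
        (hderiv (-x) hx.1).comp x (hasFDerivAt_id x).neg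
      rw [hd.fderiv] at h0
      have := congrArg (fun g => g e) h0
      simp [(hfB (-x)).2] at this
    · rw [← hUiff (-x) hx, neg_mem_preimg]

end Boundary

end HilbertGeometry

namespace HilbertGeometry

open Filter Topology

/-! ### Orbit closures and limits of cones -/

section Orbits

variable {E : Type*} [NormedAddCommGroup E] [NormedSpace ℝ E] {K K' : Set E} {Ω : Set (ℙ ℝ E)}

theorem IsLift.subset_of_mem_interior (h : IsLift Ω K) (h' : IsLift Ω K') {e : E}
    (he : e ∈ interior K) (he' : e ∈ interior K') : K ⊆ K' := by
  obtain ⟨ψ, c, hc, hψ⟩ := h'.isProperCone.exists_form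
  intro w hw
  rcases eq_or_ne w 0 with rfl | hw0
  · exact h'.isProperCone.zero_mem
  have h1 := h.pos_of_closure_subset (h'.closure_subset_affineChart hc hψ) he
    (IsProperCone.pos_of_ne_zero hc hψ (interior_subset he') (h'.ne_zero he')) hw hw0
  rcases ((h'.mem_preimg_closure_iff w).1
    ((h.mem_preimg_closure_iff w).2 ⟨hw0, Or.inl hw⟩)).2 with h2 | h2
  · exact h2
  · have := IsProperCone.nonneg_of_mem hc hψ h2
    rw [map_neg] at this
    linarith

theorem IsLift.eq_of_mem_interior (h : IsLift Ω K) (h' : IsLift Ω K') {e : E}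
    (he : e ∈ interior K) (he' : e ∈ interior K') : K = K' :=
  (h.subset_of_mem_interior h' he he').antisymm (h'.subset_of_mem_interior h he' he)

theorem IsLift.exists_unit_near (h : IsLift Ω K) {v : E} (hv : v ∈ K) (hv1 : ‖v‖ = 1)
    {ε : ℝ} (hε : 0 < ε) : ∃ w ∈ interior K, ‖w‖ = 1 ∧ ‖w - v‖ < ε := by
  have hv0 : ‖v‖ ≠ 0 := by rw [hv1]; exact one_ne_zero
  have hc : Tendsto (fun x : E => ‖x‖⁻¹ • x) (𝓝 v) (𝓝 v) := by
    have : ContinuousAt (fun x : E => ‖x‖⁻¹ • x) v :=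
      (continuous_norm.continuousAt.inv₀ hv0).smul continuousAt_id
    simpa [ContinuousAt, hv1] using this
  have h1 := mem_closure_iff_frequently.1 (h.mem_closure_interior hv)
  obtain ⟨w, hw, hwε⟩ := (h1.and_eventually (Metric.tendsto_nhds.1 hc ε hε)).exists
  have hw0 : 0 < ‖w‖ := norm_pos_iff.2 (h.ne_zero hw)
  refine ⟨‖w‖⁻¹ • w, h.isProperCone.smul_mem_interior (inv_pos.2 hw0) hw, ?_, ?_⟩
  · rw [norm_smul, norm_inv, norm_norm, inv_mul_cancel₀ hw0.ne']
  · rwa [← dist_eq_norm]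

variable {d : ℕ}

theorem mem_preimg_smul_iff {Ω : Set (ℙ ℝ (Fin (d + 1) → ℝ))} (g : GL (Fin (d + 1)) ℝ)
    (v : Fin (d + 1) → ℝ) :
    v ∈ preimg ((fun x => (Matrix.ProjGenLinGroup.mk g) • x) '' Ω) ↔ g⁻¹ • v ∈ preimg Ω := by
  constructor
  · rintro ⟨hv, x, hx, e⟩
    have h1 : x = (Matrix.ProjGenLinGroup.mk g)⁻¹ • Projectivization.mk ℝ v hv := by
      rw [← e, inv_smul_smul]
    rw [← map_inv, Projectivization.PGL.mk_smul_mk] at h1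
    exact ⟨_, h1 ▸ hx⟩
  · rintro ⟨hv, h⟩
    have hv0 : v ≠ 0 := by
      rintro rfl
      simp at hv
    refine ⟨hv0, _, h, ?_⟩
    show Matrix.ProjGenLinGroup.mk g • _ = _
    rw [Projectivization.PGL.mk_smul_mk]
    congr 1
    exact smul_inv_smul g v

theorem IsLift.image {Ω : Set (ℙ ℝ (Fin (d + 1) → ℝ))} {K : Set (Fin (d + 1) → ℝ)}
    (h : IsLift Ω K) (g : GL (Fin (d + 1)) ℝ) :
    IsLift ((fun x => (Matrix.ProjGenLinGroup.mk g) • x) '' Ω) (glEquiv g '' K) where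
  isProperCone := h.isProperCone.image _
  mem_preimg_iff v := by
    have key : ∀ v, g⁻¹ • v ∈ interior K ↔ v ∈ interior (glEquiv g '' K) := by
      intro v
      rw [interior_image_equiv]
      constructor
      · intro hv
        exact ⟨_, hv, by simp⟩
      · rintro ⟨w, hw, rfl⟩
        simpa using hw
    rw [mem_preimg_smul_iff, h.mem_preimg_iff, key, ← smul_neg, key]

theorem mk_neg_eq (g : GL (Fin (d + 1)) ℝ) :
    Matrix.ProjGenLinGroup.mk (-g) = Matrix.ProjGenLinGroup.mk g := by
  rw [Matrix.ProjGenLinGroup.mk_eq_mk_iff]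
  refine ⟨-1, ?_⟩
  ext i j
  simp

/-- Hausdorff closeness concerns the symmetric sets `K ∪ -K`; the work is to choose signs. The form
`ψ` is at least `c` in absolute value on unit vectors above `Ω'`, so it does not vanish above nearby
domains and selects the half that converges to `K'`. -/
theorem exists_coneTendsto_of_mem_closure {Ω : Set (ℙ ℝ (Fin (d + 1) → ℝ))}
    {K K' : Set (Fin (d + 1) → ℝ)} (h : IsLift Ω K) {Ω' : ConvexOpens (Fin (d + 1) → ℝ)}
    (hΩ' : Ω' ∈ closure (pglOrbit Ω)) (h' : IsLift Ω'.1 K') :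
    ∃ g : ℕ → GL (Fin (d + 1)) ℝ, ConeTendsto (fun n => glEquiv (g n) '' K) K' := by
  obtain ⟨ψ, c, hc, hψ⟩ := h'.isProperCone.exists_form
  have hpos : ∀ {w}, w ∈ K' → w ≠ 0 → 0 < ψ w := fun hw hw0 =>
    IsProperCone.pos_of_ne_zero hc hψ hw hw0
  have hseq : ∀ n : ℕ, ∃ Ωn : ConvexOpens (Fin (d + 1) → ℝ), ∃ g : GL (Fin (d + 1)) ℝ,
      IsLift Ωn.1 (glEquiv g '' K) ∧ (∃ e ∈ interior (glEquiv g '' K), 0 ≤ ψ e) ∧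
      edist Ω' Ωn < ENNReal.ofReal (1 / ((n : ℝ) + 1)) := by
    intro n
    obtain ⟨Ωn, ⟨γ, hγ⟩, hd⟩ := EMetric.mem_closure_iff.1 hΩ' (ENNReal.ofReal (1 / ((n : ℝ) + 1)))
      (ENNReal.ofReal_pos.2 (by positivity))
    obtain ⟨g, rfl⟩ := Matrix.ProjGenLinGroup.mk_surjective γ
    obtain ⟨e, he⟩ := h.isProperCone.nonempty_interior
    have hl : ∀ g' : GL (Fin (d + 1)) ℝ, Matrix.ProjGenLinGroup.mk g' =
        Matrix.ProjGenLinGroup.mk g → IsLift Ωn.1 (glEquiv g' '' K) := fun g' hg' => by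
      rw [hγ, ← hg']
      exact h.image g'
    rcases le_total 0 (ψ (g • e)) with h1 | h1
    · refine ⟨Ωn, g, hl g rfl, ⟨g • e, ?_, h1⟩, hd⟩
      rw [interior_image_equiv]
      exact ⟨e, he, rfl⟩
    -- `-g` induces the same projective transformation and exchanges the two cones.
    · refine ⟨Ωn, -g, hl _ (mk_neg_eq g), ⟨(-g) • e, ?_, ?_⟩, hd⟩
      · rw [interior_image_equiv]
        exact ⟨e, he, rfl⟩
      · have : (-g) • e = -(g • e) := by
          rw [gl_smul_eq, gl_smul_eq, Units.val_neg, Matrix.neg_mulVec]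
        rw [this, map_neg]
        linarith
  choose Ωn g hl he hd using hseq
  refine ⟨g, ?_⟩
  have near : ∀ n, ∀ w ∈ preimg (Ωn n).1, ‖w‖ = 1 → ∃ v ∈ preimg Ω'.1, ‖v‖ = 1 ∧
      ‖w - v‖ < 1 / ((n : ℝ) + 1) := by
    intro n w hw hw1
    have hd' : Metric.hausdorffEDist (sphericalTrace (Ωn n).1) (sphericalTrace Ω'.1) <
        ENNReal.ofReal (1 / ((n : ℝ) + 1)) := by
      rw [Metric.hausdorffEDist_comm]
      exact hd n
    obtain ⟨v, hv, hwv⟩ := Metric.exists_edist_lt_of_hausdorffEDist_lt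
      (show w ∈ sphericalTrace (Ωn n).1 from ⟨hw1, hw⟩) hd'
    rw [edist_dist, ENNReal.ofReal_lt_ofReal_iff (by positivity), dist_eq_norm] at hwv
    exact ⟨v, hv.2, hv.1, hwv⟩
  have near' : ∀ n, ∀ v ∈ preimg Ω'.1, ‖v‖ = 1 → ∃ w ∈ preimg (Ωn n).1, ‖w‖ = 1 ∧
      ‖v - w‖ < 1 / ((n : ℝ) + 1) := by
    intro n v hv hv1
    obtain ⟨w, hw, hwv⟩ := Metric.exists_edist_lt_of_hausdorffEDist_lt
      (show v ∈ sphericalTrace Ω'.1 from ⟨hv1, hv⟩) (hd n)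
    rw [edist_dist, ENNReal.ofReal_lt_ofReal_iff (by positivity), dist_eq_norm] at hwv
    exact ⟨w, hw.2, hw.1, hwv⟩
  have hψn : ∀ᶠ n in hyperfilter ℕ, ∀ w ∈ interior (glEquiv (g n) '' K), 0 < ψ w := by
    have hlim : Tendsto (fun n : ℕ => ‖ψ‖ * (1 / ((n : ℝ) + 1))) (hyperfilter ℕ) (𝓝 (‖ψ‖ * 0)) :=
      tendsto_one_div_hyperfilter.const_mul _
    rw [mul_zero] at hlim
    filter_upwards [hlim.eventually_lt_const hc] with n hn
    have hne : ∀ w ∈ preimg (Ωn n).1, ψ w ≠ 0 := by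
      intro w hw h0
      have hw0 : 0 < ‖w‖ := norm_pos_iff.2 (ne_zero_of_mem_preimg hw)
      obtain ⟨v, hv, hv1, hwv⟩ := near n (‖w‖⁻¹ • w) (smul_mem_preimg hw (inv_pos.2 hw0).ne')
        (by rw [norm_smul, norm_inv, norm_norm, inv_mul_cancel₀ hw0.ne'])
      have h1 : c ≤ |ψ v| := by
        rcases (h'.mem_preimg_iff v).1 hv with h2 | h2
        · have := hψ v (interior_subset h2)
          rw [hv1, mul_one] at this
          exact this.trans (le_abs_self _)
        · have := hψ (-v) (interior_subset h2)
          rw [norm_neg, hv1, mul_one, map_neg] at this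
          exact this.trans (neg_le_abs _)
      have h2 := ψ.le_opNorm (‖w‖⁻¹ • w - v)
      rw [map_sub, map_smul, h0, smul_zero, zero_sub, norm_neg, Real.norm_eq_abs] at h2
      have h3 : ‖ψ‖ * ‖‖w‖⁻¹ • w - v‖ ≤ ‖ψ‖ * (1 / ((n : ℝ) + 1)) := by gcongr
      linarith
    obtain ⟨e, heK, hψe⟩ := he n
    have hψe' := lt_of_le_of_ne hψe (hne e ((hl n).mem_preimg heK)).symm
    intro w hw
    by_contra! hcon
    have hK := (hl n).isProperCone
    have h1 : (-ψ w) • e + (ψ e) • w ∈ interior (glEquiv (g n) '' K) :=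
      hK.add_mem_interior (hK.smul_mem _ (by linarith) e (interior_subset heK))
        (hK.smul_mem_interior hψe' hw)
    refine hne _ ((hl n).mem_preimg h1) ?_
    simp only [map_add, map_smul, smul_eq_mul]
    ring
  have hψn' : ∀ᶠ n in hyperfilter ℕ, ∀ w ∈ glEquiv (g n) '' K, 0 ≤ ψ w := by
    filter_upwards [hψn] with n hn w hw
    exact closure_minimal (t := {w | 0 ≤ ψ w}) (fun w hw => (hn w hw).le)
      (isClosed_le continuous_const ψ.continuous) ((hl n).mem_closure_interior hw)
  have normalize : ∀ {w : ℕ → Fin (d + 1) → ℝ} {v}, v ≠ 0 → Tendsto w (hyperfilter ℕ) (𝓝 v) →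
      Tendsto (fun n => ‖w n‖⁻¹ • w n) (hyperfilter ℕ) (𝓝 (‖v‖⁻¹ • v)) :=
    fun hv0 hw => (hw.norm.inv₀ (norm_ne_zero_iff.2 hv0)).smul hw
  have close : ∀ {a b : ℕ → Fin (d + 1) → ℝ} {v}, Tendsto a (hyperfilter ℕ) (𝓝 v) →
      (∀ᶠ n in hyperfilter ℕ, ‖a n - b n‖ < 1 / ((n : ℝ) + 1)) →
      Tendsto b (hyperfilter ℕ) (𝓝 v) := by
    intro a b v ha hab
    have h0 : Tendsto (fun n => a n - b n) (hyperfilter ℕ) (𝓝 0) :=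
      squeeze_zero_norm' (hab.mono fun n hn => hn.le) tendsto_one_div_hyperfilter
    simpa using ha.sub h0
  constructor
  · intro w hw v hv
    rcases eq_or_ne v 0 with rfl | hv0
    · exact h'.isProperCone.zero_mem
    have hw0 : ∀ᶠ n in hyperfilter ℕ, w n ≠ 0 := hv.eventually_ne hv0
    have hv1 := normalize hv0 hv
    have hunit : ∀ᶠ n in hyperfilter ℕ, ∃ u ∈ preimg Ω'.1,
        ‖‖w n‖⁻¹ • w n - u‖ < 2 * (1 / ((n : ℝ) + 1)) := by
      filter_upwards [hw, hw0] with n hn hn0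
      have hn1 : 0 < ‖w n‖ := norm_pos_iff.2 hn0
      have hunit1 : ‖‖w n‖⁻¹ • w n‖ = 1 := by
        rw [norm_smul, norm_inv, norm_norm, inv_mul_cancel₀ hn1.ne']
      obtain ⟨a, haK, ha1, han⟩ := (hl n).exists_unit_near
        ((hl n).isProperCone.smul_mem _ (inv_nonneg.2 hn1.le) _ hn) hunit1
        (show 0 < 1 / ((n : ℝ) + 1) by positivity)
      obtain ⟨u, hu, -, hau⟩ := near n a ((hl n).mem_preimg haK) ha1
      refine ⟨u, hu, ?_⟩
      rw [norm_sub_rev] at han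
      have := norm_sub_le_norm_sub_add_norm_sub (‖w n‖⁻¹ • w n) a u
      linarith
    obtain ⟨u, hu⟩ := hunit.choice
    have hulim : Tendsto u (hyperfilter ℕ) (𝓝 (‖v‖⁻¹ • v)) := by
      have h0 : Tendsto (fun n => ‖w n‖⁻¹ • w n - u n) (hyperfilter ℕ) (𝓝 0) := by
        refine squeeze_zero_norm' (hu.mono fun n hn => hn.2.le) ?_
        simpa using tendsto_one_div_hyperfilter.const_mul 2
      simpa using hv1.sub h0
    have hcl : ‖v‖⁻¹ • v ∈ K' ∪ Neg.neg ⁻¹' K' := by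
      refine (h'.isProperCone.isClosed.union
        (h'.isProperCone.isClosed.preimage continuous_neg)).mem_of_tendsto hulim ?_
      filter_upwards [hu] with n hn
      rcases (h'.mem_preimg_iff _).1 hn.1 with h1 | h1
      · exact Or.inl (interior_subset h1)
      · exact Or.inr (show -u n ∈ K' from interior_subset h1)
    have hvpos : 0 < ‖v‖ := norm_pos_iff.2 hv0
    have back : ∀ z : Fin (d + 1) → ℝ, ‖v‖⁻¹ • z ∈ K' → z ∈ K' := fun z hz => by
      have := h'.isProperCone.smul_mem _ hvpos.le _ hz
      rwa [smul_smul, mul_inv_cancel₀ hvpos.ne', one_smul] at this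
    rcases hcl with h1 | h1
    · exact back v h1
    · have h2 : -v ∈ K' := back _ (by rw [smul_neg]; exact h1)
      have h3 := hpos h2 (neg_ne_zero.2 hv0)
      have h4 : 0 ≤ ψ v := by
        refine ge_of_tendsto ((ψ.continuous.tendsto v).comp hv) ?_
        filter_upwards [hψn', hw] with n hn hwn using hn _ hwn
      rw [map_neg] at h3
      linarith
  · intro v hv
    rcases eq_or_ne v 0 with rfl | hv0
    · exact ⟨fun _ => 0, fun n => (hl n).isProperCone.zero_mem, tendsto_const_nhds⟩
    have hvpos : 0 < ‖v‖ := norm_pos_iff.2 hv0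
    have hv1 : ‖‖v‖⁻¹ • v‖ = 1 := by
      rw [norm_smul, norm_inv, norm_norm, inv_mul_cancel₀ hvpos.ne']
    have hvK := h'.isProperCone.smul_mem _ (inv_nonneg.2 hvpos.le) _ hv
    choose a haK ha1 han using fun n : ℕ => h'.exists_unit_near hvK hv1
      (show 0 < 1 / ((n : ℝ) + 1) by positivity)
    choose b hbΩ hb1 hbn using fun n => near' n (a n) (h'.mem_preimg (haK n)) (ha1 n)
    have halim : Tendsto a (hyperfilter ℕ) (𝓝 (‖v‖⁻¹ • v)) :=
      close tendsto_const_nhds (.of_forall fun n => by rw [norm_sub_rev]; exact han n)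
    have hblim : Tendsto b (hyperfilter ℕ) (𝓝 (‖v‖⁻¹ • v)) := close halim (.of_forall hbn)
    have hbK : ∀ᶠ n in hyperfilter ℕ, b n ∈ glEquiv (g n) '' K := by
      have hψv : 0 < ψ (‖v‖⁻¹ • v) := hpos hvK (smul_ne_zero (inv_pos.2 hvpos).ne' hv0)
      have hev := ((ψ.continuous.tendsto _).comp hblim).eventually_const_lt hψv
      filter_upwards [hev, hψn] with n hn1 hn2
      rcases ((hl n).mem_preimg_iff _).1 (hbΩ n) with h1 | h1
      · exact interior_subset h1
      · have h2 := hn2 _ h1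
        have hn1 : 0 < ψ (b n) := hn1
        rw [map_neg] at h2
        linarith
    classical
    refine ⟨fun n => if b n ∈ glEquiv (g n) '' K then ‖v‖ • b n else 0, fun n => ?_, ?_⟩
    · dsimp only
      split_ifs with hb
      · exact (hl n).isProperCone.smul_mem _ hvpos.le _ hb
      · exact (hl n).isProperCone.zero_mem
    · have h1 := hblim.const_smul ‖v‖
      rw [smul_smul, mul_inv_cancel₀ hvpos.ne', one_smul] at h1
      refine h1.congr' ?_
      filter_upwards [hbK] with n hn
      rw [if_pos hn]

/-- Compactness of the unit sphere upgrades pointwise convergence of cones to Hausdorff convergence: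
unit vectors staying at distance more than `η` from the other set would have a limit that
contradicts one of the two halves of `ConeTendsto`. -/
theorem mem_closure_pglOrbit {Ω : Set (ℙ ℝ (Fin (d + 1) → ℝ))}
    {K K' : Set (Fin (d + 1) → ℝ)} (h : IsLift Ω K) {Ω' : ConvexOpens (Fin (d + 1) → ℝ)}
    (h' : IsLift Ω'.1 K') {g : ℕ → GL (Fin (d + 1)) ℝ}
    (hlim : ConeTendsto (fun n => glEquiv (g n) '' K) K') : Ω' ∈ closure (pglOrbit Ω) := by
  have hl := fun n => h.image (g n)
  set Ωn : ℕ → ConvexOpens (Fin (d + 1) → ℝ) := fun n => ⟨_, (hl n).isProperlyConvexOpen⟩ with hΩn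
  have rep : ∀ {S : Set (ℙ ℝ (Fin (d + 1) → ℝ))} {C : Set (Fin (d + 1) → ℝ)}
      {P : (Fin (d + 1) → ℝ) → Prop}, IsLift S C → (∀ v, P v → P (-v)) →
      (∃ v, (‖v‖ = 1 ∧ v ∈ preimg S) ∧ P v) → ∃ v, ‖v‖ = 1 ∧ v ∈ C ∧ P v := by
    rintro S C P hS hP ⟨v, ⟨hv1, hv⟩, hPv⟩
    rcases (hS.mem_preimg_iff v).1 hv with h1 | h1
    · exact ⟨v, hv1, interior_subset h1, hPv⟩
    · exact ⟨-v, by rwa [norm_neg], interior_subset h1, hP v hPv⟩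
  have far_neg : ∀ {S : Set (ℙ ℝ (Fin (d + 1) → ℝ))} {η : ℝ} (v : Fin (d + 1) → ℝ),
      (∀ w ∈ sphericalTrace S, η < ‖v - w‖) → ∀ w ∈ sphericalTrace S, η < ‖-v - w‖ := by
    intro S η v hv w hw
    have := hv (-w) ⟨by rw [norm_neg, hw.1], neg_mem_preimg.2 hw.2⟩
    rwa [sub_neg_eq_add, ← norm_neg, neg_add, ← sub_eq_add_neg] at this
  rw [EMetric.mem_closure_iff]
  intro ε hε
  obtain ⟨η, hη, hηε⟩ : ∃ η : ℝ, 0 < η ∧ ENNReal.ofReal η < ε := by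
    obtain ⟨r, hr0, hrε⟩ := ENNReal.lt_iff_exists_nnreal_btwn.1 hε
    exact ⟨r, by exact_mod_cast hr0, by simpa using hrε⟩
  have ev1 : ∀ᶠ n in hyperfilter ℕ, ∀ v ∈ sphericalTrace Ω'.1,
      ∃ w ∈ sphericalTrace (Ωn n).1, ‖v - w‖ ≤ η := by
    by_contra hcon
    rw [← Ultrafilter.eventually_not] at hcon
    have hcon' : ∀ᶠ n in hyperfilter ℕ, ∃ v, ‖v‖ = 1 ∧ v ∈ K' ∧
        ∀ w ∈ sphericalTrace (Ωn n).1, η < ‖v - w‖ := by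
      filter_upwards [hcon] with n hn
      push Not at hn
      exact rep h' far_neg hn
    obtain ⟨v, hv⟩ := hcon'.choice
    obtain ⟨v₀, hv₀⟩ := exists_tendsto_hyperfilter (hv.mono fun n hn => hn.1.le)
    have hv₀1 : ‖v₀‖ = 1 :=
      tendsto_nhds_unique hv₀.norm (tendsto_const_nhds.congr' (hv.mono fun n hn => hn.1.symm))
    have hv₀K := h'.isProperCone.isClosed.mem_of_tendsto hv₀ (hv.mono fun n hn => hn.2.1)
    obtain ⟨w, hw, hwv⟩ := hlim.exists_seq v₀ hv₀K
    have hv₀0 : v₀ ≠ 0 := by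
      rintro rfl
      simp at hv₀1
    have hw1 : Tendsto (fun n => ‖w n‖⁻¹ • w n) (hyperfilter ℕ) (𝓝 v₀) := by
      have := (hwv.norm.inv₀ (norm_ne_zero_iff.2 hv₀0)).smul hwv
      simpa [hv₀1] using this
    have hd1 := Metric.tendsto_nhds.1 hw1 (η / 3) (by positivity)
    have hd2 := Metric.tendsto_nhds.1 hv₀ (η / 3) (by positivity)
    obtain ⟨n, h1, h2, h3, h4⟩ := (hd1.and (hd2.and (hv.and (hwv.eventually_ne hv₀0)))).exists
    have hn0 : 0 < ‖w n‖ := norm_pos_iff.2 h4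
    obtain ⟨a, haK, ha1, han⟩ := (hl n).exists_unit_near
      ((hl n).isProperCone.smul_mem _ (inv_nonneg.2 hn0.le) _ (hw n))
      (by rw [norm_smul, norm_inv, norm_norm, inv_mul_cancel₀ hn0.ne'])
      (show 0 < η / 3 by positivity)
    have h5 := h3.2.2 a ⟨ha1, (hl n).mem_preimg haK⟩
    rw [dist_eq_norm] at h1 h2
    have e : v n - a = (v n - v₀) - (‖w n‖⁻¹ • w n - v₀) - (a - ‖w n‖⁻¹ • w n) := by abel
    rw [e] at h5
    have h6 := norm_sub_le ((v n - v₀) - (‖w n‖⁻¹ • w n - v₀)) (a - ‖w n‖⁻¹ • w n)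
    have h7 := norm_sub_le (v n - v₀) (‖w n‖⁻¹ • w n - v₀)
    linarith
  have ev2 : ∀ᶠ n in hyperfilter ℕ, ∀ w ∈ sphericalTrace (Ωn n).1,
      ∃ v ∈ sphericalTrace Ω'.1, ‖w - v‖ ≤ η := by
    by_contra hcon
    rw [← Ultrafilter.eventually_not] at hcon
    have hcon' : ∀ᶠ n in hyperfilter ℕ, ∃ w, ‖w‖ = 1 ∧ w ∈ glEquiv (g n) '' K ∧
        ∀ v ∈ sphericalTrace Ω'.1, η < ‖w - v‖ := by
      filter_upwards [hcon] with n hn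
      push Not at hn
      exact rep (hl n) far_neg hn
    obtain ⟨w, hw⟩ := hcon'.choice
    obtain ⟨w₀, hw₀⟩ := exists_tendsto_hyperfilter (hw.mono fun n hn => hn.1.le)
    have hw₀1 : ‖w₀‖ = 1 :=
      tendsto_nhds_unique hw₀.norm (tendsto_const_nhds.congr' (hw.mono fun n hn => hn.1.symm))
    have hw₀K := hlim.mem w (hw.mono fun n hn => hn.2.1) w₀ hw₀
    obtain ⟨a, haK, ha1, han⟩ := h'.exists_unit_near hw₀K hw₀1 (show 0 < η / 2 by positivity)
    obtain ⟨n, h1, h2⟩ := ((Metric.tendsto_nhds.1 hw₀ (η / 2) (by positivity)).and hw).exists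
    have h3 := h2.2.2 a ⟨ha1, h'.mem_preimg haK⟩
    rw [dist_eq_norm] at h1
    have e : w n - a = (w n - w₀) - (a - w₀) := by abel
    rw [e] at h3
    have := norm_sub_le (w n - w₀) (a - w₀)
    linarith
  obtain ⟨n, h1, h2⟩ := (ev1.and ev2).exists
  refine ⟨Ωn n, ⟨Matrix.ProjGenLinGroup.mk (g n), rfl⟩, lt_of_le_of_lt ?_ hηε⟩
  refine Metric.hausdorffEDist_le_of_mem_edist (fun v hv => ?_) fun w hw => ?_
  · obtain ⟨w, hw, hd⟩ := h1 v hv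
    exact ⟨w, hw, by rw [edist_dist, dist_eq_norm]; exact ENNReal.ofReal_le_ofReal hd⟩
  · obtain ⟨v, hv, hd⟩ := h2 w hw
    exact ⟨v, hv, by rw [edist_dist, dist_eq_norm]; exact ENNReal.ofReal_le_ofReal hd⟩

end Orbits

end HilbertGeometry

namespace HilbertGeometry

open Filter Topology

/-! ### The dual domain and the dual cone -/

section Dual

variable {E : Type*} [NormedAddCommGroup E] [NormedSpace ℝ E]
  {Ω : Set (ℙ ℝ E)} {K : Set E}

theorem mem_neg_image {v : E} {S : Set E} :
    v ∈ ContinuousLinearEquiv.neg ℝ (M := E) '' S ↔ -v ∈ S := by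
  constructor
  · rintro ⟨w, hw, rfl⟩
    simpa using hw
  · exact fun hv => ⟨-v, hv, by simp⟩

theorem IsLift.neg (h : IsLift Ω K) : IsLift Ω (ContinuousLinearEquiv.neg ℝ (M := E) '' K) where
  isProperCone := h.isProperCone.image _
  mem_preimg_iff v := by
    rw [interior_image_equiv, mem_neg_image, mem_neg_image, neg_neg, h.mem_preimg_iff, or_comm]

theorem IsLift.connectedComponentIn_eq (h : IsLift Ω K) {v : E} (hv : v ∈ interior K) :
    connectedComponentIn (preimg Ω) v = interior K := by
  have hsub : interior K ⊆ preimg Ω := fun w hw => h.mem_preimg hw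
  refine Set.Subset.antisymm ?_ (IsPreconnected.subset_connectedComponentIn
    h.isProperCone.convex.interior.isPreconnected hv hsub)
  -- The preimage of `Ω` is the disjoint union of the open sets `interior K` and its opposite, so a
  -- connected part meeting the first stays in it.
  refine isPreconnected_connectedComponentIn.subset_left_of_subset_union isOpen_interior
    (isOpen_interior.preimage continuous_neg : IsOpen (Neg.neg ⁻¹' interior K))
    (Set.disjoint_left.2 fun w hw hw' => h.neg_notMem_interior (interior_subset hw) hw')
    (fun w hw => (h.mem_preimg_iff w).1 (connectedComponentIn_subset _ _ hw))
    ⟨v, mem_connectedComponentIn (hsub hv), hv⟩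

theorem IsLift.isConeAbove_iff (h : IsLift Ω K) (C : Set E) :
    IsConeAbove Ω C ↔ C = interior K ∨ 
      C = interior (ContinuousLinearEquiv.neg ℝ (M := E) '' K) := by
  constructor
  · rintro ⟨v, hv, rfl⟩
    rcases (h.mem_preimg_iff v).1 hv with hv' | hv'
    · exact Or.inl (h.connectedComponentIn_eq hv')
    · refine Or.inr (h.neg.connectedComponentIn_eq ?_)
      rwa [interior_image_equiv, mem_neg_image]
  · have key : ∀ {K}, IsLift Ω K → IsConeAbove Ω (interior K) := fun h => by
      obtain ⟨v, hv⟩ := h.isProperCone.nonempty_interior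
      exact ⟨v, h.mem_preimg hv, (h.connectedComponentIn_eq hv).symm⟩
    rintro (rfl | rfl)
    exacts [key h, key h.neg]

theorem IsLift.mem_dualCone_iff (h : IsLift Ω K) (f : StrongDual ℝ E) :
    f ∈ dualCone (interior K) ↔ ∀ v ∈ K, v ≠ 0 → 0 < f v := by
  have : closure (interior K) = K :=
    (closure_minimal interior_subset h.isProperCone.isClosed).antisymm
      fun v hv => h.mem_closure_interior hv
  simp [dualCone, this]

theorem IsLift.mem_preimg_dual_iff (h : IsLift Ω K) (f : StrongDual ℝ E) :
    f ∈ preimg (dual Ω) ↔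
      f ≠ 0 ∧ ((∀ v ∈ K, v ≠ 0 → 0 < f v) ∨ ∀ v ∈ K, v ≠ 0 → 0 < (-f) v) := by
  have hneg : ∀ f : StrongDual ℝ E, f ∈ dualCone (interior (ContinuousLinearEquiv.neg ℝ (M := E) '' K)) ↔
      ∀ v ∈ K, v ≠ 0 → 0 < (-f) v := fun f => by
    rw [h.neg.mem_dualCone_iff]
    constructor
    · intro hf v hv hv0
      simpa using hf (-v) (mem_neg_image.2 (by simpa using hv)) (neg_ne_zero.2 hv0)
    · intro hf v hv hv0
      simpa using hf (-v) (mem_neg_image.1 hv) (neg_ne_zero.2 hv0)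
  constructor
  · rintro ⟨hf, C, hC, f', hf', hfC, e⟩
    obtain ⟨a, rfl⟩ := (Projectivization.mk_eq_mk_iff' ℝ _ _ _ _).1 e
    refine ⟨hf, ?_⟩
    have hcases : (∀ v ∈ K, v ≠ 0 → 0 < f' v) ∨ ∀ v ∈ K, v ≠ 0 → 0 < (-f') v := by
      rcases (h.isConeAbove_iff C).1 hC with rfl | rfl
      · exact Or.inl ((h.mem_dualCone_iff f').1 hfC)
      · exact Or.inr ((hneg f').1 hfC)
    have ha : a ≠ 0 := fun ha => hf (by rw [ha, zero_smul])
    rcases ha.lt_or_gt with ha | ha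
    · rcases hcases with h1 | h1
      · refine Or.inr fun v hv hv0 => ?_
        have := mul_pos (neg_pos.2 ha) (h1 v hv hv0)
        simpa using this
      · refine Or.inl fun v hv hv0 => ?_
        have := mul_pos (neg_pos.2 ha) (h1 v hv hv0)
        simpa using this
    · rcases hcases with h1 | h1
      · refine Or.inl fun v hv hv0 => ?_
        have := mul_pos ha (h1 v hv hv0)
        simpa using this
      · refine Or.inr fun v hv hv0 => ?_
        have := mul_pos ha (h1 v hv hv0)
        simpa using this
  · rintro ⟨hf, h1 | h1⟩
    · exact ⟨hf, _, (h.isConeAbove_iff _).2 (Or.inl rfl), f, hf, (h.mem_dualCone_iff f).2 h1, rfl⟩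
    · exact ⟨hf, _, (h.isConeAbove_iff _).2 (Or.inr rfl), f, hf, (hneg f).2 h1, rfl⟩

end Dual

theorem IsProperCone.mem_interior_dotDual_iff {n : ℕ} {K : Set (Fin n → ℝ)}
    (hK : IsProperCone K) (w : Fin n → ℝ) :
    w ∈ interior (HilbertGeometry.dotDual K) ↔ ∀ v ∈ K, v ≠ 0 → 0 < w ⬝ᵥ v := by
  constructor
  · intro hw v hv hv0
    have := IsProperCone.pos_of_mem_interior (f := dotEquiv n v)
      (by simpa using hv0) (fun x hx => by
        rw [dotEquiv_apply, dotProduct_comm]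
        exact hx v hv) hw
    rwa [dotEquiv_apply, dotProduct_comm] at this
  · intro h
    by_contra hw
    obtain ⟨f, hf0, hf, hfw⟩ := hK.dotDual.exists_nonpos_of_notMem_interior hw
    obtain ⟨v, rfl⟩ := (dotEquiv n).surjective f
    have hv : v ∈ K := by
      rw [← hK.dotDual_dotDual]
      exact hf
    have := h v hv (by simpa using hf0)
    rw [dotEquiv_apply, dotProduct_comm] at hfw
    linarith

theorem IsLift.dual {d : ℕ} {Ω : Set (ℙ ℝ (Fin (d + 1) → ℝ))} {K : Set (Fin (d + 1) → ℝ)}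
    (h : IsLift Ω K) : IsLift (dual Ω) (dotEquiv (d + 1) '' dotDual K) where
  isProperCone := h.isProperCone.dotDual.image _
  mem_preimg_iff f := by
    obtain ⟨w, rfl⟩ := (dotEquiv (d + 1)).surjective f
    have hint : ∀ w, dotEquiv (d + 1) w ∈ interior (dotEquiv (d + 1) '' dotDual K) ↔
        ∀ v ∈ K, v ≠ 0 → 0 < w ⬝ᵥ v := fun w => by
      rw [interior_image_equiv, (dotEquiv (d + 1)).injective.mem_set_image,
        h.isProperCone.mem_interior_dotDual_iff]
    rw [h.mem_preimg_dual_iff, ← map_neg, hint, hint]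
    refine ⟨fun h => h.2, fun h' => ⟨fun h0 => ?_, h'⟩⟩
    have hw : w = 0 := by simpa using h0
    subst hw
    obtain ⟨e, he⟩ := h.isProperCone.nonempty_interior
    rcases h' with h' | h' <;>
    simpa using h' e (interior_subset he) (h.ne_zero he)

/-! ### Divisible domains -/

section Divisible

theorem ConeTendsto.const {E : Type*} [NormedAddCommGroup E] [NormedSpace ℝ E] {K : Set E}
    (hK : IsClosed K) : ConeTendsto (fun _ => K) K where
  mem _ hw _ hv := hK.mem_of_tendsto hv hw
  exists_seq v hv := ⟨fun _ => v, fun _ => hv, tendsto_const_nhds⟩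

/-- A strictly convex cone with a cocompact group of automorphisms is thin. -/
theorem IsStrictlyConvexCone.isThinCone {E : Type*} [NormedAddCommGroup E] [NormedSpace ℝ E]
    [FiniteDimensional ℝ E] [Nontrivial E] {K : Set E} (hSC : IsStrictlyConvexCone K)
    (hK : IsProperCone K) {ψ : StrongDual ℝ E} {c : ℝ} (hc : 0 < c)
    (hψ : ∀ x ∈ K, c * ‖x‖ ≤ ψ x) {e : E} (he : e ∈ interior K) {a : ℝ} (ha : 0 < a)
    (H : ∀ u ∈ interior K, ∃ L : E ≃L[ℝ] E, L '' K = K ∧ ψ (L u) = 1 ∧ a • L u - e ∈ K) :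
    ∃ R, IsThinCone R K := by
  by_contra! hthin
  choose x hx y hy z hz hxyz using fun n : ℕ => exists_triangle_of_not_isThinCone (hthin n)
  choose L hL hL1 hLe using fun n => H _ (hK.add_mem_interior (interior_subset (hx n)) (hy n))
  have hmem : ∀ n, ∀ {v}, v ∈ K → L n v ∈ K := fun n v hv => by
    rw [← hL n]
    exact ⟨v, hv, rfl⟩
  have : ProperSpace E := FiniteDimensional.proper_real E
  obtain ⟨u, hu⟩ := exists_tendsto_hyperfilter (w := fun n => L n (x n + y n)) (B := 1 / c)
    (Eventually.of_forall fun n => by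
      have := hψ _ (hmem n (hK.add_mem _ (interior_subset (hx n)) _ (interior_subset (hy n))))
      rw [hL1] at this
      rwa [le_div_iff₀' hc])
  -- This closed condition keeps the limit of the sums interior. The maps preserve `K`, so the limit
  -- cone is `K` itself.
  have hue : a • u - e ∈ K := hK.isClosed.mem_of_tendsto ((hu.const_smul a).sub_const e)
    (Eventually.of_forall hLe)
  have huK : u ∈ interior K := by
    have := hK.smul_mem_interior (inv_pos.2 ha) (hK.add_mem_interior hue he)
    rwa [sub_add_cancel, inv_smul_smul₀ ha.ne'] at this
  refine (ConeTendsto.const hK.isClosed).not_isStrictlyConvexCone (fun _ => hK) hK hc (fun _ => hψ)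
    (x := fun n => L n (x n)) (y := fun n => L n (y n)) (z := fun n => L n (z n))
    (fun n => hmem n (interior_subset (hx n))) (fun n => hmem n (interior_subset (hy n)))
    (fun n => hmem n (interior_subset (hz n))) (fun n => ?_) huK ?_ (fun n => ?_) hSC
  · rw [Ne, map_eq_zero_iff _ (L n).injective]
    exact hK.ne_zero_of_mem_interior (hz n)
  · simpa only [map_add] using hu
  · have := triangle_image (L n) (hxyz n)
    rwa [hL n] at this

variable {d : ℕ} {Ω : Set (ℙ ℝ (Fin (d + 1) → ℝ))} {K : Set (Fin (d + 1) → ℝ)}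

theorem isOpen_smul_image {S : Set (ℙ ℝ (Fin (d + 1) → ℝ))} (hS : IsOpen S)
    (γ : PGL(Fin (d + 1), ℝ)) : IsOpen ((fun x => γ • x) '' S) := by
  obtain ⟨g, rfl⟩ := Matrix.ProjGenLinGroup.mk_surjective γ
  rw [isOpen_iff_preimg]
  have : preimg ((fun x => Matrix.ProjGenLinGroup.mk g • x) '' S) = glEquiv g⁻¹ ⁻¹' preimg S := by
    ext v
    exact mem_preimg_smul_iff g v
  rw [this]
  exact (isOpen_iff_preimg.1 hS).preimage (glEquiv g⁻¹).continuous

/-- The group dividing `Ω` moves every point into a fixed compact set. -/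
theorem IsLift.exists_equiv_of_isDivisible (h : IsLift Ω K) (hdiv : IsDivisible Ω)
    {ψ : StrongDual ℝ (Fin (d + 1) → ℝ)} {c : ℝ} (hc : 0 < c) (hψ : ∀ x ∈ K, c * ‖x‖ ≤ ψ x)
    (e : Fin (d + 1) → ℝ) :
    ∃ a : ℝ, 0 < a ∧ ∀ u ∈ interior K, ∃ L : (Fin (d + 1) → ℝ) ≃L[ℝ] (Fin (d + 1) → ℝ),
      L '' K = K ∧ ψ (L u) = 1 ∧ a • L u - e ∈ K := by
  obtain ⟨Γ, -, hΓ, hcomp⟩ := hdiv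
  have hK := h.isProperCone
  -- An increasing exhaustion of `interior K` by open sets, with a homogeneous condition (hence the
  -- factor `ψ v`) so that it descends to `Ω`. By compactness a single `j` covers the quotient.
  set W : ℕ → Set (Fin (d + 1) → ℝ) := fun j =>
    {v | v ∈ interior K ∧ ((j : ℝ) + 1) • v - ψ v • e ∈ interior K} with hW
  set P : ℕ → Set (ℙ ℝ (Fin (d + 1) → ℝ)) := fun j =>
    {x | ∃ (v : Fin (d + 1) → ℝ) (hv : v ≠ 0), v ∈ W j ∧ x = Projectivization.mk ℝ v hv} with hP
  have hWsmul : ∀ j, ∀ a : ℝ, 0 < a → ∀ v ∈ W j, a • v ∈ W j := by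
    rintro j a ha v ⟨h1, h2⟩
    refine ⟨hK.smul_mem_interior ha h1, ?_⟩
    have := hK.smul_mem_interior ha h2
    convert this using 1
    rw [map_smul, smul_eq_mul]
    module
  have hWopen : ∀ j, IsOpen (W j) := fun j =>
    isOpen_interior.inter (isOpen_interior.preimage (by fun_prop))
  have hPopen : ∀ j, IsOpen (P j) := by
    intro j
    rw [isOpen_iff_preimg]
    have : preimg (P j) = W j ∪ Neg.neg ⁻¹' W j := by
      ext v
      constructor
      · rintro ⟨hv, w, hw, hwW, e⟩
        obtain ⟨a, rfl⟩ := (Projectivization.mk_eq_mk_iff' ℝ _ _ _ _).1 e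
        have ha : a ≠ 0 := fun ha => hv (by rw [ha, zero_smul])
        rcases ha.lt_or_gt with ha | ha
        · refine Or.inr ?_
          rw [Set.mem_preimage, ← neg_smul]
          exact hWsmul j _ (neg_pos.2 ha) w hwW
        · exact Or.inl (hWsmul j a ha w hwW)
      · rintro (hv | hv)
        · exact ⟨h.ne_zero hv.1, v, h.ne_zero hv.1, hv, rfl⟩
        · rw [← neg_mem_preimg]
          exact ⟨h.ne_zero hv.1, -v, h.ne_zero hv.1, hv, rfl⟩
    rw [this]
    exact (hWopen j).union ((hWopen j).preimage continuous_neg)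
  set U : ℕ → Set (quotientBy Ω Γ) := fun j => (Quotient.mk _) '' (Subtype.val ⁻¹' P j : Set Ω)
    with hU
  have hexact : ∀ {x y : Ω}, (Quotient.mk _ x : quotientBy Ω Γ) = Quotient.mk _ y →
      ∃ γ : Γ, γ • y.1 = x.1 := fun {x y} hxy => MulAction.orbitRel_apply.1
    (@Quotient.exact Ω ((MulAction.orbitRel Γ (ℙ ℝ (Fin (d + 1) → ℝ))).comap Subtype.val) x y hxy)
  have hUopen : ∀ j, IsOpen (U j) := by
    intro j
    -- The saturation of `P j` is the union of its translates under the group, which are open.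
    have : Quotient.mk _ ⁻¹' U j =
        (⋃ γ : Γ, Subtype.val ⁻¹' ((fun x => γ.1 • x) '' P j) : Set Ω) := by
      ext x
      simp only [hU, Set.mem_preimage, Set.mem_image, Set.mem_iUnion]
      constructor
      · rintro ⟨y, hy, hyx⟩
        obtain ⟨γ, hγ⟩ := hexact hyx.symm
        exact ⟨γ, y, hy, hγ⟩
      · rintro ⟨γ, y, hy, hyx⟩
        have hyΩ : y ∈ Ω := by
          rw [← (MulAction.injective γ.1).mem_set_image (s := Ω)]
          exact (hΓ _ γ.2).symm ▸ hyx ▸ x.2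
        exact ⟨⟨y, hyΩ⟩, hy, Quotient.sound' (Setoid.symm' _ (MulAction.orbitRel_apply.2 ⟨γ, hyx⟩))⟩
    rw [← isQuotientMap_quotient_mk'.isOpen_preimage]
    refine (congrArg IsOpen this).mpr (isOpen_iUnion fun γ => ?_)
    exact (isOpen_smul_image (hPopen j) γ.1).preimage continuous_subtype_val
  have hWmono : ∀ i j, i ≤ j → W i ⊆ W j := by
    rintro i j hij v ⟨h1, h2⟩
    refine ⟨h1, ?_⟩
    have h3 : ((j : ℝ) - i) • v ∈ K :=
      hK.smul_mem _ (sub_nonneg.2 (Nat.cast_le.2 hij)) _ (interior_subset h1)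
    have := hK.add_mem_interior h3 h2
    convert this using 1
    module
  obtain ⟨j, hj⟩ := isCompact_univ.elim_directed_cover U hUopen
    (fun q _ => by
      induction q using Quotient.ind with
      | _ x =>
        obtain ⟨v, hv, hx⟩ := h.exists_rep x.2
        obtain ⟨s, hs⟩ := hK.exists_smul_sub_mem_interior hv (ψ v • e)
        obtain ⟨j, hj⟩ := exists_nat_ge s
        refine Set.mem_iUnion.2 ⟨j, x, ⟨v, h.ne_zero hv, ⟨hv, ?_⟩, hx⟩, rfl⟩
        have h3 : ((j : ℝ) + 1 - s) • v ∈ K := hK.smul_mem _ (by linarith) _ (interior_subset hv)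
        convert hK.add_mem_interior h3 hs.2 using 1
        module)
    (fun i j => ⟨max i j, Set.image_mono (Set.preimage_mono (by
        rintro x ⟨v, hv, hvW, hx⟩
        exact ⟨v, hv, hWmono _ _ (le_max_left _ _) hvW, hx⟩)),
      Set.image_mono (Set.preimage_mono (by
        rintro x ⟨v, hv, hvW, hx⟩
        exact ⟨v, hv, hWmono _ _ (le_max_right _ _) hvW, hx⟩))⟩)
  refine ⟨j + 1, by positivity, fun u hu => ?_⟩
  obtain ⟨x, ⟨v, hv0, hvW, hxv⟩, hx⟩ := hj (Set.mem_univ (Quotient.mk _ ⟨_, h.mk_mem hu⟩))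
  obtain ⟨γ, hγ⟩ := hexact hx
  have hγ' : γ.1 • Projectivization.mk ℝ u (h.ne_zero hu) = Projectivization.mk ℝ v hv0 :=
    hγ.trans hxv
  obtain ⟨g, hg⟩ : ∃ g : GL (Fin (d + 1)) ℝ, Matrix.ProjGenLinGroup.mk g = γ.1 ∧ g • u ∈ W j := by
    obtain ⟨g, hg⟩ := Matrix.ProjGenLinGroup.mk_surjective γ.1
    rw [← hg, Projectivization.PGL.mk_smul_mk] at hγ'
    obtain ⟨a, ha⟩ := (Projectivization.mk_eq_mk_iff' ℝ _ _ _ _).1 hγ'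
    have ha0 : a ≠ 0 := by
      rintro rfl
      rw [zero_smul] at ha
      exact (map_ne_zero_iff _ (glEquiv g).injective).2 (h.ne_zero hu) ha.symm
    rcases ha0.lt_or_gt with ha' | ha'
    · refine ⟨-g, by rw [mk_neg_eq, hg], ?_⟩
      have : (-g) • u = (-a) • v := by
        rw [neg_smul, ha, gl_smul_eq, gl_smul_eq, Units.val_neg, Matrix.neg_mulVec]
      rw [this]
      exact hWsmul j _ (neg_pos.2 ha') v hvW
    · refine ⟨g, hg, ?_⟩
      rw [← ha]
      exact hWsmul j _ ha' v hvW
  obtain ⟨hg, hgW⟩ := hg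
  have hgK : glEquiv g '' K = K := by
    have h1 := h.image g
    rw [hg, hΓ _ γ.2] at h1
    refine h1.eq_of_mem_interior h (e := g • u) ?_ hgW.1
    rw [interior_image_equiv]
    exact ⟨u, hu, rfl⟩
  have hpos : 0 < ψ (g • u) :=
    IsProperCone.pos_of_ne_zero hc hψ (interior_subset hgW.1) (h.ne_zero hgW.1)
  have hsc : ∀ {t : ℝ} (ht : 0 < t),
      ContinuousLinearEquiv.smulLeft (R₁ := ℝ) (Units.mk0 t ht.ne') '' K = K := by
    intro t ht
    ext v
    constructor
    · rintro ⟨v, hv, rfl⟩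
      exact hK.smul_mem t ht.le v hv
    · exact fun hv => ⟨t⁻¹ • v, hK.smul_mem _ (inv_nonneg.2 ht.le) v hv, smul_inv_smul₀ ht.ne' v⟩
  -- The matrix `g` preserves `K` and sends `u` into `W j`; the final homothety normalizes `ψ` to
  -- `1`.
  refine ⟨(glEquiv g).trans
    (ContinuousLinearEquiv.smulLeft (Units.mk0 _ (inv_pos.2 hpos).ne')), ?_, ?_, ?_⟩
  · refine Eq.trans ?_ (hsc (inv_pos.2 hpos))
    nth_rw 2 [← hgK]
    exact Set.image_comp (ContinuousLinearEquiv.smulLeft (R₁ := ℝ) (Units.mk0 _ (inv_pos.2 hpos).ne'))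
      (glEquiv g) K
  · show ψ ((ψ (g • u))⁻¹ • (g • u)) = 1
    rw [map_smul, smul_eq_mul, inv_mul_cancel₀ hpos.ne']
  · show ((j : ℝ) + 1) • ((ψ (g • u))⁻¹ • (g • u)) - e ∈ K
    convert hK.smul_mem _ (inv_nonneg.2 hpos.le) _ (interior_subset hgW.2) using 1
    rw [smul_sub, inv_smul_smul₀ hpos.ne', smul_comm]

end Divisible

end HilbertGeometry

namespace HilbertGeometry

open Filter Topology

/-! ### The equivalences for a lifted domain -/

section Equivalences

variable {d : ℕ} {Ω : Set (ℙ ℝ (Fin (d + 1) → ℝ))} {K : Set (Fin (d + 1) → ℝ)}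

theorem IsThinCone.of_mem_closure_pglOrbit {R : ℝ} (hR : IsThinCone R K) (h : IsLift Ω K)
    {Ω' : ConvexOpens (Fin (d + 1) → ℝ)} (hΩ' : Ω' ∈ closure (pglOrbit Ω)) :
    ∃ K', IsLift Ω'.1 K' ∧ IsThinCone R K' := by
  obtain ⟨K', h'⟩ := Ω'.2.exists_isLift
  obtain ⟨g, hlim⟩ := exists_coneTendsto_of_mem_closure h hΩ' h'
  exact ⟨K', h', hlim.isThinCone (fun n => h.isProperCone.image _) h'.isProperCone
    fun n => hR.image _⟩

theorem IsLift.exists_mem_closure_pglOrbit (h : IsLift Ω K) {g : ℕ → GL (Fin (d + 1)) ℝ}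
    {K' : Set (Fin (d + 1) → ℝ)} (hK' : IsProperCone K')
    (hlim : ConeTendsto (fun n => glEquiv (g n) '' K) K') :
    ∃ Ω' ∈ closure (pglOrbit Ω), IsLift Ω'.1 K' := by
  obtain ⟨Ω', h'⟩ := hK'.exists_isLift
  exact ⟨⟨Ω', h'.isProperlyConvexOpen⟩, mem_closure_pglOrbit h h' hlim, h'⟩

theorem IsLift.exists_isThinCone_dotDual_iff (h : IsLift Ω K) :
    (∃ R, IsThinCone R (dotDual K)) ↔ ∃ R, IsThinCone R K := by
  refine ⟨fun ⟨R, hR⟩ => ?_, fun ⟨R, hR⟩ => hR.dotDual h.isProperCone⟩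
  have := hR.dotDual h.isProperCone.dotDual
  rwa [h.isProperCone.dotDual_dotDual] at this

theorem IsLift.isGromovHyperbolic_iff_forall_isStrictlyConvex (h : IsLift Ω K) :
    IsGromovHyperbolic Ω ↔ ∀ Ω' ∈ closure (pglOrbit Ω), IsStrictlyConvex Ω'.1 := by
  rw [h.isGromovHyperbolic_iff]
  constructor
  · rintro ⟨R, hR⟩ Ω' hΩ'
    obtain ⟨K', h', hR'⟩ := hR.of_mem_closure_pglOrbit h hΩ'
    exact h'.isStrictlyConvex_iff.2 (hR'.isStrictlyConvexCone h'.isProperCone)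
  · intro hSC
    by_contra! hthin
    obtain ⟨g, K', hK', hlim, -, -, hnot⟩ :=
      exists_limit_not_isStrictlyConvexCone h.isProperCone hthin
    obtain ⟨Ω', hΩ', h'⟩ := h.exists_mem_closure_pglOrbit hK' hlim
    exact hnot (h'.isStrictlyConvex_iff.1 (hSC Ω' hΩ'))

theorem IsLift.isGromovHyperbolic_iff_forall_hasC1Boundary (h : IsLift Ω K) :
    IsGromovHyperbolic Ω ↔ ∀ Ω' ∈ closure (pglOrbit Ω), HasC1Boundary Ω'.1 := by
  rw [h.isGromovHyperbolic_iff]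
  constructor
  · rintro ⟨R, hR⟩ Ω' hΩ'
    obtain ⟨K', h', hR'⟩ := hR.of_mem_closure_pglOrbit h hΩ'
    exact h'.hasC1Boundary_of_isSmoothCone (hR'.isSmoothCone h'.isProperCone)
  · intro hC1
    -- Smooth limits contradict non-thinness only through the dual cone, where corners of limits of
    -- `K` arise from flat faces.
    rw [← h.exists_isThinCone_dotDual_iff]
    by_contra! hthin
    obtain ⟨g, K', hK', hlim, hnot⟩ := exists_limit_not_isSmoothCone h.isProperCone hthin
    obtain ⟨Ω', hΩ', h'⟩ := h.exists_mem_closure_pglOrbit hK' hlim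
    exact hnot (h'.isSmoothCone_of_hasC1Boundary (hC1 Ω' hΩ'))

theorem IsLift.isGromovHyperbolic_dual_iff (h : IsLift Ω K) :
    IsGromovHyperbolic Ω ↔ IsGromovHyperbolic (HilbertGeometry.dual Ω) := by
  rw [h.isGromovHyperbolic_iff, h.dual.isGromovHyperbolic_iff]
  simp only [isThinCone_image_iff]
  exact h.exists_isThinCone_dotDual_iff.symm

theorem IsLift.isGromovHyperbolic_of_isDivisible (h : IsLift Ω K) (hdiv : IsDivisible Ω)
    (hSC : IsStrictlyConvex Ω) : IsGromovHyperbolic Ω := by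
  obtain ⟨ψ, c, hc, hψ⟩ := h.isProperCone.exists_form
  obtain ⟨e, he⟩ := h.isProperCone.nonempty_interior
  obtain ⟨a, ha, H⟩ := h.exists_equiv_of_isDivisible hdiv hc hψ e
  exact h.isGromovHyperbolic_iff.2
    ((h.isStrictlyConvex_iff.1 hSC).isThinCone h.isProperCone hc hψ he ha H)

end Equivalences

end HilbertGeometry

theorem mainTheorem8 (d : ℕ) (Ω : Set (ℙ ℝ (Fin (d + 1) → ℝ)))
    (hΩ : HilbertGeometry.IsProperlyConvexOpen Ω) :
    List.TFAE
      [HilbertGeometry.IsGromovHyperbolic Ω,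
       ∀ Ω' ∈ closure (HilbertGeometry.pglOrbit Ω), HilbertGeometry.IsStrictlyConvex Ω'.1,
       ∀ Ω' ∈ closure (HilbertGeometry.pglOrbit Ω), HilbertGeometry.HasC1Boundary Ω'.1] ∧
    (HilbertGeometry.IsGromovHyperbolic Ω ↔
      HilbertGeometry.IsGromovHyperbolic (HilbertGeometry.dual Ω)) ∧
    (HilbertGeometry.IsDivisible Ω → HilbertGeometry.IsStrictlyConvex Ω →
      HilbertGeometry.IsGromovHyperbolic Ω) := by
  obtain ⟨K, h⟩ := hΩ.exists_isLift
  refine ⟨?_, h.isGromovHyperbolic_dual_iff, h.isGromovHyperbolic_of_isDivisible⟩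
  tfae_have 1 ↔ 2 := h.isGromovHyperbolic_iff_forall_isStrictlyConvex
  tfae_have 1 ↔ 3 := h.isGromovHyperbolic_iff_forall_hasC1Boundary
  tfae_finish
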